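/- **Setting.** Fix $M\in\mathbb N=\{1,2,\dots\}$, masses $m_x,m_y>0$, $\delta>0$, a function $\varphi\in C_c^\infty(\mathbb R^3,\mathbb R)$ with support in the ball $B_\delta(0)$, and coefficients $g=(g_{rr's})\in\mathbb C^4\otimes\mathbb C^4\otimes\mathbb C^4$. Let $\mathcal Q^{(N)}=(\mathbb R^3)^M\times(\mathbb R^3)^N$ and $\mathcal Q=\bigsqcup_{N\ge 0}\mathcal Q^{(N)}$. A wave function $\Psi$ on spin-configuration space $\mathcal{Q}^{s}=\bigsqcup_{N\ge0}(\mathbb R^3\times\{1,2,3,4\})^{M+N}$ is a family of functions $\Psi^{(N)}_{r,s}:\mathcal Q^{(N)}\to\mathbb C$, $N\ge 0$, $r\in\{1,2,3,4\}^M$, $s\in\{1,2,3,4\}^N$ (no permutation symmetry is required); it is smooth if every $\Psi^{(N)}_{r,s}$ is smooth, and similarly for functions on $\mathbb R\times\mathcal Q^{s}$. With $\alpha^1,\alpha^2,\alpha^3,\beta$ the Dirac matrices (standard representation), the free Dirac operators are $$H^{\rm free}_{x_k}=-i\sum_{a=1}^3\alpha^a\frac{\partial}{\partial x_k^a}+m_x\beta,\qquad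 H^{\rm free}_{y_\ell}=-i\sum_{a=1}^3\alpha^a\frac{\partial}{\partial y_\ell^a}+m_y\beta,$$ with the matrices acting on the index $r_k$ and $s_\ell$, respectively. The single-time equation for $\Psi(t,\cdot)=\Psi_t$ is, for all $t\in\mathbb R$, $N\ge0$, $r$, $s$, $x=(x_1,\dots,x_M)$, $y=(y_1,\dots,y_N)$, $$\begin{aligned} i\,\partial_t\Psi^{(N)}_{r,s}(t,x,y)={}&\sum_{k=1}^M (H^{\rm free}_{x_k}\Psi)^{(N)}_{r,s}(t,x,y)+\sum_{\ell=1}^N (H^{\rm free}_{y_\ell}\Psi)^{(N)}_{r,s}(t,x,y)\\ &+\sqrt{N+1}\sum_{k=1}^M\sum_{r',s'=1}^4 \overline{g_{r'r_ks'}}\int_{B_\delta(x_k)}\varphi(\tilde y-x_k)\,\Psi^{(N+1)}_{r[k\to r'],(s,s')}\bigl(t,x,(y,\tilde y)\bigr)\,d\tilde y\\ &+\frac1{\sqrt N}\sum_{k=1}^M\sum_{\ell=1}^N\sum_{r'=1}^4 g_{r_kr's_\ell}\,\varphi(y_\ell-x_k)\,\Psi^{(N-1)}_{r[k\to r'],\,s\setminus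 s_\ell}\bigl(t,x,y\setminus y_\ell\bigr),\end{aligned}\tag{1}$$ where $r[k\to r']$ is $r$ with $k$-th entry replaced by $r'$, $\setminus$ removes the $\ell$-th entry, and the last line is absent for $N=0$. Put $\|\Psi_t\|^2=\sum_N\|\Psi_t^{(N)}\|^2$ and $\|N^{1/2}\Psi_t\|^2=\sum_N N\|\Psi_t^{(N)}\|^2$, with $\|\Psi_t^{(N)}\|^2=\sum_{r,s}\int_{\mathcal Q^{(N)}}|\Psi^{(N)}_{r,s}(t,q)|^2dq$. For a wave function $\Psi$ let $\operatorname{supp}\Psi$ be the smallest closed subset of $\mathcal Q$ outside which all components of $\Psi$ vanish almost everywhere, and let $\operatorname{supp}_{3x}\Psi$ (resp. $\operatorname{supp}_{3y}\Psi$) be the closure in $\mathbb R^3$ of the set of all positions $x_k$ (resp. $y_\ell$) occurring in configurations of $\operatorname{supp}\Psi$; $\operatorname{supp}_3\Psi=\operatorname{supp}_{3x}\Psi\cup\operatorname{supp}_{3y}\Psi$. For $G\subseteq\mathbb R^3$ and $\tau\ge0$ let $\operatorname{Gr}(G,\tau)=\{x'\in\mathbb R^3:\exists x\in G,\ \|x-x'\|\le\tau\}$.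 **Lemma.** (a) (Support growth.) Let $\Psi\in C^\infty(\mathbb R\times\mathcal Q^{s})$ solve (1), with $\|\Psi_t\|<\infty$ and $\|N^{1/2}\Psi_t\|<\infty$ for every $t\in\mathbb R$. Then for all $t\in\mathbb R$ $$\operatorname{supp}_{3x}\Psi_t\subseteq\operatorname{Gr}(\operatorname{supp}_{3x}\Psi_0,|t|),\qquad \operatorname{supp}_{3y}\Psi_t\subseteq\operatorname{Gr}(\operatorname{supp}_{3y}\Psi_0,|t|)\cup\operatorname{Gr}(\operatorname{supp}_{3x}\Psi_0,|t|+\delta),$$ and hence $\operatorname{supp}_{3}\Psi_t\subseteq\operatorname{Gr}(\operatorname{supp}_{3y}\Psi_0,|t|)\cup\operatorname{Gr}(\operatorname{supp}_{3x}\Psi_0,|t|+\delta)$. (b) (Uniqueness.) For every $\Psi_0\in C^\infty(\mathcal Q^{s})$ there is at most one solution $\Psi\in C^\infty(\mathbb R\times\mathcal Q^{s})$ of (1) with $\|\Psi_t\|<\infty$ and $\|N^{1/2}\Psi_t\|<\infty$ for every $t\in\mathbb R$ and with initial data $\Psi_0$ at $t=0$. -/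

import Mathlib

open MeasureTheory
open scoped ContDiff

noncomputable section

namespace DiracFock

/-- Physical space `ℝ³` with the Euclidean norm and Lebesgue measure. -/
abbrev Space : Type := EuclideanSpace ℝ (Fin 3)

/-- Configurations of `M` `x`-particles and `N` `y`-particles (the sector `N`). -/
abbrev Config (M N : ℕ) : Type := (Fin M → Space) × (Fin N → Space)

/-- The spin-free configuration space: the disjoint union of all sectors. -/
abbrev ConfigSpace (M : ℕ) : Type := Σ N : ℕ, Config M N

/-- Complex functions on the spin-configuration space: `Ψ N r s q` is the value at the
configuration `q` of the sector `N`, with spin indices `r` of the `x`-particles and `s` of the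
`y`-particles. No permutation symmetry is imposed. -/
abbrev Wave (M : ℕ) : Type :=
  ∀ N : ℕ, (Fin M → Fin 4) → (Fin N → Fin 4) → Config M N → ℂ

/-- The Dirac matrices `α¹, α², α³` in the standard (Dirac) representation. -/
def alpha (a : Fin 3) : Matrix (Fin 4) (Fin 4) ℂ :=
  match a with
  | 0 => !![0, 0, 0, 1; 0, 0, 1, 0; 0, 1, 0, 0; 1, 0, 0, 0]
  | 1 => !![0, 0, 0, -Complex.I; 0, 0, Complex.I, 0; 0, -Complex.I, 0, 0; Complex.I, 0, 0, 0]
  | 2 => !![0, 0, 1, 0; 0, 0, 0, -1; 1, 0, 0, 0; 0, -1, 0, 0]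

/-- The Dirac matrix `β` in the standard (Dirac) representation. -/
def beta : Matrix (Fin 4) (Fin 4) ℂ :=
  !![1, 0, 0, 0; 0, 1, 0, 0; 0, 0, -1, 0; 0, 0, 0, -1]

/-- The tangent vector of `Config M N` that moves `x`-particle `k` in the `a`-th direction. -/
def xDir {M N : ℕ} (k : Fin M) (a : Fin 3) : Config M N :=
  (Pi.single k (EuclideanSpace.single a (1 : ℝ)), 0)

/-- The tangent vector of `Config M N` that moves `y`-particle `l` in the `a`-th direction. -/
def yDir {M N : ℕ} (l : Fin N) (a : Fin 3) : Config M N :=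
  (0, Pi.single l (EuclideanSpace.single a (1 : ℝ)))

/-- The free Dirac operator acting on `x`-particle `k`. -/
def freeX {M : ℕ} (m : ℝ) (k : Fin M) (Ψ : Wave M) : Wave M := fun N r s q =>
  -Complex.I * ∑ a : Fin 3, ∑ r' : Fin 4,
      alpha a (r k) r' * fderiv ℝ (Ψ N (Function.update r k r') s) q (xDir k a)
    + (m : ℂ) * ∑ r' : Fin 4, beta (r k) r' * Ψ N (Function.update r k r') s q

/-- The sum over all `y`-particles of the free Dirac operators acting on them. -/
def freeY {M : ℕ} (m : ℝ) (Ψ : Wave M) : Wave M := fun N r s q =>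
  ∑ l : Fin N,
    (-Complex.I * ∑ a : Fin 3, ∑ s' : Fin 4,
        alpha a (s l) s' * fderiv ℝ (Ψ N r (Function.update s l s')) q (yDir l a)
      + (m : ℂ) * ∑ s' : Fin 4, beta (s l) s' * Ψ N r (Function.update s l s') q)

/-- The absorption term of `x`-particle `k`: the last `y`-particle of the sector `N + 1` is
integrated against the cut-off function centred at `x_k`. -/
def absorb {M : ℕ} (δ : ℝ) (φ : Space → ℝ) (g : Fin 4 → Fin 4 → Fin 4 → ℂ) (k : Fin M)
    (Ψ : Wave M) : Wave M := fun N r s q =>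
  (Real.sqrt ((N : ℝ) + 1) : ℂ) * ∑ r' : Fin 4, ∑ s' : Fin 4,
    (starRingEnd ℂ) (g r' (r k) s') *
      ∫ y in Metric.ball (q.1 k) δ, (φ (y - q.1 k) : ℂ) *
        Ψ (N + 1) (Function.update r k r') (Fin.snoc (α := fun _ => Fin 4) s s')
          (q.1, Fin.snoc (α := fun _ => Space) q.2 y)

/-- The emission term of `x`-particle `k`: one of the `N` `y`-particles has been created at
`y_l` out of the sector `N - 1`. It vanishes in the sector `0`. -/
def emit {M : ℕ} (φ : Space → ℝ) (g : Fin 4 → Fin 4 → Fin 4 → ℂ) (k : Fin M)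
    (Ψ : Wave M) : Wave M := fun N =>
  match N with
  | 0 => fun _ _ _ => 0
  | N + 1 => fun r s q =>
    (1 / (Real.sqrt ((N : ℝ) + 1) : ℂ)) * ∑ l : Fin (N + 1), ∑ r' : Fin 4,
      g (r k) r' (s l) * (φ (q.2 l - q.1 k) : ℂ) *
        Ψ N (Function.update r k r') (l.removeNth s) (q.1, l.removeNth q.2)

/-- The differential expression of the full Hamiltonian. -/
def hamiltonian {M : ℕ} (mx my δ : ℝ) (φ : Space → ℝ) (g : Fin 4 → Fin 4 → Fin 4 → ℂ)
    (Ψ : Wave M) : Wave M := fun N r s q =>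
  ∑ k : Fin M, freeX mx k Ψ N r s q + freeY my Ψ N r s q
    + ∑ k : Fin M, absorb δ φ g k Ψ N r s q + ∑ k : Fin M, emit φ g k Ψ N r s q

/-- Smoothness on the spin-configuration space, i.e. on every sector. -/
def SmoothWave {M : ℕ} (Ψ : Wave M) : Prop :=
  ∀ (N : ℕ) (r : Fin M → Fin 4) (s : Fin N → Fin 4), ContDiff ℝ ∞ (Ψ N r s)

/-- Joint smoothness in time and configuration. -/
def SmoothTimeWave {M : ℕ} (Ψ : ℝ → Wave M) : Prop :=
  ∀ (N : ℕ) (r : Fin M → Fin 4) (s : Fin N → Fin 4),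
    ContDiff ℝ ∞ (fun p : ℝ × Config M N => Ψ p.1 N r s p.2)

/-- The squared `L²` norm of the `N`-th sector of `Ψ`, as an extended nonnegative number. -/
def sectorNormSq {M : ℕ} (Ψ : Wave M) (N : ℕ) : ENNReal :=
  ∑ r : Fin M → Fin 4, ∑ s : Fin N → Fin 4, ∫⁻ q : Config M N, ‖Ψ N r s q‖ₑ ^ 2

/-- `‖Ψ‖²`. -/
def normSq {M : ℕ} (Ψ : Wave M) : ENNReal := ∑' N : ℕ, sectorNormSq Ψ N

/-- `‖N^{1/2} Ψ‖²`, with `N` the `y`-number operator. -/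
def numberNormSq {M : ℕ} (Ψ : Wave M) : ENNReal := ∑' N : ℕ, (N : ENNReal) * sectorNormSq Ψ N

/-- `Ψ` is a smooth classical solution of `i ∂Ψ/∂t = H Ψ` for all times, such that `‖Ψ_t‖` and
`‖N^{1/2} Ψ_t‖` are finite at every time. -/
structure IsStrongSolution {M : ℕ} (mx my δ : ℝ) (φ : Space → ℝ)
    (g : Fin 4 → Fin 4 → Fin 4 → ℂ) (Ψ : ℝ → Wave M) : Prop where
  smooth : SmoothTimeWave Ψ
  equation : ∀ (t : ℝ) (N : ℕ) (r : Fin M → Fin 4) (s : Fin N → Fin 4) (q : Config M N),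
    Complex.I * deriv (fun τ : ℝ => Ψ τ N r s q) t = hamiltonian mx my δ φ g (Ψ t) N r s q
  norm_finite : ∀ t : ℝ, normSq (Ψ t) < ⊤
  number_norm_finite : ∀ t : ℝ, numberNormSq (Ψ t) < ⊤

/-- The essential support in the spin-free configuration space: the smallest closed set outside
which `Ψ` vanishes almost everywhere (for all values of the spin indices). -/
def essSupport {M : ℕ} (Ψ : Wave M) : Set (ConfigSpace M) :=
  ⋂₀ {G : Set (ConfigSpace M) | IsClosed G ∧
    ∀ N : ℕ, ∀ᵐ q : Config M N, (⟨N, q⟩ : ConfigSpace M) ∉ G →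
      ∀ (r : Fin M → Fin 4) (s : Fin N → Fin 4), Ψ N r s q = 0}

/-- The 3-support of the `x`-particles. -/
def supp3x {M : ℕ} (Ψ : Wave M) : Set Space :=
  closure {x : Space | ∃ q ∈ essSupport Ψ, ∃ k : Fin M, q.2.1 k = x}

/-- The 3-support of the `y`-particles. -/
def supp3y {M : ℕ} (Ψ : Wave M) : Set Space :=
  closure {y : Space | ∃ q ∈ essSupport Ψ, ∃ l : Fin q.1, q.2.2 l = y}

/-- The 3-support. -/
def supp3 {M : ℕ} (Ψ : Wave M) : Set Space := supp3x Ψ ∪ supp3y Ψ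

/-- The set `G` grown by the distance `t`. -/
def grown (G : Set Space) (t : ℝ) : Set Space := {x' : Space | ∃ x ∈ G, ‖x - x'‖ ≤ t}

end DiracFock

end

/-!
Apart from the interaction, each particle evolves under a free Dirac operator, and the probability
current of a Dirac particle is at most its density (`norm_currentX_le`, `norm_currentY_le`, which
rest on the matrix bound `v · α ≤ ‖v‖`). Hence, under the free evolution, the integral of the density against
a weight on space-time does not grow if the weight does not increase along motions in which no
particle is faster than light (`IsConeFunction`, `transport_nonpos`). The proof applies such
localized energies to weights built from smooth backward light cones.

The interaction has to be treated as a perturbation. Without permutation symmetry, the absorption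
term, which always takes the last particle, is not the adjoint of the emission term; hence there is
no conservation law, and the terms are only estimated: on the sector `N`, relative to weights that
are compatible with creation and annihilation (`IsCompatible`), the interaction is bounded by
`√(N + 1)` times the neighbouring sectors (`exists_interaction_bound`). With `a N τ` the localized
energy of the sector `N`, this gives (`localEnergy_le`)

  `a N τ ≤ a N s + C √(N + 1) ∫ (a (N - 1) + a N + a (N + 1))` over `[s, τ]`,

first for weights of compact support and then, by Fatou's lemma, for all weights. The weights
`exp (b √(N + 1))` change by a bounded factor from `N` to `N + 1`, and the growth of `b` in time
makes up for the factor `√(N + 1)`. A ladder of this kind that starts from zero and is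
bounded by a multiple of `exp (c √(N + 1))` thus stays zero (`ladder_eq_zero`).

This requires a bound that is uniform in time, whereas the norm of a solution is only assumed to be
finite at each time. The bound comes from the ladder inequality with weight `1` and Baire's theorem:
the set of times near which it fails is closed, and if it were nonempty, the norms would be bounded
uniformly on an open piece of it, from which the Gronwall inequality carries the bound to the
adjacent gaps (`exists_uniform_ladder_bound`).

For the `x`-particles, the weight is a backward cone in one position `x_k`; the interaction does not
move the `x`-particles (`IsStrongSolution.x_mem_grown`). For the `y`-particles, the weight is the
number of `y`-particles in a backward cone that the `x`-particles, by the first part, cannot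
reach to within `δ` (`IsStrongSolution.y_mem_grown`). Uniqueness follows, since the difference of
two solutions with the same data has an empty initial support and there is at least one
`x`-particle.
-/

namespace DiracFock

open Set Filter Topology
open scoped ENNReal NNReal

/-! ### Gronwall inequalities for infinite ladders -/

/-- The sum of the sectors `N - 1`, `N` and `N + 1` of a family of functions of time. In the
sector `0` the truncated subtraction counts that sector twice, which only weakens the upper bounds
in which this sum is used. -/
noncomputable def neighbours (a : ℕ → ℝ → ℝ≥0∞) (N : ℕ) (τ : ℝ) : ℝ≥0∞ :=
  a (N - 1) τ + a N τ + a (N + 1) τ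

lemma sqrt_le_sqrt_add_one {m n : ℕ} (h : m ≤ n + 1) :
    √((m : ℝ) + 1) ≤ √((n : ℝ) + 1) + 1 := by
  have hm : (m : ℝ) ≤ n + 1 := by exact_mod_cast h
  rw [Real.sqrt_le_left (by positivity)]
  nlinarith [Real.sq_sqrt (show (0 : ℝ) ≤ (n : ℝ) + 1 by positivity),
    Real.sqrt_nonneg ((n : ℝ) + 1)]

lemma integral_exp_affine_le {b κ x τ : ℝ} (hκ : 0 < κ) (hx : 0 < x) :
    ∫ r in (0 : ℝ)..τ, Real.exp ((b + κ * r) * x) ≤ Real.exp ((b + κ * τ) * x) / (κ * x) := by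
  have hder : ∀ r ∈ uIcc 0 τ, HasDerivAt (fun r => Real.exp ((b + κ * r) * x) / (κ * x))
      (Real.exp ((b + κ * r) * x)) r := by
    intro r _
    have h1 : HasDerivAt (fun r : ℝ => (b + κ * r) * x) (κ * x) r := by
      simpa using (((hasDerivAt_id r).const_mul κ).const_add b).mul_const x
    have := h1.exp.div_const (κ * x)
    rwa [mul_div_assoc, div_self (by positivity), mul_one] at this
  rw [intervalIntegral.integral_eq_sub_of_hasDerivAt hder
    ((by fun_prop : Continuous _).intervalIntegrable _ _)]
  have : 0 ≤ Real.exp ((b + κ * 0) * x) / (κ * x) := by positivity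
  linarith

/-- A Gronwall inequality for an infinite ladder whose `N`-th rung is coupled to its neighbours
with strength `√(N + 1)`. Over times at most `1 / κ` the weight `exp (b √(N + 1))` is only
deteriorated to `exp ((b + κ τ) √(N + 1))`, so that an a priori bound with such a weight can be
halved again and again and only the contribution of the initial value `Q` remains. -/
lemma ladder_gronwall {a : ℕ → ℝ → ℝ≥0∞} {C c h K Q : ℝ} (hC : 0 < C) (hc : 0 ≤ c) (hK : 0 ≤ K)
    (hQ : 0 ≤ Q)
    (hineq : ∀ N : ℕ, ∀ τ ∈ Icc 0 h, a N τ ≤ ENNReal.ofReal Q +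
      ENNReal.ofReal (C * √((N : ℝ) + 1)) * ∫⁻ r in Icc 0 τ, neighbours a N r)
    (hap : ∀ N : ℕ, ∀ τ ∈ Icc 0 h, a N τ ≤ ENNReal.ofReal (K * Real.exp (c * √((N : ℝ) + 1))))
    (hh : 6 * C * Real.exp (c + 1) * h ≤ 1) :
    ∀ N : ℕ, ∀ τ ∈ Icc 0 h, a N τ ≤
      ENNReal.ofReal (2 * Q * Real.exp (6 * C * Real.exp (c + 1) * τ * √((N : ℝ) + 1))) := by
  -- `κ` is large enough for one iteration to halve the bound: there are three neighbours, and each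
  -- weight is at most `exp (c + 1)` times the weight of the sector `N`
  set κ := 6 * C * Real.exp (c + 1) with hκdef
  have hκ : 0 < κ := by positivity
  let w : ℝ → ℕ → ℝ → ℝ := fun b N r => Real.exp ((b + κ * r) * √((N : ℝ) + 1))
  -- the bound after `n` iterations of the inequality
  let B : ℕ → ℕ → ℝ → ℝ := fun n N r => 2 * Q * w 0 N r + K * (1 / 2) ^ n * w c N r
  have hwpos : ∀ b N r, 0 < w b N r := fun b N r => Real.exp_pos _
  have hBnn : ∀ n N r, 0 ≤ B n N r := fun n N r => by
    have := hwpos 0 N r; have := hwpos c N r; positivity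
  have hwstep : ∀ b, 0 ≤ b → b ≤ c → ∀ N m : ℕ, m ≤ N + 1 → ∀ r ∈ Icc 0 h,
      w b m r ≤ Real.exp (c + 1) * w b N r := by
    intro b hb hbc N m hm r hr
    simp only [w]
    rw [← Real.exp_add]
    apply Real.exp_le_exp.2
    have h1 := sqrt_le_sqrt_add_one hm
    have h2 : κ * r ≤ 1 := le_trans (by gcongr; exact hr.2) hh
    have h3 : 0 ≤ b + κ * r := add_nonneg hb (mul_nonneg hκ.le hr.1)
    nlinarith [mul_le_mul_of_nonneg_left h1 h3]
  have hBstep : ∀ n (N m : ℕ), m ≤ N + 1 → ∀ r ∈ Icc 0 h,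
      B n m r ≤ Real.exp (c + 1) * B n N r := by
    intro n N m hm r hr
    have h1 := hwstep 0 le_rfl hc N m hm r hr
    have h2 := hwstep c hc le_rfl N m hm r hr
    simp only [B]
    calc _ ≤ 2 * Q * (Real.exp (c + 1) * w 0 N r)
          + K * (1 / 2) ^ n * (Real.exp (c + 1) * w c N r) := by gcongr
      _ = _ := by ring
  have hwcont : ∀ b N, Continuous (w b N) := fun b N => by simp only [w]; fun_prop
  have hBcont : ∀ n N, Continuous (B n N) := fun n N =>
    ((hwcont 0 N).const_mul _).add ((hwcont c N).const_mul _)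
  have hint : ∀ n N : ℕ, ∀ τ ∈ Icc 0 h,
      C * √((N : ℝ) + 1) * ∫ r in (0 : ℝ)..τ, 3 * Real.exp (c + 1) * B n N r ≤ B n N τ / 2 := by
    intro n N τ hτ
    have hx : 0 < √((N : ℝ) + 1) := Real.sqrt_pos.2 (by positivity)
    have i1 := integral_exp_affine_le (b := 0) (τ := τ) hκ hx
    have i2 := integral_exp_affine_le (b := c) (τ := τ) hκ hx
    have : ∫ r in (0 : ℝ)..τ, 3 * Real.exp (c + 1) * B n N r
        ≤ 3 * Real.exp (c + 1) * (B n N τ / (κ * √((N : ℝ) + 1))) := by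
      rw [intervalIntegral.integral_const_mul]
      gcongr
      simp only [B]
      rw [intervalIntegral.integral_add (((hwcont 0 N).const_mul _).intervalIntegrable _ _)
        (((hwcont c N).const_mul _).intervalIntegrable _ _),
        intervalIntegral.integral_const_mul, intervalIntegral.integral_const_mul, add_div,
        mul_div_assoc, mul_div_assoc]
      gcongr
    calc _ ≤ C * √((N : ℝ) + 1) *
          (3 * Real.exp (c + 1) * (B n N τ / (κ * √((N : ℝ) + 1)))) := by gcongr
      _ = B n N τ / 2 := by
        rw [hκdef]; field_simp; ring
  have main : ∀ n : ℕ, ∀ N : ℕ, ∀ τ ∈ Icc 0 h, a N τ ≤ ENNReal.ofReal (B n N τ) := by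
    intro n
    induction n with
    | zero =>
      intro N τ hτ
      refine (hap N τ hτ).trans (ENNReal.ofReal_le_ofReal ?_)
      have h1 : Real.exp (c * √((N : ℝ) + 1)) ≤ w c N τ := by
        apply Real.exp_le_exp.2
        gcongr
        linarith [mul_nonneg hκ.le hτ.1]
      have h2 := hwpos 0 N τ
      simp only [B, pow_zero, mul_one]
      nlinarith [mul_le_mul_of_nonneg_left h1 hK, mul_nonneg hQ h2.le]
    | succ n ih =>
      intro N τ hτ
      refine (hineq N τ hτ).trans ?_
      have hle : ∫⁻ r in Icc 0 τ, neighbours a N r ≤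
          ENNReal.ofReal (∫ r in (0 : ℝ)..τ, 3 * Real.exp (c + 1) * B n N r) := by
        rw [intervalIntegral.integral_of_le hτ.1, ← integral_Icc_eq_integral_Ioc,
          ofReal_integral_eq_lintegral_ofReal]
        · refine setLIntegral_mono' measurableSet_Icc fun r hr => ?_
          have hr' : r ∈ Icc 0 h := ⟨hr.1, hr.2.trans hτ.2⟩
          have e1 := ih (N - 1) r hr'
          have e2 := ih N r hr'
          have e3 := ih (N + 1) r hr'
          have f1 := hBstep n N (N - 1) (by omega) r hr'
          have f2 := hBstep n N N (by omega) r hr'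
          have f3 := hBstep n N (N + 1) (by omega) r hr'
          calc neighbours a N r ≤ ENNReal.ofReal (B n (N - 1) r) + ENNReal.ofReal (B n N r)
                + ENNReal.ofReal (B n (N + 1) r) := by unfold neighbours; gcongr
            _ = ENNReal.ofReal (B n (N - 1) r + B n N r + B n (N + 1) r) := by
              rw [ENNReal.ofReal_add (add_nonneg (hBnn _ _ _) (hBnn _ _ _)) (hBnn _ _ _),
                ENNReal.ofReal_add (hBnn _ _ _) (hBnn _ _ _)]
            _ ≤ _ := ENNReal.ofReal_le_ofReal (by linarith)
        · exact ((hBcont n N).const_mul _).integrableOn_Icc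
        · exact ae_of_all _ fun r => mul_nonneg (by positivity) (hBnn _ _ _)
      calc _ ≤ ENNReal.ofReal Q + ENNReal.ofReal (C * √((N : ℝ) + 1)) *
            ENNReal.ofReal (∫ r in (0 : ℝ)..τ, 3 * Real.exp (c + 1) * B n N r) := by gcongr
        _ ≤ ENNReal.ofReal Q + ENNReal.ofReal (B n N τ / 2) := by
          rw [← ENNReal.ofReal_mul (by positivity)]
          gcongr
          exact hint n N τ hτ
        _ ≤ _ := by
          rw [← ENNReal.ofReal_add hQ (div_nonneg (hBnn _ _ _) zero_le_two)]
          apply ENNReal.ofReal_le_ofReal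
          have h1 : 1 ≤ w 0 N τ := by
            apply Real.one_le_exp
            have := mul_nonneg hκ.le hτ.1
            positivity
          simp only [B, pow_succ]
          nlinarith
  intro N τ hτ
  have hlim : Tendsto (fun n => ENNReal.ofReal (B n N τ)) atTop
      (𝓝 (ENNReal.ofReal (2 * Q * w 0 N τ + K * 0 * w c N τ))) := by
    apply ENNReal.tendsto_ofReal
    refine Tendsto.add tendsto_const_nhds (Tendsto.mul_const _ (Tendsto.const_mul _ ?_))
    exact tendsto_pow_atTop_nhds_zero_of_lt_one (by norm_num) (by norm_num)
  have := ge_of_tendsto' hlim fun n => main n N τ hτ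
  simpa [w] using this

/-- A ladder that starts from zero and has an a priori bound of the order `exp (c √(N + 1))` stays
zero: `ladder_gronwall` applies on successive time steps of a length that depends only on the
coupling. -/
lemma ladder_eq_zero {a : ℕ → ℝ → ℝ≥0∞} {C c T K : ℝ} (hC : 0 < C) (hc : 0 ≤ c) (hK : 0 ≤ K)
    (hzero : ∀ N, a N 0 = 0)
    (hineq : ∀ N : ℕ, ∀ s τ, 0 ≤ s → s ≤ τ → τ ≤ T → a N τ ≤ a N s +
      ENNReal.ofReal (C * √((N : ℝ) + 1)) * ∫⁻ r in Icc s τ, neighbours a N r)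
    (hap : ∀ N : ℕ, ∀ τ ∈ Icc 0 T, a N τ ≤ ENNReal.ofReal (K * Real.exp (c * √((N : ℝ) + 1)))) :
    ∀ N : ℕ, ∀ τ ∈ Icc 0 T, a N τ = 0 := by
  set κ := 6 * C * Real.exp (c + 1) with hκdef
  have hκ : 0 < κ := by positivity
  have main : ∀ n N : ℕ, ∀ τ ∈ Icc 0 T, τ ≤ n / κ → a N τ = 0 := by
    intro n
    induction n with
    | zero =>
      intro N τ hτ hn
      rw [Nat.cast_zero, zero_div] at hn
      rw [le_antisymm hn hτ.1, hzero]
    | succ n ih =>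
      intro N τ hτ hn
      rcases le_total τ (n / κ) with hle | hle
      · exact ih N τ hτ hle
      set s : ℝ := n / κ with hs
      have hs0 : 0 ≤ s := by positivity
      have key := ladder_gronwall (a := fun N r => a N (s + r)) (C := C) (c := c) (h := τ - s)
        (K := K) (Q := 0) hC hc hK le_rfl ?_ ?_ ?_ N (τ - s) ⟨by linarith, le_rfl⟩
      · simpa using key
      · intro N r hr
        have h1 := hineq N s (s + r) hs0 (by linarith [hr.1]) (by linarith [hr.2, hτ.2])
        rw [ih N s ⟨hs0, hle.trans hτ.2⟩ le_rfl] at h1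
        refine h1.trans (le_of_eq ?_)
        rw [ENNReal.ofReal_zero]
        congr 2
        have := (measurePreserving_add_left volume s).setLIntegral_comp_preimage_emb
          (measurableEmbedding_addLeft s) (neighbours a N) (Icc s (s + r))
        rw [← this]
        simp [neighbours]
      · intro N r hr
        exact hap N (s + r) ⟨by linarith [hr.1], by linarith [hr.2, hτ.2]⟩
      · rw [← hκdef]
        have : κ * s = n := by rw [hs]; field_simp
        have h2 : κ * τ ≤ n + 1 := by
          have := mul_le_mul_of_nonneg_left hn hκ.le
          push_cast at this
          rwa [mul_div_cancel₀ _ hκ.ne'] at this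
        nlinarith
  intro N τ hτ
  obtain ⟨n, hn⟩ := exists_nat_ge (τ * κ)
  exact main n N τ hτ (by rwa [le_div_iff₀ hκ])

/-- On every bounded time interval, a ladder that is bounded in `N` at each single time is bounded
by a multiple of `exp √(N + 1)`, uniformly in time. The times near which this fails form a closed
set `B`. If `B` were nonempty, then by Baire's theorem the ladder would be bounded uniformly on
`B ∩ U` for some open interval `U` that meets `B`. A time `t ∈ U` outside `B` is separated from `B`
by an interval with one end point `a ∈ B` and no other point of `B`; there the Gronwall inequality
from `t` to `a` gives some a priori bound, and then the one from `a` to `t` gives a bound that does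
not depend on `t`. Hence the points of `B ∩ U` would not belong to `B`. -/
theorem exists_uniform_ladder_bound {E : ℕ → ℝ → ℝ≥0∞} {C : ℝ} (hC : 0 < C)
    (hlsc : ∀ N, LowerSemicontinuous (E N))
    (hfin : ∀ t, ∃ Q : ℝ, 0 ≤ Q ∧ ∀ N, E N t ≤ ENNReal.ofReal Q)
    (hineq : ∀ σ : ℝ, σ = 1 ∨ σ = -1 → ∀ (N : ℕ) (s τ : ℝ), 0 ≤ τ → E N (s + σ * τ) ≤ E N s +
      ENNReal.ofReal (C * √((N : ℝ) + 1)) *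
        ∫⁻ r in Icc 0 τ, neighbours E N (s + σ * r)) (T : ℝ) :
    ∃ K : ℝ, 0 ≤ K ∧ ∀ t ∈ Icc (-T) T, ∀ N : ℕ,
      E N t ≤ ENNReal.ofReal (K * Real.exp √((N : ℝ) + 1)) := by
  -- the bound of the theorem on a set of times; the good times are those near which it holds
  let WB : Set ℝ → Prop := fun S => ∃ K : ℝ, 0 ≤ K ∧ ∀ t ∈ S, ∀ N : ℕ,
    E N t ≤ ENNReal.ofReal (K * Real.exp √((N : ℝ) + 1))
  have WBmono : ∀ S S' : Set ℝ, S ⊆ S' → WB S' → WB S := fun S S' h ⟨K, hK, hb⟩ =>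
    ⟨K, hK, fun t ht => hb t (h ht)⟩
  have WBunion : ∀ S S' : Set ℝ, WB S → WB S' → WB (S ∪ S') := by
    rintro S S' ⟨K, hK, hb⟩ ⟨K', hK', hb'⟩
    refine ⟨max K K', le_max_of_le_left hK, fun t ht N => ?_⟩
    rcases ht with ht | ht
    · refine (hb t ht N).trans (ENNReal.ofReal_le_ofReal ?_)
      gcongr; exact le_max_left _ _
    · refine (hb' t ht N).trans (ENNReal.ofReal_le_ofReal ?_)
      gcongr; exact le_max_right _ _
  let good : Set ℝ := {t | ∃ U ∈ 𝓝 t, WB U}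
  have hopen : IsOpen good := by
    rw [isOpen_iff_mem_nhds]
    rintro t ⟨U, hU, hWB⟩
    filter_upwards [eventually_mem_nhds_iff.2 hU] with s hs
    exact ⟨U, hs, hWB⟩
  have hcompact : ∀ S : Set ℝ, IsCompact S → S ⊆ good → WB S := by
    intro S hS hSg
    refine hS.induction_on (p := WB) ⟨0, le_rfl, by simp⟩ (fun s t h ht => WBmono s t h ht)
      (fun s t => WBunion s t) fun x hx => ?_
    obtain ⟨U, hU, hWB⟩ := hSg hx
    exact ⟨U, mem_nhdsWithin_of_mem_nhds hU, hWB⟩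
  set κ := 6 * C * Real.exp (1 + 1) with hκdef
  have hκ : 0 < κ := by positivity
  -- the Gronwall inequality from `s` to `t`, forwards or backwards in time; the constant of the
  -- a priori bound on the interval between them does not enter its conclusion
  have gron : ∀ s t Q : ℝ, κ * |t - s| ≤ 1 → WB (uIcc s t) → 0 ≤ Q →
      (∀ N, E N s ≤ ENNReal.ofReal Q) →
      ∀ N : ℕ, E N t ≤ ENNReal.ofReal (2 * Q * Real.exp √((N : ℝ) + 1)) := by
    rintro s t Q hst ⟨K, hK, hb⟩ hQ hs N
    obtain ⟨σ, hσ, ht⟩ : ∃ σ : ℝ, (σ = 1 ∨ σ = -1) ∧ t = s + σ * |t - s| := by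
      rcases le_total s t with h | h
      · exact ⟨1, Or.inl rfl, by rw [abs_of_nonneg (by linarith)]; ring⟩
      · exact ⟨-1, Or.inr rfl, by rw [abs_of_nonpos (by linarith)]; ring⟩
    have hmem : ∀ r ∈ Icc 0 |t - s|, s + σ * r ∈ uIcc s t := by
      intro r hr
      rcases hσ with rfl | rfl
      · have : s ≤ t := by rw [ht]; linarith [abs_nonneg (t - s)]
        rw [uIcc_of_le this]
        exact ⟨by linarith [hr.1], by rw [ht]; linarith [hr.2]⟩
      · have : t ≤ s := by rw [ht]; linarith [abs_nonneg (t - s)]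
        rw [uIcc_of_ge this]
        exact ⟨by rw [ht]; linarith [hr.2], by linarith [hr.1]⟩
    have key := ladder_gronwall (a := fun N r => E N (s + σ * r)) (C := C) (c := 1)
      (h := |t - s|) (K := K) (Q := Q) hC zero_le_one hK hQ ?_ ?_ hst N |t - s|
      ⟨abs_nonneg _, le_rfl⟩
    · simp only [← ht] at key
      refine key.trans (ENNReal.ofReal_le_ofReal ?_)
      gcongr
      exact mul_le_of_le_one_left (Real.sqrt_nonneg _) hst
    · intro N r hr
      refine (hineq σ hσ N s r hr.1).trans ?_
      gcongr
      exacts [hs N, le_rfl]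
    · intro N r hr
      simpa using hb _ (hmem r hr) N
  suffices hall : goodᶜ = ∅ by
    refine hcompact (Icc (-T) T) isCompact_Icc ?_
    rw [compl_empty_iff] at hall
    simp [hall]
  by_contra hne
  have hne : (goodᶜ).Nonempty := nonempty_iff_ne_empty.2 hne
  have hBcl : IsClosed goodᶜ := hopen.isClosed_compl
  have : Nonempty (goodᶜ : Set ℝ) := hne.to_subtype
  have : CompleteSpace (goodᶜ : Set ℝ) := hBcl.completeSpace_coe
  obtain ⟨n, x, hx⟩ := nonempty_interior_of_iUnion_of_closed
    (f := fun n : ℕ => {t : (goodᶜ : Set ℝ) | ∀ N, E N t ≤ ENNReal.ofReal n})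
    (fun n => by
      simp only [ofPred_forall]
      exact isClosed_iInter fun N =>
        ((hlsc N).isClosed_preimage _).preimage continuous_subtype_val)
    (by
      refine eq_univ_of_forall fun t => ?_
      obtain ⟨Q, -, hb⟩ := hfin t
      obtain ⟨n, hn⟩ := exists_nat_ge Q
      exact mem_iUnion.2 ⟨n, fun N => (hb N).trans (ENNReal.ofReal_le_ofReal hn)⟩)
  rw [mem_interior_iff_mem_nhds, Metric.mem_nhds_iff] at hx
  obtain ⟨ε, hε, hball⟩ := hx
  have hB : ∀ t ∈ goodᶜ, |t - x| < ε → ∀ N, E N t ≤ ENNReal.ofReal n := fun t ht hd =>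
    hball (show (⟨t, ht⟩ : (goodᶜ : Set ℝ)) ∈ Metric.ball x ε from hd)
  refine x.2 ⟨Metric.ball (x : ℝ) (min ε (1 / κ)), Metric.ball_mem_nhds _ (by positivity),
    2 * n, by positivity, fun t ht N => ?_⟩
  rw [Metric.mem_ball, Real.dist_eq, lt_min_iff] at ht
  by_cases htg : t ∈ good
  swap
  · refine (hB t htg ht.1 N).trans (ENNReal.ofReal_le_ofReal ?_)
    have h1 : 1 ≤ Real.exp √((N : ℝ) + 1) := Real.one_le_exp (Real.sqrt_nonneg _)
    nlinarith [(Nat.cast_nonneg n : (0 : ℝ) ≤ n)]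
  -- the bad time between `x` and `t` that is closest to `t`
  obtain ⟨a, ⟨haB, hax⟩, hmin⟩ := (isCompact_uIcc.inter_left hBcl : IsCompact
    (goodᶜ ∩ uIcc (x : ℝ) t)).exists_isMinOn ⟨x, x.2, left_mem_uIcc⟩
    (f := fun r => |t - r|) (by fun_prop)
  have hsub : uIcc a t ⊆ uIcc (x : ℝ) t := uIcc_subset_uIcc_right hax
  have hgood : ∀ r ∈ uIcc a t, r ≠ a → r ∈ good := by
    intro r hr hra
    by_contra hrB
    have h1 : |t - a| ≤ |t - r| := hmin ⟨hrB, hsub hr⟩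
    apply hra
    rcases le_total a t with h | h
    · rw [uIcc_of_le h] at hr
      rw [abs_of_nonneg (by linarith), abs_of_nonneg (by linarith [hr.2])] at h1
      linarith [hr.1]
    · rw [uIcc_of_ge h] at hr
      rw [abs_of_nonpos (by linarith), abs_of_nonpos (by linarith [hr.1])] at h1
      linarith [hr.2]
  have habs : ∀ r ∈ uIcc (x : ℝ) t, |t - r| ≤ |t - x| := fun r hr => by
    have := abs_sub_right_of_mem_uIcc hr
    exact this
  have hshort : ∀ r ∈ uIcc (x : ℝ) t, κ * |t - r| ≤ 1 := fun r hr => by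
    have := (habs r hr).trans ht.2.le
    rwa [le_div_iff₀ hκ, mul_comm] at this
  have hxa : |a - x| < ε := by
    have : |a - x| ≤ |t - x| := abs_sub_left_of_mem_uIcc hax
    linarith [ht.1]
  have hEa := hB a haB hxa
  obtain ⟨Q, hQ, hEt⟩ := hfin t
  refine gron a t n (hshort a hax) ⟨max (2 * Q) n, le_max_of_le_right (by positivity),
    fun r hr N => ?_⟩ (by positivity) hEa N
  by_cases hra : r = a
  · rw [hra]
    refine (hEa N).trans (ENNReal.ofReal_le_ofReal ?_)
    have h1 : 1 ≤ Real.exp √((N : ℝ) + 1) := Real.one_le_exp (Real.sqrt_nonneg _)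
    nlinarith [(Nat.cast_nonneg n : (0 : ℝ) ≤ n), le_max_right (2 * Q) (n : ℝ)]
  · refine (gron t r Q (by rw [abs_sub_comm]; exact hshort r (hsub hr)) ?_ hQ hEt N).trans
      (ENNReal.ofReal_le_ofReal ?_)
    · refine hcompact _ isCompact_uIcc fun r' hr' => ?_
      have hr'a : r' ∈ uIcc a t := by
        rw [uIcc_comm] at hr'
        exact uIcc_subset_uIcc_right hr hr'
      refine hgood r' hr'a fun h => ?_
      subst h
      apply hra
      rw [uIcc_comm] at hr'
      exact eq_of_mem_uIcc_of_mem_uIcc hr hr'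
    · gcongr
      exact le_max_left _ _

/-! ### Spin indices and the probability current -/

section Spin

variable {ι : Type*} [Fintype ι] [DecidableEq ι]

/-- Exchanging the old and the new value of one entry is an involution on pairs consisting of a
multi-index and a new value of its `k`-th entry. -/
lemma sum_update_swap {β : Type*} [AddCommMonoid β] (k : ι)
    (F : (ι → Fin 4) → (ι → Fin 4) → β) :
    ∑ r, ∑ b, F r (Function.update r k b) = ∑ r, ∑ b, F (Function.update r k b) r := by
  rw [← Fintype.sum_prod_type', ← Fintype.sum_prod_type']
  refine Finset.sum_nbij' (fun p => (Function.update p.1 k p.2, p.1 k))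
    (fun p => (Function.update p.1 k p.2, p.1 k)) ?_ ?_ ?_ ?_ ?_ <;> simp

lemma sum_sum_update (k : ι) {β : Type*} [AddCommMonoid β] (F : (ι → Fin 4) → β) :
    ∑ r, ∑ b, F (Function.update r k b) = 4 • ∑ r, F r := by
  rw [← sum_update_swap k (fun r _ => F r), Finset.smul_sum]
  simp

/-- The sesquilinear form of the matrix `A` acting on the `k`-th spin index. -/
noncomputable def spinForm (A : Matrix (Fin 4) (Fin 4) ℂ) (k : ι) (ψ χ : (ι → Fin 4) → ℂ) : ℂ :=
  ∑ r, ∑ b, (starRingEnd ℂ) (ψ r) * A (r k) b * χ (Function.update r k b)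

lemma spinForm_conj {A : Matrix (Fin 4) (Fin 4) ℂ} (hA : A.IsHermitian) (k : ι)
    (ψ χ : (ι → Fin 4) → ℂ) : (starRingEnd ℂ) (spinForm A k ψ χ) = spinForm A k χ ψ := by
  have h1 := sum_update_swap k fun r r' : ι → Fin 4 =>
    (starRingEnd ℂ) (χ r) * A (r k) (r' k) * ψ r'
  simp only [Function.update_self] at h1
  rw [spinForm, spinForm, h1, map_sum]
  refine Finset.sum_congr rfl fun r _ => ?_
  rw [map_sum]
  refine Finset.sum_congr rfl fun b _ => ?_
  have : (starRingEnd ℂ) (A (r k) b) = A b (r k) := hA.apply b (r k)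
  simp only [map_mul, Complex.conj_conj, this]
  ring

lemma isHermitian_alpha (a : Fin 3) : (alpha a).IsHermitian := by
  ext i j
  fin_cases a <;> fin_cases i <;> fin_cases j <;> simp [alpha]

lemma isHermitian_beta : beta.IsHermitian := by
  ext i j
  fin_cases i <;> fin_cases j <;> simp [beta]

/-- The matrix `v · α` is bounded by `‖v‖`, because its square is `‖v‖²`. -/
lemma re_alpha_form_le (v : Space) (ψ : Fin 4 → ℂ) :
    ∑ a, v a * (∑ b, ∑ c, (starRingEnd ℂ) (ψ b) * alpha a b c * ψ c).re
      ≤ ‖v‖ * ∑ b, ‖ψ b‖ ^ 2 := by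
  have hn : ‖v‖ ^ 2 = v 0 ^ 2 + v 1 ^ 2 + v 2 ^ 2 := by
    rw [EuclideanSpace.real_norm_sq_eq, Fin.sum_univ_three]
  rcases (norm_nonneg v).eq_or_lt with h0 | hpos
  · have : v = 0 := norm_eq_zero.1 h0.symm
    simp [this]
  generalize ‖v‖ = n at *
  -- the four components of `(v · α - ‖v‖) ψ`
  have key : 0 ≤
      ((v 2 * (ψ 2).re + v 0 * (ψ 3).re + v 1 * (ψ 3).im) - n * (ψ 0).re) ^ 2 +
      ((v 2 * (ψ 2).im + v 0 * (ψ 3).im - v 1 * (ψ 3).re) - n * (ψ 0).im) ^ 2 +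
      ((v 0 * (ψ 2).re - v 1 * (ψ 2).im - v 2 * (ψ 3).re) - n * (ψ 1).re) ^ 2 +
      ((v 0 * (ψ 2).im + v 1 * (ψ 2).re - v 2 * (ψ 3).im) - n * (ψ 1).im) ^ 2 +
      ((v 2 * (ψ 0).re + v 0 * (ψ 1).re + v 1 * (ψ 1).im) - n * (ψ 2).re) ^ 2 +
      ((v 2 * (ψ 0).im + v 0 * (ψ 1).im - v 1 * (ψ 1).re) - n * (ψ 2).im) ^ 2 +
      ((v 0 * (ψ 0).re - v 1 * (ψ 0).im - v 2 * (ψ 1).re) - n * (ψ 3).re) ^ 2 +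
      ((v 0 * (ψ 0).im + v 1 * (ψ 0).re - v 2 * (ψ 1).im) - n * (ψ 3).im) ^ 2 := by positivity
  refine le_of_mul_le_mul_left ?_ (mul_pos two_pos hpos)
  rw [← sub_nonneg]
  refine key.trans_eq ?_
  simp only [Fin.sum_univ_three, Fin.sum_univ_four, Complex.sq_norm, Complex.normSq_apply, alpha]
  simp
  linear_combination (-((ψ 0).re ^ 2 + (ψ 0).im ^ 2 + (ψ 1).re ^ 2 + (ψ 1).im ^ 2 + (ψ 2).re ^ 2
    + (ψ 2).im ^ 2 + (ψ 3).re ^ 2 + (ψ 3).im ^ 2)) * hn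

lemma re_spinForm_alpha_le (v : Space) (k : ι) (ψ : (ι → Fin 4) → ℂ) :
    ∑ a, v a * (spinForm (alpha a) k ψ ψ).re ≤ ‖v‖ * ∑ r, ‖ψ r‖ ^ 2 := by
  -- averaging over the value of the `k`-th index reduces the claim to a single spinor
  have h1 : ∀ a, 4 * (spinForm (alpha a) k ψ ψ).re = ∑ r, (∑ b, ∑ c,
      (starRingEnd ℂ) (ψ (Function.update r k b)) * alpha a b c *
        ψ (Function.update r k c)).re := by
    intro a
    have := sum_sum_update k (fun r => ∑ c, (starRingEnd ℂ) (ψ r) * alpha a (r k) c *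
        ψ (Function.update r k c))
    simp only [Function.update_self, Function.update_idem] at this
    rw [← Complex.re_sum, this, spinForm]
    simp
  have h2 : ∑ r, ∑ b, ‖ψ (Function.update r k b)‖ ^ 2 = 4 * ∑ r, ‖ψ r‖ ^ 2 := by
    simpa using sum_sum_update k (fun r => ‖ψ r‖ ^ 2)
  have h3 : 4 * ∑ a, v a * (spinForm (alpha a) k ψ ψ).re ≤ 4 * (‖v‖ * ∑ r, ‖ψ r‖ ^ 2) := by
    calc 4 * ∑ a, v a * (spinForm (alpha a) k ψ ψ).re
        = ∑ a, v a * (4 * (spinForm (alpha a) k ψ ψ).re) := by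
          rw [Finset.mul_sum]; exact Finset.sum_congr rfl fun a _ => by ring
      _ = ∑ r, ∑ a, v a * (∑ b, ∑ c, (starRingEnd ℂ) (ψ (Function.update r k b)) * alpha a b c *
            ψ (Function.update r k c)).re := by
          simp_rw [h1, Finset.mul_sum]; exact Finset.sum_comm
      _ ≤ ∑ r, ‖v‖ * ∑ b, ‖ψ (Function.update r k b)‖ ^ 2 :=
          Finset.sum_le_sum fun r _ => re_alpha_form_le v fun b => ψ (Function.update r k b)
      _ = _ := by rw [← Finset.mul_sum, h2]; ring
  linarith

variable {E : Type*} [NormedAddCommGroup E] [NormedSpace ℝ E]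

/-- The `a`-th component of the probability current carried by the `k`-th spin index. -/
noncomputable def current (ψ : (ι → Fin 4) → E → ℂ) (k : ι) (a : Fin 3) (q : E) : ℝ :=
  (spinForm (alpha a) k (fun r => ψ r q) (fun r => ψ r q)).re

lemma fderiv_current {ψ : (ι → Fin 4) → E → ℂ} {q : E}
    (hψ : ∀ r, DifferentiableAt ℝ (ψ r) q) (k : ι) (a : Fin 3) (v : E) :
    DifferentiableAt ℝ (current ψ k a) q ∧ fderiv ℝ (current ψ k a) q v =
      2 * (spinForm (alpha a) k (fun r => ψ r q) (fun r => fderiv ℝ (ψ r) q v)).re := by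
  have hd := fun r => (hψ r).hasFDerivAt
  have h1 : HasFDerivAt (fun q => spinForm (alpha a) k (fun r => ψ r q) (fun r => ψ r q))
      (∑ r, ∑ b, (((starRingEnd ℂ) (ψ r q) * alpha a (r k) b) •
          fderiv ℝ (ψ (Function.update r k b)) q +
        (ψ (Function.update r k b) q) • ((alpha a (r k) b) •
          (Complex.conjCLE.toContinuousLinearMap.comp (fderiv ℝ (ψ r) q))))) q := by
    unfold spinForm
    refine HasFDerivAt.fun_sum fun r _ => HasFDerivAt.fun_sum fun b _ => ?_
    have hc : HasFDerivAt (fun q => (starRingEnd ℂ) (ψ r q))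
        (Complex.conjCLE.toContinuousLinearMap.comp (fderiv ℝ (ψ r) q)) q :=
      (Complex.conjCLE.toContinuousLinearMap.hasFDerivAt).comp q (hd r)
    exact (hc.mul_const (alpha a (r k) b)).mul (hd (Function.update r k b))
  have h2 := (Complex.reCLM.hasFDerivAt).comp q h1
  refine ⟨h2.differentiableAt, ?_⟩
  have h3 : fderiv ℝ (current ψ k a) q = _ := h2.fderiv
  have h4 : (spinForm (alpha a) k (fun r => fderiv ℝ (ψ r) q v) (fun r => ψ r q)).re =
      (spinForm (alpha a) k (fun r => ψ r q) (fun r => fderiv ℝ (ψ r) q v)).re := by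
    rw [← spinForm_conj (isHermitian_alpha a), Complex.conj_re]
  rw [h3, two_mul]
  nth_rewrite 2 [← h4]
  simp only [spinForm, ← Complex.add_re, ← Finset.sum_add_distrib]
  simp only [ContinuousLinearMap.comp_apply, _root_.sum_apply,
    _root_.add_apply, _root_.smul_apply, smul_eq_mul,
    Complex.reCLM_apply, ContinuousLinearEquiv.coe_coe, Complex.conjCLE_apply]
  congr 1
  refine Finset.sum_congr rfl fun r _ => Finset.sum_congr rfl fun b _ => ?_
  ring

/-- The continuity equation of the free Dirac operator that acts on one spin index: the mass term
does not contribute since `β` is Hermitian, and the kinetic term yields the divergence of the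
current since the `α` matrices are Hermitian. -/
lemma two_im_free_eq {ψ : (ι → Fin 4) → E → ℂ} {q : E} (hψ : ∀ r, DifferentiableAt ℝ (ψ r) q)
    (k : ι) (m : ℝ) (d : Fin 3 → E) :
    2 * (∑ r, (starRingEnd ℂ) (ψ r q) *
      (-Complex.I * ∑ a : Fin 3, ∑ b : Fin 4,
          alpha a (r k) b * fderiv ℝ (ψ (Function.update r k b)) q (d a)
        + (m : ℂ) * ∑ b : Fin 4, beta (r k) b * ψ (Function.update r k b) q)).im
      = -∑ a, fderiv ℝ (current ψ k a) q (d a) := by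
  have hβ : (spinForm beta k (fun r => ψ r q) (fun r => ψ r q)).im = 0 :=
    Complex.conj_eq_iff_im.1 (spinForm_conj isHermitian_beta k _ _)
  have h1 : ∑ r, (starRingEnd ℂ) (ψ r q) *
      (-Complex.I * ∑ a : Fin 3, ∑ b : Fin 4,
          alpha a (r k) b * fderiv ℝ (ψ (Function.update r k b)) q (d a)
        + (m : ℂ) * ∑ b : Fin 4, beta (r k) b * ψ (Function.update r k b) q) =
      -Complex.I * (∑ a, spinForm (alpha a) k (fun r => ψ r q)
        (fun r => fderiv ℝ (ψ r) q (d a))) +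
      (m : ℂ) * spinForm beta k (fun r => ψ r q) (fun r => ψ r q) := by
    simp only [spinForm, mul_add, Finset.sum_add_distrib, Finset.mul_sum]
    congr 1
    · rw [Finset.sum_comm]
      refine Finset.sum_congr rfl fun a _ => Finset.sum_congr rfl fun r _ =>
        Finset.sum_congr rfl fun b _ => ?_
      ring
    · refine Finset.sum_congr rfl fun r _ => Finset.sum_congr rfl fun b _ => ?_
      ring
  rw [h1]
  simp only [(fderiv_current hψ k _ _).2, Complex.add_im, Complex.mul_im, hβ,
    Complex.ofReal_im, Complex.neg_im, Complex.neg_re, Complex.I_im, Complex.I_re, Complex.re_sum,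
    ← Finset.mul_sum]
  ring

end Spin

/-! ### Weighted bounds for absorption and emission -/

lemma sq_sum_le_card_mul {ι : Type*} (s : Finset ι) (f : ι → ℝ≥0∞) :
    (∑ i ∈ s, f i) ^ 2 ≤ s.card * ∑ i ∈ s, f i ^ 2 := by
  have := ENNReal.rpow_sum_le_const_mul_sum_rpow s f (p := 2) one_le_two
  norm_num at this
  simpa using this

lemma sq_setLIntegral_le {α : Type*} [MeasurableSpace α] (μ : Measure α) (s : Set α)
    {f : α → ℝ≥0∞} (hf : Measurable f) :
    (∫⁻ x in s, f x ∂μ) ^ 2 ≤ μ s * ∫⁻ x in s, f x ^ 2 ∂μ := by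
  have h := ENNReal.lintegral_mul_le_Lp_mul_Lq (μ.restrict s) Real.HolderConjugate.two_two
    (f := fun _ => 1) (g := f) aemeasurable_const hf.aemeasurable
  simp only [Pi.mul_apply, one_mul, ENNReal.one_rpow, lintegral_const, Measure.restrict_apply,
    MeasurableSet.univ, univ_inter] at h
  calc (∫⁻ x in s, f x ∂μ) ^ 2
      ≤ (μ s ^ (1 / 2 : ℝ) * (∫⁻ x in s, f x ^ (2 : ℝ) ∂μ) ^ (1 / 2 : ℝ)) ^ 2 := by gcongr
    _ = _ := by
      rw [mul_pow, ← ENNReal.rpow_natCast, ← ENNReal.rpow_natCast, ← ENNReal.rpow_mul,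
        ← ENNReal.rpow_mul]
      norm_num

variable {M N : ℕ}

lemma measurable_insertNth (l : Fin (N + 1)) :
    Measurable fun p : Config M N × Space =>
      ((p.1.1, l.insertNth (α := fun _ => Space) p.2 p.1.2) : Config M (N + 1)) := by
  refine (measurable_fst.comp measurable_fst).prodMk ?_
  exact (MeasurableEquiv.piFinSuccAbove (fun _ => Space) l).symm.measurable.comp
    (measurable_snd.prodMk (measurable_snd.comp measurable_fst))

/-- Tonelli's theorem for the configurations of the sector `N + 1`, with the position of the
`y`-particle `l` integrated first. -/
lemma lintegral_config_succ (l : Fin (N + 1)) {F : Config M (N + 1) → ℝ≥0∞} (hF : Measurable F) :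
    ∫⁻ q, F q =
      ∫⁻ q : Config M N, ∫⁻ y, F (q.1, l.insertNth (α := fun _ => Space) y q.2) := by
  have hF' : Measurable fun p : Config M N × Space =>
      F (p.1.1, l.insertNth (α := fun _ => Space) p.2 p.1.2) :=
    hF.comp (measurable_insertNth (M := M) l)
  rw [Measure.volume_eq_prod, Measure.volume_eq_prod, lintegral_prod _ hF.aemeasurable,
    lintegral_prod (fun q : Config M N =>
      ∫⁻ y, F (q.1, l.insertNth (α := fun _ => Space) y q.2))
      (Measurable.lintegral_prod_right' hF').aemeasurable]
  refine lintegral_congr fun x => ?_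
  have hx : Measurable fun y : Fin (N + 1) → Space => F (x, y) := hF.comp measurable_prodMk_left
  have e := volume_preserving_piFinSuccAbove (fun _ : Fin (N + 1) => Space) l
  rw [← e.symm.lintegral_comp hx]
  rw [Measure.volume_eq_prod, lintegral_prod_symm]
  · rfl
  · exact (hx.comp e.symm.measurable).aemeasurable

lemma sum_insertNth {β : Type*} [AddCommMonoid β] (l : Fin (N + 1))
    (F : (Fin (N + 1) → Fin 4) → β) :
    ∑ s : Fin N → Fin 4, ∑ b, F (l.insertNth (α := fun _ => Fin 4) b s) = ∑ s, F s := by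
  rw [Finset.sum_comm, ← Fintype.sum_prod_type' (f := fun b s =>
    F (l.insertNth (α := fun _ => Fin 4) b s))]
  exact Equiv.sum_comp (Fin.insertNthEquiv (fun _ => Fin 4) l) F

/-- The squared `L²` norm of the sector `N` of `Ψ` with respect to the density `w`. -/
noncomputable def weightedNormSq (w : Config M N → ℝ) (Ψ : Wave M) : ℝ≥0∞ :=
  ∑ r : Fin M → Fin 4, ∑ s : Fin N → Fin 4,
    ∫⁻ q, ENNReal.ofReal (w q) * ‖Ψ N r s q‖ₑ ^ 2

lemma exists_enorm_coefficient_le (g : Fin 4 → Fin 4 → Fin 4 → ℂ) :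
    ∃ G : ℝ≥0∞, G ≠ ⊤ ∧ ∀ a b c, ‖g a b c‖ₑ ≤ G := by
  refine ⟨∑ a, ∑ b, ∑ c, ‖g a b c‖ₑ, by simp, fun a b c => ?_⟩
  calc ‖g a b c‖ₑ ≤ ∑ c, ‖g a b c‖ₑ :=
        Finset.single_le_sum (f := fun c => ‖g a b c‖ₑ) (fun _ _ => zero_le) (Finset.mem_univ c)
    _ ≤ ∑ b, ∑ c, ‖g a b c‖ₑ :=
        Finset.single_le_sum (f := fun b => ∑ c, ‖g a b c‖ₑ) (fun _ _ => zero_le)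
          (Finset.mem_univ b)
    _ ≤ _ := Finset.single_le_sum (f := fun a => ∑ b, ∑ c, ‖g a b c‖ₑ) (fun _ _ => zero_le)
          (Finset.mem_univ a)

lemma enorm_sqrt_succ_sq (N : ℕ) : ‖(√((N : ℝ) + 1) : ℂ)‖ₑ ^ 2 = (N : ℝ≥0∞) + 1 := by
  rw [← ofReal_norm, Complex.norm_real, ← ENNReal.ofReal_pow (norm_nonneg _),
    Real.norm_eq_abs, sq_abs, Real.sq_sqrt (by positivity),
    ENNReal.ofReal_add (by positivity) zero_le_one]
  simp

/-- The absorption term is bounded, relative to `√(N + 1)`, by the sector `N + 1`, provided that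
the weight does not decrease when the absorbed particle is added. -/
lemma exists_absorb_bound (M : ℕ) (δ : ℝ) {φ : Space → ℝ} (hφ : Continuous φ)
    (hφc : HasCompactSupport φ) (g : Fin 4 → Fin 4 → Fin 4 → ℂ) :
    ∃ A : ℝ≥0∞, A ≠ ⊤ ∧ ∀ (k : Fin M) (N : ℕ) (Ψ : Wave M) (w : Config M N → ℝ)
      (w' : Config M (N + 1) → ℝ), (∀ r s, Continuous (Ψ (N + 1) r s)) → Continuous w' →
      (∀ q y, ‖y - q.1 k‖ < δ → w q ≤ w' (q.1, Fin.snoc (α := fun _ => Space) q.2 y)) →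
      ∑ r, ∑ s, ∫⁻ q, ENNReal.ofReal (w q) * ‖absorb δ φ g k Ψ N r s q‖ₑ ^ 2
        ≤ A * (N + 1) * weightedNormSq w' Ψ := by
  obtain ⟨B, hB⟩ := hφ.bounded_above_of_compact_support hφc
  set V := volume (Metric.ball (0 : Space) δ) with hV
  obtain ⟨G, hGtop, hGle⟩ := exists_enorm_coefficient_le g
  have hVtop : V ≠ ⊤ := measure_ball_lt_top.ne
  refine ⟨4 * (4 * 4 * G ^ 2 * ENNReal.ofReal B ^ 2 * V), by finiteness, ?_⟩
  intro k N Ψ w w' hΨ hw' hmono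
  set D := 4 * 4 * G ^ 2 * ENNReal.ofReal B ^ 2 * V with hD
  have hDtop : D ≠ ⊤ := by finiteness
  have hsnoc : ∀ (x : Fin N → Space) y, Fin.snoc (α := fun _ => Space) x y =
      (Fin.last N).insertNth (α := fun _ => Space) y x := fun x y =>
    (Fin.insertNth_last' (β := Space) y x).symm
  have hsnoc' : ∀ (s : Fin N → Fin 4) b, Fin.snoc (α := fun _ => Fin 4) s b =
      (Fin.last N).insertNth (α := fun _ => Fin 4) b s := fun s b =>
    (Fin.insertNth_last' (β := Fin 4) b s).symm
  -- the sector `N + 1` as a function of the configuration of the sector `N` and of one more point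
  let f : (Fin M → Fin 4) → (Fin (N + 1) → Fin 4) → Config M (N + 1) → ℝ≥0∞ := fun r s q =>
    ENNReal.ofReal (w' q) * ‖Ψ (N + 1) r s q‖ₑ ^ 2
  have hf : ∀ r s, Measurable (f r s) := fun r s =>
    (ENNReal.measurable_ofReal.comp hw'.measurable).mul ((hΨ r s).measurable.enorm.pow_const 2)
  have hpt : ∀ r s q, ENNReal.ofReal (w q) * ‖absorb δ φ g k Ψ N r s q‖ₑ ^ 2 ≤
      D * (N + 1) * ∑ b, ∑ c, ∫⁻ y, f (Function.update r k b)
        ((Fin.last N).insertNth (α := fun _ => Fin 4) c s)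
        (q.1, (Fin.last N).insertNth (α := fun _ => Space) y q.2) := by
    intro r s q
    let h : Fin 4 → Fin 4 → Space → ℝ≥0∞ := fun b c y =>
      ‖Ψ (N + 1) (Function.update r k b) (Fin.snoc (α := fun _ => Fin 4) s c)
        (q.1, Fin.snoc (α := fun _ => Space) q.2 y)‖ₑ
    have hh : ∀ b c, Measurable (h b c) := by
      intro b c
      refine ((hΨ _ _).measurable.comp ?_).enorm
      simp only [hsnoc]
      exact (measurable_insertNth (Fin.last N)).comp (measurable_prodMk_left (x := q))
    have h1 : ‖absorb δ φ g k Ψ N r s q‖ₑ ≤ ‖(√((N : ℝ) + 1) : ℂ)‖ₑ * ∑ b, ∑ c,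
        G * (ENNReal.ofReal B * ∫⁻ y in Metric.ball (q.1 k) δ, h b c y) := by
      rw [absorb, enorm_mul]
      gcongr
      refine (enorm_sum_le _ _).trans (Finset.sum_le_sum fun b _ =>
        (enorm_sum_le _ _).trans (Finset.sum_le_sum fun c _ => ?_))
      rw [enorm_mul]
      gcongr
      · rw [RCLike.enorm_conj]; exact hGle _ _ _
      · refine (enorm_integral_le_lintegral_enorm _).trans ?_
        rw [← lintegral_const_mul _ (hh b c)]
        refine lintegral_mono fun y => ?_
        rw [enorm_mul]
        gcongr
        rw [← ofReal_norm, Complex.norm_real]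
        exact ENNReal.ofReal_le_ofReal (hB _)
    have h2 := enorm_sqrt_succ_sq N
    have h3 : ‖absorb δ φ g k Ψ N r s q‖ₑ ^ 2 ≤ D * (N + 1) *
        ∑ b, ∑ c, ∫⁻ y in Metric.ball (q.1 k) δ, h b c y ^ 2 := by
      calc ‖absorb δ φ g k Ψ N r s q‖ₑ ^ 2 ≤ (‖(√((N : ℝ) + 1) : ℂ)‖ₑ * ∑ b, ∑ c,
            G * (ENNReal.ofReal B * ∫⁻ y in Metric.ball (q.1 k) δ, h b c y)) ^ 2 := by gcongr
        _ = (N + 1) * (∑ b, ∑ c,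
            G * (ENNReal.ofReal B * ∫⁻ y in Metric.ball (q.1 k) δ, h b c y)) ^ 2 := by
          rw [mul_pow, h2]
        _ ≤ (N + 1) * (4 * ∑ b, (∑ c,
            G * (ENNReal.ofReal B * ∫⁻ y in Metric.ball (q.1 k) δ, h b c y)) ^ 2) := by
          gcongr
          simpa using sq_sum_le_card_mul Finset.univ fun b => ∑ c,
            G * (ENNReal.ofReal B * ∫⁻ y in Metric.ball (q.1 k) δ, h b c y)
        _ ≤ (N + 1) * (4 * ∑ b, 4 * ∑ c,
            (G * (ENNReal.ofReal B * ∫⁻ y in Metric.ball (q.1 k) δ, h b c y)) ^ 2) := by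
          gcongr with b
          simpa using sq_sum_le_card_mul Finset.univ fun c =>
            G * (ENNReal.ofReal B * ∫⁻ y in Metric.ball (q.1 k) δ, h b c y)
        _ ≤ (N + 1) * (4 * ∑ b, 4 * ∑ c,
            (G ^ 2 * (ENNReal.ofReal B ^ 2 *
              (V * ∫⁻ y in Metric.ball (q.1 k) δ, h b c y ^ 2)))) := by
          gcongr with b _ c _
          rw [mul_pow, mul_pow]
          gcongr
          have := sq_setLIntegral_le volume (Metric.ball (q.1 k) δ) (hh b c)
          rwa [Measure.addHaar_ball_center] at this
        _ = _ := by
          simp only [← Finset.mul_sum, hD]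
          ring
    calc _ ≤ ENNReal.ofReal (w q) * (D * (N + 1) *
          ∑ b, ∑ c, ∫⁻ y in Metric.ball (q.1 k) δ, h b c y ^ 2) := by gcongr
      _ = D * (N + 1) * ∑ b, ∑ c, ∫⁻ y in Metric.ball (q.1 k) δ,
          ENNReal.ofReal (w q) * h b c y ^ 2 := by
        simp only [lintegral_const_mul' _ _ ENNReal.ofReal_ne_top, ← Finset.mul_sum]
        ring
      _ ≤ _ := by
        refine mul_le_mul_right (Finset.sum_le_sum fun b _ => Finset.sum_le_sum fun c _ => ?_) _
        refine (setLIntegral_mono' measurableSet_ball fun y hy => ?_).trans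
          (setLIntegral_le_lintegral (Metric.ball (q.1 k) δ) _)
        simp only [f, h, hsnoc, hsnoc']
        gcongr
        have := hmono q y (by simpa [dist_eq_norm] using hy)
        rwa [hsnoc] at this
  have hmeas : ∀ r s, Measurable fun q : Config M N => ∫⁻ y, f r s
      (q.1, (Fin.last N).insertNth (α := fun _ => Space) y q.2) := fun r s =>
    Measurable.lintegral_prod_right' ((hf r s).comp (measurable_insertNth (Fin.last N)))
  have hint : ∀ r s, ∫⁻ q, ENNReal.ofReal (w q) * ‖absorb δ φ g k Ψ N r s q‖ₑ ^ 2 ≤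
      D * (N + 1) * ∑ b, ∑ c, ∫⁻ q, f (Function.update r k b)
        ((Fin.last N).insertNth (α := fun _ => Fin 4) c s) q := by
    intro r s
    refine (lintegral_mono (hpt r s)).trans (le_of_eq ?_)
    rw [lintegral_const_mul' _ _ (by finiteness), lintegral_finsetSum]
    · congr 1
      refine Finset.sum_congr rfl fun b _ => ?_
      rw [lintegral_finsetSum]
      · exact Finset.sum_congr rfl fun c _ => (lintegral_config_succ _ (hf _ _)).symm
      · exact fun c _ => hmeas _ _
    · exact fun b _ => Finset.measurable_sum _ fun c _ => hmeas _ _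
  calc _ ≤ ∑ r, ∑ s, D * (N + 1) * ∑ b, ∑ c, ∫⁻ q, f (Function.update r k b)
        ((Fin.last N).insertNth (α := fun _ => Fin 4) c s) q :=
      Finset.sum_le_sum fun r _ => Finset.sum_le_sum fun s _ => hint r s
    _ = D * (N + 1) * ∑ r, ∑ b, ∑ s, ∑ c, ∫⁻ q, f (Function.update r k b)
        ((Fin.last N).insertNth (α := fun _ => Fin 4) c s) q := by
      simp only [← Finset.mul_sum]
      congr 1
      exact Finset.sum_congr rfl fun r _ => Finset.sum_comm
    _ = D * (N + 1) * ∑ r, ∑ b, ∑ s, ∫⁻ q, f (Function.update r k b) s q := by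
      congr 1
      refine Finset.sum_congr rfl fun r _ => Finset.sum_congr rfl fun b _ => ?_
      exact sum_insertNth (Fin.last N) fun s => ∫⁻ q, f (Function.update r k b) s q
    _ = _ := by
      rw [sum_sum_update k (fun r => ∑ s, ∫⁻ q, f r s q), nsmul_eq_mul, weightedNormSq]
      push_cast
      ring

/-- The emission term in the sector `N + 1` is bounded, relative to `√(N + 1)`, by the sector `N`,
provided that, where the emission term does not vanish, the weight does not increase when the
emitted particle is added. -/
lemma exists_emit_bound (M : ℕ) {φ : Space → ℝ} (hφ : Continuous φ)
    (hφc : HasCompactSupport φ) (g : Fin 4 → Fin 4 → Fin 4 → ℂ) :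
    ∃ A : ℝ≥0∞, A ≠ ⊤ ∧ ∀ (k : Fin M) (N : ℕ) (Ψ : Wave M) (w : Config M N → ℝ)
      (w' : Config M (N + 1) → ℝ), (∀ r s, Continuous (Ψ N r s)) → Continuous w →
      (∀ q l r s, φ (q.2 l - q.1 k) ≠ 0 → Ψ N r s (q.1, l.removeNth q.2) ≠ 0 →
        w' q ≤ w (q.1, l.removeNth q.2)) →
      ∑ r, ∑ s, ∫⁻ q, ENNReal.ofReal (w' q) * ‖emit φ g k Ψ (N + 1) r s q‖ₑ ^ 2
        ≤ A * (N + 1) * weightedNormSq w Ψ := by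
  obtain ⟨G, hGtop, hGle⟩ := exists_enorm_coefficient_le g
  set P := ∫⁻ y, ‖φ y‖ₑ ^ 2 with hP
  have hPtop : P ≠ ⊤ := by
    have hL : MemLp φ 2 volume := hφ.memLp_of_hasCompactSupport hφc
    have := hL.eLpNorm_lt_top
    rw [eLpNorm_lt_top_iff_lintegral_rpow_enorm_lt_top (by norm_num) (by norm_num)] at this
    simpa [hP] using this.ne
  refine ⟨4 * 4 * (4 * G ^ 2) * P, by finiteness, ?_⟩
  intro k N Ψ w w' hΨ hw hmono
  let f : (Fin M → Fin 4) → (Fin N → Fin 4) → Config M N → ℝ≥0∞ := fun r s q =>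
    ENNReal.ofReal (w q) * ‖Ψ N r s q‖ₑ ^ 2
  have hf : ∀ r s, Measurable (f r s) := fun r s =>
    (ENNReal.measurable_ofReal.comp hw.measurable).mul ((hΨ r s).measurable.enorm.pow_const 2)
  have hrem : ∀ l : Fin (N + 1), Measurable fun q : Config M (N + 1) =>
      ((q.1, l.removeNth q.2) : Config M N) := fun l =>
    measurable_fst.prodMk (measurable_pi_lambda _ fun i =>
      (measurable_pi_apply (l.succAbove i)).comp measurable_snd)
  have hφm : ∀ l : Fin (N + 1), Measurable fun q : Config M (N + 1) =>
      ‖φ (q.2 l - q.1 k)‖ₑ ^ 2 := fun l => by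
    refine (hφ.measurable.comp (Measurable.sub ?_ ?_)).enorm.pow_const 2
    · exact (measurable_pi_apply l).comp measurable_snd
    · exact (measurable_pi_apply k).comp measurable_fst
  have hpt : ∀ r s q, ENNReal.ofReal (w' q) * ‖emit φ g k Ψ (N + 1) r s q‖ₑ ^ 2 ≤
      4 * G ^ 2 * ∑ l, ∑ b, ‖φ (q.2 l - q.1 k)‖ₑ ^ 2 *
        f (Function.update r k b) (l.removeNth s) (q.1, l.removeNth q.2) := by
    intro r s q
    let h : Fin (N + 1) → Fin 4 → ℝ≥0∞ := fun l b => ‖φ (q.2 l - q.1 k)‖ₑ *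
      ‖Ψ N (Function.update r k b) (l.removeNth s) (q.1, l.removeNth q.2)‖ₑ
    have h0 : ‖1 / (√((N : ℝ) + 1) : ℂ)‖ₑ ^ 2 * (N + 1) = 1 := by
      rw [← enorm_sqrt_succ_sq, ← mul_pow, ← enorm_mul, one_div, inv_mul_cancel₀]
      · simp
      · exact_mod_cast (Real.sqrt_pos.2 (by positivity : (0 : ℝ) < (N : ℝ) + 1)).ne'
    have h1 : ‖emit φ g k Ψ (N + 1) r s q‖ₑ ≤ ‖1 / (√((N : ℝ) + 1) : ℂ)‖ₑ *
        ∑ l, ∑ b, G * h l b := by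
      rw [emit, enorm_mul]
      gcongr
      refine (enorm_sum_le _ _).trans (Finset.sum_le_sum fun l _ =>
        (enorm_sum_le _ _).trans (Finset.sum_le_sum fun b _ => ?_))
      rw [enorm_mul, enorm_mul, mul_assoc]
      simp only [h]
      gcongr
      · exact hGle _ _ _
      · rw [← ofReal_norm, Complex.norm_real, ofReal_norm]
    have h3 : ‖emit φ g k Ψ (N + 1) r s q‖ₑ ^ 2 ≤ 4 * G ^ 2 * ∑ l, ∑ b, h l b ^ 2 := by
      calc ‖emit φ g k Ψ (N + 1) r s q‖ₑ ^ 2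
          ≤ (‖1 / (√((N : ℝ) + 1) : ℂ)‖ₑ * ∑ l, ∑ b, G * h l b) ^ 2 := by gcongr
        _ ≤ ‖1 / (√((N : ℝ) + 1) : ℂ)‖ₑ ^ 2 * ((N + 1) * ∑ l, (∑ b, G * h l b) ^ 2) := by
          rw [mul_pow]
          gcongr
          simpa using sq_sum_le_card_mul Finset.univ fun l => ∑ b, G * h l b
        _ = ∑ l, (∑ b, G * h l b) ^ 2 := by rw [← mul_assoc, h0, one_mul]
        _ ≤ ∑ l, 4 * ∑ b, (G * h l b) ^ 2 := by
          gcongr with l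
          simpa using sq_sum_le_card_mul Finset.univ fun b => G * h l b
        _ = _ := by
          simp only [mul_pow, ← Finset.mul_sum]
          ring
    calc _ ≤ ENNReal.ofReal (w' q) * (4 * G ^ 2 * ∑ l, ∑ b, h l b ^ 2) := by gcongr
      _ = 4 * G ^ 2 * ∑ l, ∑ b, ENNReal.ofReal (w' q) * h l b ^ 2 := by
        simp only [← Finset.mul_sum]
        ring
      _ ≤ _ := by
        refine mul_le_mul_right (Finset.sum_le_sum fun l _ => Finset.sum_le_sum fun b _ => ?_) _
        by_cases hz : h l b = 0
        · simp [hz]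
        · have hz' : φ (q.2 l - q.1 k) ≠ 0 ∧
              Ψ N (Function.update r k b) (l.removeNth s) (q.1, l.removeNth q.2) ≠ 0 := by
            simpa [h, not_or] using hz
          have := hmono q l _ _ hz'.1 hz'.2
          simp only [f, h, mul_pow]
          rw [mul_left_comm]
          gcongr
  have hint : ∀ r s, ∫⁻ q, ENNReal.ofReal (w' q) * ‖emit φ g k Ψ (N + 1) r s q‖ₑ ^ 2 ≤
      4 * G ^ 2 * P * ∑ l : Fin (N + 1), ∑ b,
        ∫⁻ q, f (Function.update r k b) (l.removeNth s) q := by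
    intro r s
    have hm : ∀ l b, Measurable fun q : Config M (N + 1) => ‖φ (q.2 l - q.1 k)‖ₑ ^ 2 *
        f (Function.update r k b) (l.removeNth s) (q.1, l.removeNth q.2) := fun l b =>
      (hφm l).mul ((hf _ _).comp (hrem l))
    refine (lintegral_mono (hpt r s)).trans (le_of_eq ?_)
    rw [lintegral_const_mul' _ _ (by finiteness), lintegral_finsetSum _
      fun l _ => Finset.measurable_sum _ fun b _ => hm l b, mul_assoc _ P]
    congr 1
    rw [Finset.mul_sum]
    refine Finset.sum_congr rfl fun l _ => ?_
    rw [lintegral_finsetSum _ fun b _ => hm l b, Finset.mul_sum]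
    refine Finset.sum_congr rfl fun b _ => ?_
    rw [lintegral_config_succ l (hm l b), ← lintegral_const_mul' _ _ hPtop]
    refine lintegral_congr fun q => ?_
    simp only [Fin.insertNth_apply_same, Fin.removeNth_insertNth]
    have hm' : Measurable fun y => ‖φ (y - q.1 k)‖ₑ ^ 2 :=
      ((hφ.measurable.comp (measurable_id.sub_const _)).enorm).pow_const 2
    rw [lintegral_mul_const _ hm',
      lintegral_sub_right_eq_self (fun y => ‖φ y‖ₑ ^ 2)]
  calc _ ≤ ∑ r, ∑ s : Fin (N + 1) → Fin 4, 4 * G ^ 2 * P * ∑ l : Fin (N + 1), ∑ b,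
        ∫⁻ q, f (Function.update r k b) (l.removeNth s) q :=
      Finset.sum_le_sum fun r _ => Finset.sum_le_sum fun s _ => hint r s
    _ = 4 * G ^ 2 * P * ∑ l : Fin (N + 1), ∑ s : Fin (N + 1) → Fin 4, ∑ r, ∑ b,
        ∫⁻ q, f (Function.update r k b) (l.removeNth s) q := by
      simp only [← Finset.mul_sum]
      rw [Finset.sum_comm]
      simp_rw [Finset.sum_comm (s := (Finset.univ : Finset (Fin M → Fin 4)))
        (t := (Finset.univ : Finset (Fin (N + 1))))]
      rw [Finset.sum_comm]
    _ = 4 * G ^ 2 * P * ∑ l : Fin (N + 1), ∑ s : Fin (N + 1) → Fin 4,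
        4 * ∑ r, ∫⁻ q, f r (l.removeNth s) q := by
      congr 1
      refine Finset.sum_congr rfl fun l _ => Finset.sum_congr rfl fun s _ => ?_
      rw [sum_sum_update k (fun r => ∫⁻ q, f r (l.removeNth s) q), nsmul_eq_mul]
      simp
    _ = 4 * G ^ 2 * P * ∑ l : Fin (N + 1), 4 * (4 * ∑ s, ∑ r, ∫⁻ q, f r s q) := by
      congr 1
      refine Finset.sum_congr rfl fun l _ => ?_
      have hrem' : ∀ (b : Fin 4) (s : Fin N → Fin 4),
          l.removeNth (α := fun _ => Fin 4) (l.insertNth (α := fun _ => Fin 4) b s) = s :=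
        fun b s => Fin.removeNth_insertNth (α := fun _ => Fin 4) l b s
      rw [← sum_insertNth l]
      simp only [hrem', Finset.sum_const, Finset.card_univ, Fintype.card_fin, nsmul_eq_mul,
        ← Finset.mul_sum]
      push_cast
      rfl
    _ = _ := by
      rw [Finset.sum_const, Finset.card_univ, Fintype.card_fin, nsmul_eq_mul, Finset.sum_comm,
        weightedNormSq]
      push_cast
      ring

/-- The interaction part of the Hamiltonian. -/
noncomputable def interaction (δ : ℝ) (φ : Space → ℝ) (g : Fin 4 → Fin 4 → Fin 4 → ℂ)
    (Ψ : Wave M) : Wave M := fun N r s q =>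
  ∑ k : Fin M, absorb δ φ g k Ψ N r s q + ∑ k : Fin M, emit φ g k Ψ N r s q

/-- The compatibility of a family of weights with the interaction: adding a `y`-particle within the
range `δ` of an `x`-particle does not decrease the weight, and it does not increase the weight
where the emission term does not vanish. -/
structure IsCompatible (δ : ℝ) (φ : Space → ℝ) (Ψ : Wave M) (w : ∀ N, Config M N → ℝ) : Prop where
  absorb : ∀ N (k : Fin M) (q : Config M N) y, ‖y - q.1 k‖ < δ →
    w N q ≤ w (N + 1) (q.1, Fin.snoc (α := fun _ => Space) q.2 y)
  emit : ∀ N (k : Fin M) (q : Config M (N + 1)) l r s, φ (q.2 l - q.1 k) ≠ 0 →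
    Ψ N r s (q.1, l.removeNth q.2) ≠ 0 → w (N + 1) q ≤ w N (q.1, l.removeNth q.2)

lemma measurable_absorb {δ : ℝ} {φ : Space → ℝ} (hφ : Continuous φ)
    {g : Fin 4 → Fin 4 → Fin 4 → ℂ} {Ψ : Wave M} (hΨ : ∀ r s, Continuous (Ψ (N + 1) r s))
    (k : Fin M) (r : Fin M → Fin 4) (s : Fin N → Fin 4) :
    Measurable (absorb δ φ g k Ψ N r s) := by
  unfold absorb
  refine Measurable.const_mul (Finset.measurable_sum _ fun b _ => Finset.measurable_sum _
    fun c _ => Measurable.const_mul ?_ _) _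
  let F : Config M N × Space → ℂ := fun p => (φ (p.2 - p.1.1 k) : ℂ) *
    Ψ (N + 1) (Function.update r k b) (Fin.snoc (α := fun _ => Fin 4) s c)
      (p.1.1, Fin.snoc (α := fun _ => Space) p.1.2 p.2)
  have hxk : Measurable fun p : Config M N × Space => p.1.1 k :=
    (measurable_pi_apply k).comp (measurable_fst.comp measurable_fst)
  have hF : Measurable F := by
    refine Measurable.mul (Complex.measurable_ofReal.comp
      (hφ.measurable.comp (measurable_snd.sub hxk))) ((hΨ _ _).measurable.comp ?_)
    have := measurable_insertNth (M := M) (Fin.last N)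
    simpa only [Fin.insertNth_last' (β := Space)] using this
  have hS : MeasurableSet {p : Config M N × Space | dist p.2 (p.1.1 k) < δ} :=
    measurableSet_lt (measurable_snd.dist hxk) measurable_const
  have := ((hF.indicator hS).stronglyMeasurable.integral_prod_right' (ν := volume)).measurable
  convert this using 2 with q
  rw [← integral_indicator measurableSet_ball]
  rfl

lemma continuous_emit {φ : Space → ℝ} (hφ : Continuous φ)
    {g : Fin 4 → Fin 4 → Fin 4 → ℂ} {Ψ : Wave M} (hΨ : ∀ N r s, Continuous (Ψ N r s))
    (k : Fin M) (r : Fin M → Fin 4) (s : Fin N → Fin 4) :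
    Continuous (emit φ g k Ψ N r s) := by
  cases N with
  | zero => exact continuous_const
  | succ N =>
    unfold emit
    refine Continuous.mul continuous_const (continuous_finsetSum _ fun l _ =>
      continuous_finsetSum _ fun b _ => Continuous.mul ?_ ((hΨ N _ _).comp ?_))
    · fun_prop
    · refine continuous_fst.prodMk (continuous_pi fun i => ?_)
      exact (continuous_apply (l.succAbove i)).comp continuous_snd

/-- For compatible weights the interaction is bounded, relative to `√(N + 1)`, by the neighbouring
sectors. -/
lemma exists_interaction_bound (M : ℕ) (δ : ℝ) {φ : Space → ℝ} (hφ : Continuous φ)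
    (hφc : HasCompactSupport φ) (g : Fin 4 → Fin 4 → Fin 4 → ℂ) :
    ∃ A : ℝ≥0∞, A ≠ ⊤ ∧ ∀ (Ψ : Wave M) (w : ∀ N, Config M N → ℝ),
      (∀ N r s, Continuous (Ψ N r s)) → (∀ N, Continuous (w N)) →
      IsCompatible δ φ Ψ w → ∀ N,
      ∑ r, ∑ s, ∫⁻ q, ENNReal.ofReal (w N q) * ‖interaction δ φ g Ψ N r s q‖ₑ ^ 2
        ≤ A * (N + 1) * (weightedNormSq (w (N - 1)) Ψ + weightedNormSq (w (N + 1)) Ψ) := by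
  obtain ⟨A, hA, hAb⟩ := exists_absorb_bound M δ hφ hφc g
  obtain ⟨B, hB, hBb⟩ := exists_emit_bound M hφ hφc g
  refine ⟨2 * M * (M * (A + B)), by finiteness, fun Ψ w hΨ hw hcomp N => ?_⟩
  have hwm : Measurable fun q => ENNReal.ofReal (w N q) :=
    ENNReal.measurable_ofReal.comp (hw N).measurable
  have ham : ∀ k r s, Measurable fun q =>
      ENNReal.ofReal (w N q) * ‖absorb δ φ g k Ψ N r s q‖ₑ ^ 2 := fun k r s =>
    hwm.mul ((measurable_absorb hφ (hΨ (N + 1)) k r s).enorm.pow_const 2)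
  have hem : ∀ k r s, Measurable fun q =>
      ENNReal.ofReal (w N q) * ‖emit φ g k Ψ N r s q‖ₑ ^ 2 := fun k r s =>
    hwm.mul ((continuous_emit hφ hΨ k r s).measurable.enorm.pow_const 2)
  have hpt : ∀ r s q, ENNReal.ofReal (w N q) * ‖interaction δ φ g Ψ N r s q‖ₑ ^ 2 ≤
      2 * M * ∑ k, (ENNReal.ofReal (w N q) * ‖absorb δ φ g k Ψ N r s q‖ₑ ^ 2
        + ENNReal.ofReal (w N q) * ‖emit φ g k Ψ N r s q‖ₑ ^ 2) := by
    intro r s q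
    have h1 : ‖interaction δ φ g Ψ N r s q‖ₑ ≤
        ∑ k, (‖absorb δ φ g k Ψ N r s q‖ₑ + ‖emit φ g k Ψ N r s q‖ₑ) := by
      rw [interaction, ← Finset.sum_add_distrib]
      exact (enorm_sum_le _ _).trans (Finset.sum_le_sum fun k _ => enorm_add_le _ _)
    have h2 : ∀ a b : ℝ≥0∞, (a + b) ^ 2 ≤ 2 * (a ^ 2 + b ^ 2) := fun a b => by
      simpa [Fin.sum_univ_two] using sq_sum_le_card_mul Finset.univ ![a, b]
    calc _ ≤ ENNReal.ofReal (w N q) *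
          (∑ k, (‖absorb δ φ g k Ψ N r s q‖ₑ + ‖emit φ g k Ψ N r s q‖ₑ)) ^ 2 := by gcongr
      _ ≤ ENNReal.ofReal (w N q) *
          (M * ∑ k, (‖absorb δ φ g k Ψ N r s q‖ₑ + ‖emit φ g k Ψ N r s q‖ₑ) ^ 2) := by
        gcongr
        simpa using sq_sum_le_card_mul (Finset.univ : Finset (Fin M)) fun k =>
          ‖absorb δ φ g k Ψ N r s q‖ₑ + ‖emit φ g k Ψ N r s q‖ₑ
      _ ≤ ENNReal.ofReal (w N q) * (M * ∑ k,
          2 * (‖absorb δ φ g k Ψ N r s q‖ₑ ^ 2 + ‖emit φ g k Ψ N r s q‖ₑ ^ 2)) := by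
        gcongr with k
        exact h2 _ _
      _ = _ := by
        simp only [← mul_add, ← Finset.mul_sum]
        ring
  have habs : ∀ k, ∑ r, ∑ s, ∫⁻ q, ENNReal.ofReal (w N q) * ‖absorb δ φ g k Ψ N r s q‖ₑ ^ 2 ≤
      A * (N + 1) * weightedNormSq (w (N + 1)) Ψ := fun k =>
    hAb k N Ψ (w N) (w (N + 1)) (hΨ (N + 1)) (hw (N + 1)) (hcomp.absorb N k)
  have hemi : ∀ k, ∑ r, ∑ s, ∫⁻ q, ENNReal.ofReal (w N q) * ‖emit φ g k Ψ N r s q‖ₑ ^ 2 ≤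
      B * (N + 1) * weightedNormSq (w (N - 1)) Ψ := by
    intro k
    cases N with
    | zero => simp [emit]
    | succ N =>
      refine (hBb k N Ψ (w N) (w (N + 1)) (hΨ N) (hw N) (hcomp.emit N k)).trans ?_
      rw [Nat.add_sub_cancel]
      gcongr
      exact le_self_add
  calc _ ≤ ∑ r, ∑ s, ∫⁻ q, 2 * M * ∑ k,
        (ENNReal.ofReal (w N q) * ‖absorb δ φ g k Ψ N r s q‖ₑ ^ 2
          + ENNReal.ofReal (w N q) * ‖emit φ g k Ψ N r s q‖ₑ ^ 2) :=
      Finset.sum_le_sum fun r _ => Finset.sum_le_sum fun s _ => lintegral_mono (hpt r s)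
    _ = 2 * M * ∑ k, ((∑ r, ∑ s, ∫⁻ q,
          ENNReal.ofReal (w N q) * ‖absorb δ φ g k Ψ N r s q‖ₑ ^ 2)
        + ∑ r, ∑ s, ∫⁻ q, ENNReal.ofReal (w N q) * ‖emit φ g k Ψ N r s q‖ₑ ^ 2) := by
      have h1 : ∀ r s, ∫⁻ q, 2 * M * ∑ k,
          (ENNReal.ofReal (w N q) * ‖absorb δ φ g k Ψ N r s q‖ₑ ^ 2
            + ENNReal.ofReal (w N q) * ‖emit φ g k Ψ N r s q‖ₑ ^ 2) =
          2 * M * ∑ k, ((∫⁻ q, ENNReal.ofReal (w N q) * ‖absorb δ φ g k Ψ N r s q‖ₑ ^ 2)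
            + ∫⁻ q, ENNReal.ofReal (w N q) * ‖emit φ g k Ψ N r s q‖ₑ ^ 2) := by
        intro r s
        have hm : ∀ k, Measurable fun q =>
            ENNReal.ofReal (w N q) * ‖absorb δ φ g k Ψ N r s q‖ₑ ^ 2
              + ENNReal.ofReal (w N q) * ‖emit φ g k Ψ N r s q‖ₑ ^ 2 := fun k =>
          (ham k r s).add (hem k r s)
        rw [lintegral_const_mul' _ _ (by finiteness), lintegral_finsetSum _ fun k _ => hm k]
        congr 1
        exact Finset.sum_congr rfl fun k _ => lintegral_add_left (ham k r s) _
      simp only [h1, ← Finset.mul_sum]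
      congr 1
      simp only [← Finset.sum_add_distrib]
      exact (Finset.sum_congr rfl fun r _ => Finset.sum_comm).trans Finset.sum_comm
    _ ≤ 2 * M * ∑ k : Fin M, (A * (N + 1) * weightedNormSq (w (N + 1)) Ψ
        + B * (N + 1) * weightedNormSq (w (N - 1)) Ψ) := by
      gcongr with k
      exacts [habs k, hemi k]
    _ ≤ 2 * M * ∑ k : Fin M, ((A + B) * (N + 1) *
        (weightedNormSq (w (N - 1)) Ψ + weightedNormSq (w (N + 1)) Ψ)) := by
      gcongr with k
      rw [mul_add ((A + B) * (N + 1)), add_comm]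
      gcongr
      exacts [le_add_self, le_self_add]
    _ = _ := by
      rw [Finset.sum_const, Finset.card_univ, Fintype.card_fin, nsmul_eq_mul]
      ring

/-! ### Integration by parts and differentiation of integrals -/

section Integration

variable {E : Type*} [NormedAddCommGroup E] [NormedSpace ℝ E] [MeasurableSpace E] [BorelSpace E]
  (μ : Measure E)

omit [MeasurableSpace E] [BorelSpace E] in
lemma hasDerivAt_slice {F : ℝ × E → ℝ} {t : ℝ} {q : E} (hF : DifferentiableAt ℝ F (t, q)) :
    HasDerivAt (fun τ => F (τ, q)) (fderiv ℝ F (t, q) (1, 0)) t :=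
  hF.hasFDerivAt.comp_hasDerivAt t ((hasDerivAt_id t).prodMk (hasDerivAt_const t q))

omit [MeasurableSpace E] [BorelSpace E] in
lemma fderiv_slice {F : ℝ × E → ℝ} {t : ℝ} {q : E} (hF : DifferentiableAt ℝ F (t, q)) (u : E) :
    fderiv ℝ (fun q => F (t, q)) q u = fderiv ℝ F (t, q) (0, u) := by
  have : HasFDerivAt (fun q => F (t, q))
      ((fderiv ℝ F (t, q)).comp (ContinuousLinearMap.inr ℝ ℝ E)) q :=
    hF.hasFDerivAt.comp q (hasFDerivAt_prodMk_right t q)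
  rw [this.fderiv]
  rfl

/-- Differentiation under the integral sign for a `C¹` integrand whose support in the integration
variable stays in a fixed compact set. -/
lemma hasDerivAt_integral_of_contDiff [IsFiniteMeasureOnCompacts μ] {F : ℝ × E → ℝ}
    (hF : ContDiff ℝ 1 F) {K : Set E}
    (hK : IsCompact K) {U : Set ℝ} (hU : IsOpen U) (hFK : ∀ τ ∈ U, ∀ q ∉ K, F (τ, q) = 0) {t : ℝ}
    (ht : t ∈ U) :
    Integrable (fun q => fderiv ℝ F (t, q) (1, 0)) μ ∧
    HasDerivAt (fun τ => ∫ q, F (τ, q) ∂μ) (∫ q, fderiv ℝ F (t, q) (1, 0) ∂μ) t := by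
  obtain ⟨ε, hε, hball⟩ := Metric.isOpen_iff.1 hU t ht
  have hder : ∀ τ q, HasDerivAt (fun τ => F (τ, q)) (fderiv ℝ F (τ, q) (1, 0)) τ := fun τ q =>
    hasDerivAt_slice (hF.differentiable one_ne_zero _)
  have hcont : Continuous fun p : ℝ × E => fderiv ℝ F p (1, 0) :=
    (hF.continuous_fderiv one_ne_zero).clm_apply continuous_const
  obtain ⟨C, hC⟩ := ((isCompact_closedBall t ε).prod hK).exists_bound_of_continuousOn
    hcont.continuousOn
  have hzero : ∀ τ ∈ Metric.ball t ε, ∀ q ∉ K, fderiv ℝ F (τ, q) (1, 0) = 0 := by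
    intro τ hτ q hq
    refine (hder τ q).unique ?_
    refine (hasDerivAt_const τ (0 : ℝ)).congr_of_eventuallyEq ?_
    filter_upwards [hU.mem_nhds (hball hτ)] with s hs using hFK s hs q hq
  have hint : ∀ τ ∈ U, Integrable (fun q => F (τ, q)) μ := fun τ hτ =>
    (hF.continuous.comp (Continuous.prodMk_right τ)).integrable_of_hasCompactSupport
      (HasCompactSupport.intro hK fun q hq => hFK τ hτ q hq)
  refine hasDerivAt_integral_of_dominated_loc_of_deriv_le
    (F := fun τ q => F (τ, q)) (F' := fun τ q => fderiv ℝ F (τ, q) (1, 0))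
    (bound := K.indicator fun _ => C) (Metric.ball_mem_nhds t hε) ?_ (hint t ht) ?_ ?_ ?_ ?_
  · filter_upwards [hU.mem_nhds ht] with τ hτ using (hint τ hτ).aestronglyMeasurable
  · exact (hcont.comp (Continuous.prodMk_right t)).aestronglyMeasurable
  · refine ae_of_all _ fun q τ hτ => ?_
    by_cases hq : q ∈ K
    · rw [indicator_of_mem hq]
      exact hC (τ, q) ⟨Metric.ball_subset_closedBall hτ, hq⟩
    · rw [indicator_of_notMem hq, hzero τ hτ q hq, norm_zero]
  · exact (integrable_indicator_iff hK.measurableSet).2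
      (integrableOn_const hK.measure_lt_top.ne)
  · exact ae_of_all _ fun q τ _ => hder τ q

/-- Integration by parts against a `C¹` function of compact support. -/
lemma integral_mul_fderiv_of_compact_support [FiniteDimensional ℝ E] [μ.IsAddHaarMeasure]
    {w J : E → ℝ} (hw : ContDiff ℝ 1 w) (hwc : HasCompactSupport w) (hJ : ContDiff ℝ 1 J) (v : E) :
    Integrable (fun q => w q * fderiv ℝ J q v) μ ∧ Integrable (fun q => fderiv ℝ w q v * J q) μ ∧
    ∫ q, w q * fderiv ℝ J q v ∂μ = -∫ q, fderiv ℝ w q v * J q ∂μ := by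
  have hJ' : Continuous fun q => fderiv ℝ J q v :=
    (hJ.continuous_fderiv one_ne_zero).clm_apply continuous_const
  have hw' : Continuous fun q => fderiv ℝ w q v :=
    (hw.continuous_fderiv one_ne_zero).clm_apply continuous_const
  have i1 : Integrable (fun q => w q * fderiv ℝ J q v) μ :=
    (hw.continuous.mul hJ').integrable_of_hasCompactSupport hwc.mul_right
  have i2 : Integrable (fun q => fderiv ℝ w q v * J q) μ :=
    (hw'.mul hJ.continuous).integrable_of_hasCompactSupport
      ((hwc.fderiv_apply (𝕜 := ℝ) v).mul_right)
  have i3 : Integrable (fun q => w q * J q) μ :=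
    (hw.continuous.mul hJ.continuous).integrable_of_hasCompactSupport hwc.mul_right
  exact ⟨i1, i2, integral_mul_fderiv_eq_neg_fderiv_mul_of_integrable i2 i1 i3
    (fun x _ => hw.differentiable one_ne_zero x) (fun x _ => hJ.differentiable one_ne_zero x)⟩

end Integration

/-! ### The continuity equation -/

/-- A smooth solution of the evolution equation whose time is multiplied by `σ`; the values
`σ = 1` and `σ = -1` describe the evolution forwards and backwards in time. -/
structure IsFlow (σ mx my δ : ℝ) (φ : Space → ℝ) (g : Fin 4 → Fin 4 → Fin 4 → ℂ)
    (Φ : ℝ → Wave M) : Prop where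
  smooth : SmoothTimeWave Φ
  equation : ∀ (t : ℝ) (N : ℕ) (r : Fin M → Fin 4) (s : Fin N → Fin 4) (q : Config M N),
    Complex.I * deriv (fun τ : ℝ => Φ τ N r s q) t = σ * hamiltonian mx my δ φ g (Φ t) N r s q

/-- The probability density of the sector `N`. -/
noncomputable def density (Ψ : Wave M) (N : ℕ) (q : Config M N) : ℝ :=
  ∑ r, ∑ s, ‖Ψ N r s q‖ ^ 2

lemma SmoothTimeWave.contDiff_slice {Φ : ℝ → Wave M} (h : SmoothTimeWave Φ) (t : ℝ) (N : ℕ)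
    (r : Fin M → Fin 4) (s : Fin N → Fin 4) : ContDiff ℝ ∞ (Φ t N r s) :=
  (h N r s).comp (contDiff_const.prodMk contDiff_id)

lemma SmoothTimeWave.hasDerivAt {Φ : ℝ → Wave M} (h : SmoothTimeWave Φ) (t : ℝ) (N : ℕ)
    (r : Fin M → Fin 4) (s : Fin N → Fin 4) (q : Config M N) :
    HasDerivAt (fun τ => Φ τ N r s q) (deriv (fun τ => Φ τ N r s q) t) t := by
  have : ContDiff ℝ ∞ fun τ => Φ τ N r s q := (h N r s).comp (contDiff_id.prodMk contDiff_const)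
  exact (this.differentiable (by simp) t).hasDerivAt

lemma SmoothTimeWave.contDiff_density {Φ : ℝ → Wave M} (h : SmoothTimeWave Φ) (N : ℕ) :
    ContDiff ℝ 1 fun p : ℝ × Config M N => density (Φ p.1) N p.2 := by
  unfold density
  exact ContDiff.sum fun r _ => ContDiff.sum fun s _ =>
    ((h N r s).of_le (by exact_mod_cast le_top)).norm_sq ℝ

/-- The probability current of the `x`-particle `k`. -/
noncomputable def currentX (Ψ : Wave M) (N : ℕ) (q : Config M N) (k : Fin M) : Space :=
  WithLp.toLp 2 fun a => ∑ s, current (fun r => Ψ N r s) k a q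

/-- The probability current of the `y`-particle `l`. -/
noncomputable def currentY (Ψ : Wave M) (N : ℕ) (q : Config M N) (l : Fin N) : Space :=
  WithLp.toLp 2 fun a => ∑ r, current (fun s => Ψ N r s) l a q

/-- No particle moves faster than light. -/
lemma norm_currentX_le (Ψ : Wave M) (q : Config M N) (k : Fin M) :
    ‖currentX Ψ N q k‖ ≤ density Ψ N q := by
  rcases (norm_nonneg (currentX Ψ N q k)).eq_or_lt with h0 | hpos
  · rw [← h0]; unfold density; positivity
  refine le_of_mul_le_mul_left ?_ hpos
  set v := currentX Ψ N q k with hv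
  calc ‖v‖ * ‖v‖ = ∑ a, v a * v a := by
        rw [← sq, EuclideanSpace.real_norm_sq_eq]
        exact Finset.sum_congr rfl fun a _ => sq _
    _ = ∑ a, v a * ∑ s, current (fun r => Ψ N r s) k a q := rfl
    _ = ∑ s, ∑ a, v a * current (fun r => Ψ N r s) k a q := by
        simp_rw [Finset.mul_sum]; exact Finset.sum_comm
    _ ≤ ∑ s, ‖v‖ * ∑ r, ‖Ψ N r s q‖ ^ 2 :=
        Finset.sum_le_sum fun s _ => re_spinForm_alpha_le v k fun r => Ψ N r s q
    _ = ‖v‖ * density Ψ N q := by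
        rw [← Finset.mul_sum, density, Finset.sum_comm]

lemma norm_currentY_le (Ψ : Wave M) (q : Config M N) (l : Fin N) :
    ‖currentY Ψ N q l‖ ≤ density Ψ N q := by
  rcases (norm_nonneg (currentY Ψ N q l)).eq_or_lt with h0 | hpos
  · rw [← h0]; unfold density; positivity
  refine le_of_mul_le_mul_left ?_ hpos
  set v := currentY Ψ N q l with hv
  calc ‖v‖ * ‖v‖ = ∑ a, v a * v a := by
        rw [← sq, EuclideanSpace.real_norm_sq_eq]
        exact Finset.sum_congr rfl fun a _ => sq _
    _ = ∑ a, v a * ∑ r, current (fun s => Ψ N r s) l a q := rfl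
    _ = ∑ r, ∑ a, v a * current (fun s => Ψ N r s) l a q := by
        simp_rw [Finset.mul_sum]; exact Finset.sum_comm
    _ ≤ ∑ r, ‖v‖ * ∑ s, ‖Ψ N r s q‖ ^ 2 :=
        Finset.sum_le_sum fun r _ => re_spinForm_alpha_le v l fun s => Ψ N r s q
    _ = ‖v‖ * density Ψ N q := by
        rw [← Finset.mul_sum, density]

lemma config_eq_sum (c : Config M N) :
    c = ∑ k, ∑ a, c.1 k a • xDir k a + ∑ l, ∑ a, c.2 l a • yDir l a := by
  have h : ∀ {n : ℕ} (z : Fin n → Space), z = ∑ k, ∑ a, z k a •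
      (Pi.single k (EuclideanSpace.single a (1 : ℝ)) : Fin n → Space) := by
    intro n z
    ext k a
    simp [Finset.sum_apply, Pi.single_apply, Finset.sum_ite_eq]
  refine Prod.ext ?_ ?_
  · simp only [xDir, yDir, Prod.fst_add, Prod.fst_sum, Prod.smul_fst, smul_zero,
      Finset.sum_const_zero, add_zero]
    exact h c.1
  · simp only [xDir, yDir, Prod.snd_add, Prod.snd_sum, Prod.smul_snd, smul_zero,
      Finset.sum_const_zero, zero_add]
    exact h c.2

/-- The cone condition on a weight makes up for the transport of the density by the free evolution:
the currents are the density times velocities of norm at most one. -/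
lemma transport_nonpos {Ψ : Wave M} {q : Config M N} {σ : ℝ} (hσ : |σ| ≤ 1)
    (D : ℝ × Config M N →L[ℝ] ℝ) (hD : ∀ c : Config M N, ‖c‖ ≤ 1 → D (1, c) ≤ 0) :
    D (1, 0) * density Ψ N q + σ *
      (∑ k, ∑ a, D (0, xDir k a) * currentX Ψ N q k a
        + ∑ l, ∑ a, D (0, yDir l a) * currentY Ψ N q l a) ≤ 0 := by
  set ρ := density Ψ N q with hρ
  have hρ0 : 0 ≤ ρ := by rw [hρ]; unfold density; positivity
  let j : Config M N := (currentX Ψ N q, currentY Ψ N q)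
  have hj : ‖j‖ ≤ ρ := by
    refine norm_prod_le_iff.2 ⟨?_, ?_⟩
    · exact (pi_norm_le_iff_of_nonneg hρ0).2 fun k => norm_currentX_le Ψ q k
    · exact (pi_norm_le_iff_of_nonneg hρ0).2 fun l => norm_currentY_le Ψ q l
  have hsum : ∑ k, ∑ a, D (0, xDir k a) * currentX Ψ N q k a
        + ∑ l, ∑ a, D (0, yDir l a) * currentY Ψ N q l a = D (0, j) := by
    obtain ⟨L, hL⟩ : ∃ L : Config M N →L[ℝ] ℝ, ∀ v, D (0, v) = L v :=
      ⟨D.comp (ContinuousLinearMap.inr ℝ ℝ _), fun v => rfl⟩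
    simp only [hL]
    conv_rhs => rw [config_eq_sum j]
    simp only [map_add, map_sum, map_smul, smul_eq_mul]
    congr 1
    · exact Finset.sum_congr rfl fun k _ => Finset.sum_congr rfl fun a _ => mul_comm _ _
    · exact Finset.sum_congr rfl fun l _ => Finset.sum_congr rfl fun a _ => mul_comm _ _
  rw [hsum]
  rcases hρ0.eq_or_lt with h0 | hpos
  · have : j = 0 := norm_le_zero_iff.1 (h0 ▸ hj)
    rw [← h0, this, Prod.mk_zero_zero, map_zero]
    simp
  · have h1 : ‖(σ / ρ) • j‖ ≤ 1 := by
      rw [norm_smul, Real.norm_eq_abs, abs_div, abs_of_pos hpos, div_mul_eq_mul_div,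
        div_le_one hpos]
      calc |σ| * ‖j‖ ≤ 1 * ρ := by gcongr
        _ = ρ := one_mul ρ
    have h2 := hD _ h1
    have h3 : D (1, 0) * ρ + σ * D (0, j) = ρ * D (1, (σ / ρ) • j) := by
      have : ((1, (σ / ρ) • j) : ℝ × Config M N) = (1, 0) + (σ / ρ) • (0, j) := by simp
      rw [this, map_add, map_smul, smul_eq_mul]
      field_simp
    rw [h3]
    exact mul_nonpos_of_nonneg_of_nonpos hpos.le h2

/-- The continuity equation with the interaction as a source term. -/
lemma IsFlow.deriv_density {σ mx my δ : ℝ} {φ : Space → ℝ} {g : Fin 4 → Fin 4 → Fin 4 → ℂ}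
    {Φ : ℝ → Wave M} (h : IsFlow σ mx my δ φ g Φ) (t : ℝ) (q : Config M N) :
    HasDerivAt (fun τ => density (Φ τ) N q)
      (-σ * (∑ k, ∑ a, ∑ s, fderiv ℝ (current (fun r => Φ t N r s) k a) q (xDir k a)
          + ∑ l, ∑ a, ∑ r, fderiv ℝ (current (fun s => Φ t N r s) l a) q (yDir l a))
        + σ * (2 * (∑ r, ∑ s, (starRingEnd ℂ) (Φ t N r s q) *
            interaction δ φ g (Φ t) N r s q).im)) t := by
  have hdiff : ∀ r s, DifferentiableAt ℝ (Φ t N r s) q := fun r s =>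
    (h.smooth.contDiff_slice t N r s).differentiable (by simp) q
  have h1 : HasDerivAt (fun τ => density (Φ τ) N q)
      (∑ r, ∑ s, 2 * inner ℝ (Φ t N r s q) (deriv (fun τ => Φ τ N r s q) t)) t := by
    unfold density
    exact HasDerivAt.fun_sum fun r _ => HasDerivAt.fun_sum fun s _ =>
      (h.smooth.hasDerivAt t N r s q).norm_sq
  convert h1 using 1
  have h2 : ∀ r s, inner ℝ (Φ t N r s q) (deriv (fun τ => Φ τ N r s q) t) =
      σ * ((starRingEnd ℂ) (Φ t N r s q) * hamiltonian mx my δ φ g (Φ t) N r s q).im := by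
    intro r s
    have h3 : deriv (fun τ => Φ τ N r s q) t =
        -Complex.I * (σ * hamiltonian mx my δ φ g (Φ t) N r s q) := by
      rw [← h.equation, ← mul_assoc]
      simp
    rw [Complex.inner, h3]
    simp only [Complex.mul_re, Complex.mul_im, Complex.neg_re, Complex.neg_im, Complex.I_re,
      Complex.I_im, Complex.ofReal_re, Complex.ofReal_im, Complex.conj_re, Complex.conj_im]
    ring
  have hX : ∀ k : Fin M, 2 * (∑ r, ∑ s, (starRingEnd ℂ) (Φ t N r s q) *
      freeX mx k (Φ t) N r s q).im
      = -∑ a, ∑ s, fderiv ℝ (current (fun r => Φ t N r s) k a) q (xDir k a) := by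
    intro k
    rw [Finset.sum_comm, Complex.im_sum, Finset.mul_sum,
      Finset.sum_comm (s := (Finset.univ : Finset (Fin 3))), ← Finset.sum_neg_distrib]
    exact Finset.sum_congr rfl fun s _ => two_im_free_eq (fun r => hdiff r s) k mx (xDir k)
  have hY : 2 * (∑ r, ∑ s, (starRingEnd ℂ) (Φ t N r s q) * freeY my (Φ t) N r s q).im
      = -∑ l, ∑ a, ∑ r, fderiv ℝ (current (fun s => Φ t N r s) l a) q (yDir l a) := by
    have : ∀ l : Fin N, 2 * (∑ r, ∑ s, (starRingEnd ℂ) (Φ t N r s q) *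
        (-Complex.I * ∑ a : Fin 3, ∑ s' : Fin 4,
          alpha a (s l) s' * fderiv ℝ (Φ t N r (Function.update s l s')) q (yDir l a)
        + (my : ℂ) * ∑ s' : Fin 4, beta (s l) s' * Φ t N r (Function.update s l s') q)).im
        = -∑ a, ∑ r, fderiv ℝ (current (fun s => Φ t N r s) l a) q (yDir l a) := by
      intro l
      rw [Complex.im_sum, Finset.mul_sum,
        Finset.sum_comm (s := (Finset.univ : Finset (Fin 3))), ← Finset.sum_neg_distrib]
      exact Finset.sum_congr rfl fun r _ => two_im_free_eq (fun s => hdiff r s) l my (yDir l)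
    rw [← Finset.sum_neg_distrib, ← Finset.sum_congr rfl fun l _ => this l, ← Finset.mul_sum,
      ← Complex.im_sum]
    congr 2
    simp only [freeY, Finset.mul_sum (s := (Finset.univ : Finset (Fin N)))]
    exact ((Finset.sum_congr rfl fun r _ => Finset.sum_comm).trans Finset.sum_comm)
  have hH : ∀ r s, (starRingEnd ℂ) (Φ t N r s q) * hamiltonian mx my δ φ g (Φ t) N r s q =
      ∑ k, (starRingEnd ℂ) (Φ t N r s q) * freeX mx k (Φ t) N r s q
      + (starRingEnd ℂ) (Φ t N r s q) * freeY my (Φ t) N r s q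
      + (starRingEnd ℂ) (Φ t N r s q) * interaction δ φ g (Φ t) N r s q := by
    intro r s
    rw [hamiltonian, interaction, ← Finset.mul_sum]
    ring
  have hsum : ∑ r, ∑ s, 2 * (σ * ((starRingEnd ℂ) (Φ t N r s q) *
      hamiltonian mx my δ φ g (Φ t) N r s q).im) =
      σ * (2 * (∑ r, ∑ s, (starRingEnd ℂ) (Φ t N r s q) *
        hamiltonian mx my δ φ g (Φ t) N r s q).im) := by
    simp only [Complex.im_sum, Finset.mul_sum]
    exact Finset.sum_congr rfl fun r _ => Finset.sum_congr rfl fun s _ => by ring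
  simp only [h2]
  rw [hsum]
  simp only [hH, Finset.sum_add_distrib, Complex.add_im]
  have hXs : 2 * (∑ r, ∑ s, ∑ k, (starRingEnd ℂ) (Φ t N r s q) * freeX mx k (Φ t) N r s q).im
      = -∑ k, ∑ a, ∑ s, fderiv ℝ (current (fun r => Φ t N r s) k a) q (xDir k a) := by
    rw [← Finset.sum_neg_distrib, ← Finset.sum_congr rfl fun k _ => hX k, ← Finset.mul_sum,
      ← Complex.im_sum]
    congr 2
    exact ((Finset.sum_congr rfl fun r _ => Finset.sum_comm).trans Finset.sum_comm)
  linear_combination -σ * hXs - σ * hY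

/-! ### The localized energy -/

instance : (volume : Measure (Config M N)).IsAddHaarMeasure := by
  have h : ∀ n : ℕ, (volume : Measure (Fin n → Space)).IsAddHaarMeasure := fun n => by
    rw [volume_pi]; infer_instance
  have := h M
  have := h N
  exact Measure.prod.instIsAddHaarMeasure _ _

lemma contDiff_current {ι : Type*} [Fintype ι] [DecidableEq ι] {E : Type*} [NormedAddCommGroup E]
    [NormedSpace ℝ E] {n : WithTop ℕ∞} {ψ : (ι → Fin 4) → E → ℂ} (hψ : ∀ r, ContDiff ℝ n (ψ r))
    (k : ι) (a : Fin 3) : ContDiff ℝ n (current ψ k a) := by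
  unfold current spinForm
  refine Complex.reCLM.contDiff.comp (ContDiff.sum fun r _ => ContDiff.sum fun b _ => ?_)
  exact ((Complex.conjCLE.contDiff.comp (hψ r)).mul contDiff_const).mul (hψ _)

lemma integral_sum_sum_sum_eq_neg {α ι κ ν : Type*} [MeasurableSpace α] {μ : Measure α} [Fintype ι]
    [Fintype κ] [Fintype ν] {f g : ι → κ → ν → α → ℝ}
    (h : ∀ i j k, Integrable (f i j k) μ ∧ Integrable (g i j k) μ ∧
      ∫ q, f i j k q ∂μ = -∫ q, g i j k q ∂μ) :
    Integrable (fun q => ∑ i, ∑ j, ∑ k, f i j k q) μ ∧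
    Integrable (fun q => ∑ i, ∑ j, ∑ k, g i j k q) μ ∧
    ∫ q, ∑ i, ∑ j, ∑ k, f i j k q ∂μ = -∫ q, ∑ i, ∑ j, ∑ k, g i j k q ∂μ := by
  have hs : ∀ {u : ι → κ → ν → α → ℝ}, (∀ i j k, Integrable (u i j k) μ) →
      Integrable (fun q => ∑ i, ∑ j, ∑ k, u i j k q) μ ∧
      ∫ q, ∑ i, ∑ j, ∑ k, u i j k q ∂μ = ∑ i, ∑ j, ∑ k, ∫ q, u i j k q ∂μ := by
    intro u hu
    have h1 : ∀ i j, Integrable (fun q => ∑ k, u i j k q) μ := fun i j =>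
      integrable_finsetSum _ fun k _ => hu i j k
    have h2 : ∀ i, Integrable (fun q => ∑ j, ∑ k, u i j k q) μ := fun i =>
      integrable_finsetSum _ fun j _ => h1 i j
    refine ⟨integrable_finsetSum _ fun i _ => h2 i, ?_⟩
    rw [integral_finsetSum _ fun i _ => h2 i]
    refine Finset.sum_congr rfl fun i _ => ?_
    rw [integral_finsetSum _ fun j _ => h1 i j]
    refine Finset.sum_congr rfl fun j _ => ?_
    rw [integral_finsetSum _ fun k _ => hu i j k]
  have hf := hs fun i j k => (h i j k).1
  have hg := hs fun i j k => (h i j k).2.1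
  refine ⟨hf.1, hg.1, ?_⟩
  simp only [hf.2, hg.2, (h _ _ _).2.2, Finset.sum_neg_distrib]

/-- If a rate `f` splits into a local part `a`, the divergences `b`, `b'` and a source `s`, and if
the divergences integrate to `-c` and `-c'`, then only the source contributes to the integral of `f`
from above as soon as `a + σ (c + c') ≤ 0`. -/
lemma integral_le_integral_source {α : Type*} [MeasurableSpace α] {μ : Measure α} {σ : ℝ}
    {f a b b' c c' s : α → ℝ} (hpt : ∀ q, f q = a q - σ * (b q + b' q) + s q)
    (hf : Integrable f μ) (ha : Integrable a μ)
    (hb : Integrable b μ ∧ Integrable c μ ∧ ∫ q, b q ∂μ = -∫ q, c q ∂μ)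
    (hb' : Integrable b' μ ∧ Integrable c' μ ∧ ∫ q, b' q ∂μ = -∫ q, c' q ∂μ)
    (hneg : ∀ q, a q + σ * (c q + c' q) ≤ 0) :
    Integrable s μ ∧ ∫ q, f q ∂μ ≤ ∫ q, s q ∂μ := by
  have ibb : Integrable (fun q => σ * (b q + b' q)) μ := (hb.1.add hb'.1).const_mul σ
  have icc : Integrable (fun q => σ * (c q + c' q)) μ := (hb.2.1.add hb'.2.1).const_mul σ
  have iab : Integrable (fun q => a q - σ * (b q + b' q)) μ := ha.sub ibb
  have is : Integrable s μ := by
    have : s = fun q => f q - (a q - σ * (b q + b' q)) := by ext q; rw [hpt]; ring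
    rw [this]
    exact hf.sub iab
  refine ⟨is, ?_⟩
  have h1 := integral_nonpos (μ := μ) hneg
  rw [integral_add ha icc, integral_const_mul, integral_add hb.2.1 hb'.2.1] at h1
  simp only [hpt]
  rw [integral_add iab is, integral_sub ha ibb, integral_const_mul, integral_add hb.1 hb'.1,
    hb.2.2, hb'.2.2]
  linarith

lemma density_nonneg (Ψ : Wave M) (q : Config M N) : 0 ≤ density Ψ N q := by
  unfold density; positivity

lemma weightedNormSq_eq_lintegral {w : Config M N → ℝ} {Ψ : Wave M} (hw : Measurable w)
    (hw0 : ∀ q, 0 ≤ w q) (hΨ : ∀ r s, Measurable (Ψ N r s)) :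
    weightedNormSq w Ψ = ∫⁻ q, ENNReal.ofReal (w q * density Ψ N q) := by
  have hm : ∀ r s, Measurable fun q => ENNReal.ofReal (w q) * ‖Ψ N r s q‖ₑ ^ 2 := fun r s =>
    (ENNReal.measurable_ofReal.comp hw).mul ((hΨ r s).enorm.pow_const 2)
  have hpt : ∀ q, ENNReal.ofReal (w q * density Ψ N q) =
      ∑ r, ∑ s, ENNReal.ofReal (w q) * ‖Ψ N r s q‖ₑ ^ 2 := by
    intro q
    rw [ENNReal.ofReal_mul (hw0 q), density,
      ENNReal.ofReal_sum_of_nonneg fun r _ => by positivity, Finset.mul_sum]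
    refine Finset.sum_congr rfl fun r _ => ?_
    rw [ENNReal.ofReal_sum_of_nonneg fun s _ => by positivity, Finset.mul_sum]
    refine Finset.sum_congr rfl fun s _ => ?_
    rw [ENNReal.ofReal_pow (norm_nonneg _), ofReal_norm]
  simp only [hpt]
  rw [lintegral_finsetSum _ fun r _ => Finset.measurable_sum _ fun s _ => hm r s]
  refine Finset.sum_congr rfl fun r _ => ?_
  rw [lintegral_finsetSum _ fun s _ => hm r s]

lemma measurable_interaction {δ : ℝ} {φ : Space → ℝ} (hφ : Continuous φ)
    {g : Fin 4 → Fin 4 → Fin 4 → ℂ} {Ψ : Wave M} (hΨ : ∀ N r s, Continuous (Ψ N r s))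
    (r : Fin M → Fin 4) (s : Fin N → Fin 4) : Measurable (interaction δ φ g Ψ N r s) :=
  (Finset.measurable_sum _ fun k _ => measurable_absorb hφ (hΨ (N + 1)) k r s).add
    (Finset.measurable_sum _ fun k _ => (continuous_emit hφ hΨ k r s).measurable)

/-- A nonnegative `C¹` function on space-time that, for times in `[0, T]`, does not increase along
any motion with velocity of norm at most one. On `ℝ × Config M N`, whose spatial norm is the maximum
of the Euclidean norms of the particle positions, these are the motions in which no particle is
faster than light. -/
structure IsConeFunction {E : Type*} [NormedAddCommGroup E] [NormedSpace ℝ E] (T : ℝ)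
    (F : ℝ × E → ℝ) : Prop where
  contDiff : ContDiff ℝ 1 F
  nonneg : ∀ p, 0 ≤ F p
  cone : ∀ τ ∈ Icc 0 T, ∀ q c : E, ‖c‖ ≤ 1 → fderiv ℝ F (τ, q) (1, c) ≤ 0

section Energy

variable {σ mx my δ T : ℝ} {φ : Space → ℝ} {g : Fin 4 → Fin 4 → Fin 4 → ℂ} {Φ : ℝ → Wave M}
  {w : ∀ N, ℝ × Config M N → ℝ}

/-- The energy of the sector `N` that is localized by the weight `w` at time `τ`. -/
noncomputable def localEnergy (w : ∀ N, ℝ × Config M N → ℝ) (Φ : ℝ → Wave M) (N : ℕ) (τ : ℝ) :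
    ℝ≥0∞ :=
  weightedNormSq (fun q => w N (τ, q)) (Φ τ)

/-- The time derivative of the localized energy is only due to the interaction, up to a term of the
favourable sign. The support is controlled on the larger interval `(-1, T + 1)` since the derivative
at the end points of `[0, T]` is two-sided. -/
lemma deriv_localized_le (hflow : IsFlow σ mx my δ φ g Φ) (hσ : |σ| ≤ 1)
    (hw : ∀ N, IsConeFunction T (w N)) {K : Set (Config M N)} (hK : IsCompact K)
    (hwK : ∀ τ ∈ Ioo (-1) (T + 1), ∀ q ∉ K, w N (τ, q) = 0) {t : ℝ} (ht : t ∈ Icc 0 T) :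
    ∃ D : ℝ, HasDerivAt (fun τ => ∫ q, w N (τ, q) * density (Φ τ) N q) D t ∧
      Integrable (fun q : Config M N => w N (t, q) *
        (σ * (2 * (∑ r, ∑ s, (starRingEnd ℂ) (Φ t N r s q) *
            interaction δ φ g (Φ t) N r s q).im))) ∧
      D ≤ ∫ q : Config M N, w N (t, q) *
        (σ * (2 * (∑ r, ∑ s, (starRingEnd ℂ) (Φ t N r s q) *
            interaction δ φ g (Φ t) N r s q).im)) := by
  have htU : t ∈ Ioo (-1) (T + 1) := ⟨by linarith [ht.1], by linarith [ht.2]⟩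
  set F : ℝ × Config M N → ℝ := fun p => w N p * density (Φ p.1) N p.2 with hF
  have hFd : ContDiff ℝ 1 F := (hw N).contDiff.mul (hflow.smooth.contDiff_density N)
  obtain ⟨hint, hder⟩ := hasDerivAt_integral_of_contDiff volume hFd hK isOpen_Ioo
    (fun τ hτ q hq => by simp [hF, hwK τ hτ q hq]) htU
  have hwd : ∀ q, DifferentiableAt ℝ (w N) (t, q) := fun q =>
    (hw N).contDiff.differentiable one_ne_zero _
  have hvd : ContDiff ℝ 1 fun q => w N (t, q) :=
    (hw N).contDiff.comp (contDiff_const.prodMk contDiff_id)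
  have hvc : HasCompactSupport fun q => w N (t, q) :=
    HasCompactSupport.intro hK fun q hq => hwK t htU q hq
  have hcΦ : ∀ r s, ContDiff ℝ 1 (Φ t N r s) := fun r s =>
    (hflow.smooth.contDiff_slice t N r s).of_le (by exact_mod_cast le_top)
  have ibpX := integral_sum_sum_sum_eq_neg fun (k : Fin M) (a : Fin 3) (s : Fin N → Fin 4) =>
    integral_mul_fderiv_of_compact_support volume hvd hvc
      (contDiff_current (fun r => hcΦ r s) k a) (xDir k a)
  have ibpY := integral_sum_sum_sum_eq_neg fun (l : Fin N) (a : Fin 3) (r : Fin M → Fin 4) =>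
    integral_mul_fderiv_of_compact_support volume hvd hvc
      (contDiff_current (fun s => hcΦ r s) l a) (yDir l a)
  refine ⟨_, hder, integral_le_integral_source (σ := σ)
    (a := fun q => fderiv ℝ (w N) (t, q) (1, 0) * density (Φ t) N q) ?_ hint ?_ ibpX ibpY ?_⟩
  · intro q
    have h1 := hasDerivAt_slice (hFd.differentiable one_ne_zero (t, q))
    have h2 := (hasDerivAt_slice (hwd q)).mul (hflow.deriv_density t q)
    rw [h1.unique h2]
    simp only [← Finset.mul_sum]
    ring
  · refine Continuous.integrable_of_hasCompactSupport ?_ (HasCompactSupport.intro hK ?_)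
    · have h1 : Continuous fun p : ℝ × Config M N =>
          fderiv ℝ (w N) p (1, 0) * density (Φ p.1) N p.2 :=
        (((hw N).contDiff.continuous_fderiv one_ne_zero).clm_apply continuous_const).mul
          (hflow.smooth.contDiff_density N).continuous
      exact h1.comp (Continuous.prodMk_right t)
    · intro q hq
      have h2 : HasDerivAt (fun τ => w N (τ, q)) 0 t :=
        (hasDerivAt_const t (0 : ℝ)).congr_of_eventuallyEq (by
          filter_upwards [isOpen_Ioo.mem_nhds htU] with τ hτ using hwK τ hτ q hq)
      rw [(hasDerivAt_slice (hwd q)).unique h2, zero_mul]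
  · intro q
    have := transport_nonpos (Ψ := Φ t) (q := q) hσ (fderiv ℝ (w N) (t, q)) ((hw N).cone t ht q)
    simpa only [fderiv_slice (hwd q), currentX, currentY, Finset.mul_sum] using this

end Energy

/-! ### The energy inequality for compactly supported weights -/

section Energy

variable {σ mx my δ T : ℝ} {φ : Space → ℝ} {g : Fin 4 → Fin 4 → Fin 4 → ℂ} {Φ : ℝ → Wave M}
  {w : ∀ N, ℝ × Config M N → ℝ}

/-- The source term of the continuity equation, estimated by Young's inequality in which the factor
`√(N + 1)` is distributed so that both resulting terms carry it. -/
lemma source_le {v n σ : ℝ} (hv : 0 ≤ v) (hn : 0 < n) (hσ : |σ| ≤ 1) (Ψ X : Wave M)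
    (q : Config M N) :
    v * (σ * (2 * (∑ r, ∑ s, (starRingEnd ℂ) (Ψ N r s q) * X N r s q).im)) ≤
      n * (v * density Ψ N q) + n⁻¹ * (v * density X N q) := by
  have h1 : |(∑ r, ∑ s, (starRingEnd ℂ) (Ψ N r s q) * X N r s q).im| * 2 ≤
      n * density Ψ N q + n⁻¹ * density X N q := by
    calc |(∑ r, ∑ s, (starRingEnd ℂ) (Ψ N r s q) * X N r s q).im| * 2
        ≤ (∑ r, ∑ s, ‖Ψ N r s q‖ * ‖X N r s q‖) * 2 := by
          gcongr
          refine (Complex.abs_im_le_norm _).trans ((norm_sum_le _ _).trans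
            (Finset.sum_le_sum fun r _ => (norm_sum_le _ _).trans
              (Finset.sum_le_sum fun s _ => ?_)))
          rw [norm_mul, RCLike.norm_conj]
      _ = ∑ r, ∑ s, ‖Ψ N r s q‖ * ‖X N r s q‖ * 2 := by simp only [Finset.sum_mul]
      _ ≤ ∑ r, ∑ s, (n * ‖Ψ N r s q‖ ^ 2 + n⁻¹ * ‖X N r s q‖ ^ 2) := by
          gcongr with r _ s _
          have h2 : 0 ≤ n⁻¹ * (n * ‖Ψ N r s q‖ - ‖X N r s q‖) ^ 2 := by positivity
          have h3 : n⁻¹ * (n * ‖Ψ N r s q‖ - ‖X N r s q‖) ^ 2 = n * ‖Ψ N r s q‖ ^ 2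
              + n⁻¹ * ‖X N r s q‖ ^ 2 - ‖Ψ N r s q‖ * ‖X N r s q‖ * 2 := by
            field_simp
            ring
          linarith
      _ = _ := by simp only [density, Finset.sum_add_distrib, Finset.mul_sum]
  generalize (∑ r, ∑ s, (starRingEnd ℂ) (Ψ N r s q) * X N r s q).im = z at *
  have h2 : σ * (2 * z) ≤ |z| * 2 := by
    calc σ * (2 * z) ≤ |σ * (2 * z)| := le_abs_self _
      _ = |σ| * (|z| * 2) := by rw [abs_mul, abs_mul, abs_two, mul_comm 2]
      _ ≤ 1 * (|z| * 2) := by gcongr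
      _ = _ := one_mul _
  calc _ ≤ v * (n * density Ψ N q + n⁻¹ * density X N q) := by gcongr; linarith
    _ = _ := by ring

lemma SmoothTimeWave.continuous_slice (h : SmoothTimeWave Φ) (t : ℝ) (N : ℕ)
    (r : Fin M → Fin 4) (s : Fin N → Fin 4) : Continuous (Φ t N r s) :=
  (h.contDiff_slice t N r s).continuous

lemma integrable_localized (hΦ : SmoothTimeWave Φ) (hw : ∀ N, IsConeFunction T (w N))
    {K : Set (Config M N)} (hK : IsCompact K) {t : ℝ} (hwK : ∀ q ∉ K, w N (t, q) = 0) :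
    Integrable fun q => w N (t, q) * density (Φ t) N q := by
  have h1 : Continuous fun p : ℝ × Config M N => w N p * density (Φ p.1) N p.2 :=
    (hw N).contDiff.continuous.mul (hΦ.contDiff_density N).continuous
  exact (h1.comp (Continuous.prodMk_right t)).integrable_of_hasCompactSupport
    (HasCompactSupport.intro hK fun q hq => by simp [hwK q hq])

lemma localEnergy_eq_ofReal (hΦ : SmoothTimeWave Φ) (hw : ∀ N, IsConeFunction T (w N))
    {K : Set (Config M N)} (hK : IsCompact K) {t : ℝ} (hwK : ∀ q ∉ K, w N (t, q) = 0) :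
    localEnergy w Φ N t = ENNReal.ofReal (∫ q, w N (t, q) * density (Φ t) N q) := by
  rw [localEnergy, weightedNormSq_eq_lintegral, ofReal_integral_eq_lintegral_ofReal]
  · exact integrable_localized hΦ hw hK hwK
  · exact ae_of_all _ fun q => mul_nonneg ((hw _).nonneg _) (density_nonneg _ _)
  · exact ((hw N).contDiff.continuous.comp (Continuous.prodMk_right t)).measurable
  · exact fun q => (hw _).nonneg _
  · exact fun r s => (hΦ.continuous_slice t N r s).measurable

/-- The bound on the interaction that `exists_interaction_bound` provides, as a predicate on its
constant. -/
def IsInteractionBound (M : ℕ) (δ : ℝ) (φ : Space → ℝ) (g : Fin 4 → Fin 4 → Fin 4 → ℂ)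
    (A : ℝ≥0∞) : Prop :=
  ∀ (Ψ : Wave M) (w : ∀ N, Config M N → ℝ),
    (∀ N r s, Continuous (Ψ N r s)) → (∀ N, Continuous (w N)) →
    IsCompatible δ φ Ψ w → ∀ N,
    ∑ r, ∑ s, ∫⁻ q, ENNReal.ofReal (w N q) * ‖interaction δ φ g Ψ N r s q‖ₑ ^ 2
      ≤ A * (N + 1) * (weightedNormSq (w (N - 1)) Ψ + weightedNormSq (w (N + 1)) Ψ)

/-- The energy inequality for weights of compact support. -/
lemma localEnergy_le_of_compact {A : ℝ≥0∞} (hA : A ≠ ⊤) (hAb : IsInteractionBound M δ φ g A)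
    (hφ : Continuous φ)
    (hflow : IsFlow σ mx my δ φ g Φ) (hσ : |σ| ≤ 1) (hw : ∀ N, IsConeFunction T (w N))
    (hsupp : ∀ N, ∃ K : Set (Config M N), IsCompact K ∧
      ∀ τ ∈ Ioo (-1) (T + 1), ∀ q ∉ K, w N (τ, q) = 0)
    (hcomp : ∀ τ ∈ Icc 0 T, IsCompatible δ φ (Φ τ) fun N q => w N (τ, q))
    (N : ℕ) {s τ : ℝ} (hs : 0 ≤ s) (hsτ : s ≤ τ) (hτ : τ ≤ T) :
    localEnergy w Φ N τ ≤ localEnergy w Φ N s +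
      ENNReal.ofReal ((A.toReal + 1) * √((N : ℝ) + 1)) *
        ∫⁻ r in Icc s τ, neighbours (localEnergy w Φ) N r := by
  choose K hK hwK using hsupp
  have hU : ∀ t ∈ Icc 0 T, t ∈ Ioo (-1) (T + 1) := fun t ht =>
    ⟨by linarith [ht.1], by linarith [ht.2]⟩
  let e : ℕ → ℝ → ℝ := fun N t => ∫ q, w N (t, q) * density (Φ t) N q
  have he : ∀ N, ∀ t ∈ Icc 0 T, localEnergy w Φ N t = ENNReal.ofReal (e N t) := fun N t ht =>
    localEnergy_eq_ofReal hflow.smooth hw (hK N) (hwK N t (hU t ht))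
  have he0 : ∀ N t, 0 ≤ e N t := fun N t =>
    integral_nonneg fun q => mul_nonneg ((hw _).nonneg _) (density_nonneg _ _)
  set n := √((N : ℝ) + 1) with hn
  have hnpos : 0 < n := Real.sqrt_pos.2 (by positivity)
  have hnsq : n * n = N + 1 := Real.mul_self_sqrt (by positivity)
  have hder : ∀ N, ∀ t ∈ Icc 0 T, ∃ D, HasDerivAt (e N) D t := fun N t ht => by
    obtain ⟨D, hD, -⟩ := deriv_localized_le hflow hσ hw (hK N) (hwK N) ht
    exact ⟨D, hD⟩
  have hcont : ∀ N, ContinuousOn (e N) (Icc 0 T) := fun N t ht =>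
    (hder N t ht).choose_spec.continuousAt.continuousWithinAt
  have hrate : ∀ t ∈ Icc 0 T, ∃ D, HasDerivAt (e N) D t ∧
      D ≤ (A.toReal + 1) * n * (e (N - 1) t + e N t + e (N + 1) t) := by
    intro t ht
    obtain ⟨D, hD, hint, hle⟩ := deriv_localized_le hflow hσ hw (hK N) (hwK N) ht
    refine ⟨D, hD, hle.trans ?_⟩
    have hΦc := hflow.smooth.continuous_slice t
    have hwc : ∀ N, Continuous fun q => w N (t, q) := fun N =>
      (hw N).contDiff.continuous.comp (Continuous.prodMk_right t)
    have hbd : ∫⁻ q, ENNReal.ofReal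
        (w N (t, q) * density (interaction δ φ g (Φ t)) N q) ≤
        A * (N + 1) * ENNReal.ofReal (e (N - 1) t + e (N + 1) t) := by
      rw [← weightedNormSq_eq_lintegral (hwc N).measurable (fun q => (hw _).nonneg _)
        (fun r s => measurable_interaction hφ hΦc r s),
        ENNReal.ofReal_add (he0 _ _) (he0 _ _), ← he _ t ht, ← he _ t ht]
      exact hAb (Φ t) (fun N q => w N (t, q)) hΦc hwc (hcomp t ht) N
    have hnn : ∀ q, 0 ≤ w N (t, q) * density (interaction δ φ g (Φ t)) N q := fun q =>
      mul_nonneg ((hw _).nonneg _) (density_nonneg _ _)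
    have hmeas : Measurable fun q => w N (t, q) * density (interaction δ φ g (Φ t)) N q := by
      refine (hwc N).measurable.mul ?_
      unfold density
      exact Finset.measurable_sum _ fun r _ => Finset.measurable_sum _ fun s _ =>
        (measurable_interaction hφ hΦc r s).norm.pow_const 2
    have hfin : A * (N + 1) * ENNReal.ofReal (e (N - 1) t + e (N + 1) t) ≠ ⊤ := by finiteness
    have hintI : Integrable fun q => w N (t, q) * density (interaction δ φ g (Φ t)) N q := by
      refine ⟨hmeas.aestronglyMeasurable, ?_⟩
      rw [hasFiniteIntegral_iff_ofReal (ae_of_all _ hnn)]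
      exact hbd.trans_lt hfin.lt_top
    have hI : ∫ q, w N (t, q) * density (interaction δ φ g (Φ t)) N q ≤
        A.toReal * (n * n) * (e (N - 1) t + e (N + 1) t) := by
      rw [integral_eq_lintegral_of_nonneg_ae (ae_of_all _ hnn) hmeas.aestronglyMeasurable]
      refine (ENNReal.toReal_mono hfin hbd).trans (le_of_eq ?_)
      rw [ENNReal.toReal_mul, ENNReal.toReal_mul, ENNReal.toReal_ofReal
        (add_nonneg (he0 _ _) (he0 _ _)), hnsq, ENNReal.toReal_add (by simp) (by simp)]
      simp
    have hintΦ := integrable_localized hflow.smooth hw (hK N) (hwK N t (hU t ht))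
    calc _ ≤ ∫ q, (n * (w N (t, q) * density (Φ t) N q)
          + n⁻¹ * (w N (t, q) * density (interaction δ φ g (Φ t)) N q)) :=
        integral_mono hint ((hintΦ.const_mul n).add (hintI.const_mul n⁻¹)) fun q =>
          source_le ((hw _).nonneg _) hnpos hσ _ _ q
      _ = n * e N t + n⁻¹ * ∫ q, w N (t, q) * density (interaction δ φ g (Φ t)) N q := by
        rw [integral_add (hintΦ.const_mul n) (hintI.const_mul n⁻¹), integral_const_mul,
          integral_const_mul]
      _ ≤ n * e N t + n⁻¹ * (A.toReal * (n * n) * (e (N - 1) t + e (N + 1) t)) := by gcongr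
      _ = n * e N t + A.toReal * n * (e (N - 1) t + e (N + 1) t) := by
        field_simp
      _ ≤ _ := by
        have h1 := mul_nonneg hnpos.le (add_nonneg (he0 (N - 1) t) (he0 (N + 1) t))
        have h2 := mul_nonneg (mul_nonneg (ENNReal.toReal_nonneg (a := A)) hnpos.le) (he0 N t)
        linarith
  set C := (A.toReal + 1) * n with hC
  have hC0 : 0 ≤ C := mul_nonneg (by positivity) hnpos.le
  have hsub : Icc s τ ⊆ Icc 0 T := Icc_subset_Icc hs hτ
  have hsubo : Ioo s τ ⊆ Icc 0 T := Ioo_subset_Icc_self.trans hsub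
  have hhc : ContinuousOn (fun t => C * (e (N - 1) t + e N t + e (N + 1) t)) (Icc s τ) :=
    continuousOn_const.mul ((((hcont _).mono hsub).add ((hcont _).mono hsub)).add
      ((hcont _).mono hsub))
  have hhi : IntegrableOn (fun t => C * (e (N - 1) t + e N t + e (N + 1) t)) (Icc s τ) :=
    hhc.integrableOn_Icc
  choose! D hD hDle using hrate
  have hmain := intervalIntegral.sub_le_integral_of_hasDeriv_right_of_le hsτ
    ((hcont N).mono hsub) (fun t ht => (hD t (hsubo ht)).hasDerivWithinAt) hhi
    (fun t ht => hDle t (hsubo ht))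
  rw [intervalIntegral.integral_of_le hsτ, ← integral_Icc_eq_integral_Ioc] at hmain
  rw [he N τ ⟨hs.trans hsτ, hτ⟩, he N s ⟨hs, hsτ.trans hτ⟩]
  calc ENNReal.ofReal (e N τ) ≤ ENNReal.ofReal (e N s +
        ∫ t in Icc s τ, C * (e (N - 1) t + e N t + e (N + 1) t)) :=
        ENNReal.ofReal_le_ofReal (by linarith)
    _ ≤ ENNReal.ofReal (e N s) + ENNReal.ofReal
        (∫ t in Icc s τ, C * (e (N - 1) t + e N t + e (N + 1) t)) := ENNReal.ofReal_add_le
    _ = _ := by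
      congr 1
      rw [ofReal_integral_eq_lintegral_ofReal hhi (ae_of_all _ fun t => mul_nonneg hC0
        (add_nonneg (add_nonneg (he0 _ _) (he0 _ _)) (he0 _ _))),
        ← lintegral_const_mul' _ _ ENNReal.ofReal_ne_top]
      refine setLIntegral_congr_fun measurableSet_Icc fun t ht => ?_
      simp only [neighbours]
      rw [ENNReal.ofReal_mul hC0, ENNReal.ofReal_add (add_nonneg (he0 _ _) (he0 _ _)) (he0 _ _),
        ENNReal.ofReal_add (he0 _ _) (he0 _ _), he _ t (hsub ht), he _ t (hsub ht),
        he _ t (hsub ht)]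

end Energy

/-! ### Cone functions and cut-offs -/

namespace IsConeFunction

variable {E E' : Type*} [NormedAddCommGroup E] [NormedSpace ℝ E] [NormedAddCommGroup E']
  [NormedSpace ℝ E'] {T : ℝ} {F G : ℝ × E → ℝ}

lemma const {c : ℝ} (hc : 0 ≤ c) : IsConeFunction T fun _ : ℝ × E => c :=
  ⟨contDiff_const, fun _ => hc, fun τ _ q c _ => by simp⟩

lemma mul (hF : IsConeFunction T F) (hG : IsConeFunction T G) :
    IsConeFunction T fun p => F p * G p := by
  refine ⟨hF.contDiff.mul hG.contDiff, fun p => mul_nonneg (hF.nonneg p) (hG.nonneg p), ?_⟩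
  intro τ hτ q c hc
  have h := ((hF.contDiff.differentiable one_ne_zero (τ, q)).hasFDerivAt).mul
    (hG.contDiff.differentiable one_ne_zero (τ, q)).hasFDerivAt
  have h' : HasFDerivAt (fun p => F p * G p) _ (τ, q) := h
  rw [h'.fderiv]
  have h2 := hF.cone τ hτ q c hc
  have h3 := hG.cone τ hτ q c hc
  simp only [_root_.add_apply, _root_.smul_apply, smul_eq_mul]
  exact add_nonpos (mul_nonpos_of_nonneg_of_nonpos (hF.nonneg _) h3)
    (mul_nonpos_of_nonneg_of_nonpos (hG.nonneg _) h2)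

lemma add (hF : IsConeFunction T F) (hG : IsConeFunction T G) :
    IsConeFunction T fun p => F p + G p := by
  refine ⟨hF.contDiff.add hG.contDiff, fun p => add_nonneg (hF.nonneg p) (hG.nonneg p), ?_⟩
  intro τ hτ q c hc
  have h : HasFDerivAt (fun p => F p + G p) _ (τ, q) :=
    ((hF.contDiff.differentiable one_ne_zero (τ, q)).hasFDerivAt).add
      (hG.contDiff.differentiable one_ne_zero (τ, q)).hasFDerivAt
  rw [h.fderiv]
  exact add_nonpos (hF.cone τ hτ q c hc) (hG.cone τ hτ q c hc)

lemma prod {ι : Type*} (s : Finset ι) {F : ι → ℝ × E → ℝ} (hF : ∀ i, IsConeFunction T (F i)) :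
    IsConeFunction T fun p => ∏ i ∈ s, F i p := by
  classical
  induction s using Finset.induction_on with
  | empty => simpa using const zero_le_one
  | insert i s hi ih =>
    simp only [Finset.prod_insert hi]
    exact (hF i).mul ih

lemma sum {ι : Type*} (s : Finset ι) {F : ι → ℝ × E → ℝ} (hF : ∀ i, IsConeFunction T (F i)) :
    IsConeFunction T fun p => ∑ i ∈ s, F i p := by
  classical
  induction s using Finset.induction_on with
  | empty => simpa using const le_rfl
  | insert i s hi ih =>
    simp only [Finset.sum_insert hi]
    exact (hF i).add ih

lemma comp_clm {G : ℝ × E' → ℝ} (hG : IsConeFunction T G) (A : E →L[ℝ] E')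
    (hA : ∀ c, ‖A c‖ ≤ ‖c‖) : IsConeFunction T fun p : ℝ × E => G (p.1, A p.2) := by
  refine ⟨hG.contDiff.comp (contDiff_fst.prodMk (A.contDiff.comp contDiff_snd)),
    fun p => hG.nonneg _, fun τ hτ q c hc => ?_⟩
  have h1 : HasFDerivAt (fun p : ℝ × E => (p.1, A p.2))
      ((ContinuousLinearMap.fst ℝ ℝ E).prod (A.comp (ContinuousLinearMap.snd ℝ ℝ E))) (τ, q) :=
    ((ContinuousLinearMap.fst ℝ ℝ E).prod
      (A.comp (ContinuousLinearMap.snd ℝ ℝ E))).hasFDerivAt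
  have h2 : HasFDerivAt (fun p : ℝ × E => G (p.1, A p.2)) _ (τ, q) :=
    (hG.contDiff.differentiable one_ne_zero (τ, A q)).hasFDerivAt.comp (τ, q) h1
  rw [h2.fderiv]
  exact hG.cone τ hτ (A q) (A c) ((hA c).trans hc)

end IsConeFunction

/-- A smooth function on space-time that is positive exactly inside the backward light cone of the
event `(R, z)`, as far as times before `R` are concerned. -/
noncomputable def cone (R : ℝ) (z : Space) (p : ℝ × Space) : ℝ :=
  Real.smoothTransition ((R - p.1) ^ 2 - ‖p.2 - z‖ ^ 2)

lemma cone_nonneg (R : ℝ) (z : Space) (p : ℝ × Space) : 0 ≤ cone R z p :=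
  Real.smoothTransition.nonneg _

lemma cone_le_one (R : ℝ) (z : Space) (p : ℝ × Space) : cone R z p ≤ 1 :=
  Real.smoothTransition.le_one _

lemma norm_lt_abs_of_cone_ne_zero {R τ : ℝ} {z x : Space} (h : cone R z (τ, x) ≠ 0) :
    ‖x - z‖ < |R - τ| := by
  by_contra! hle
  refine h (Real.smoothTransition.zero_of_nonpos ?_)
  have := pow_le_pow_left₀ (abs_nonneg _) hle 2
  rw [sq_abs] at this
  linarith

lemma norm_lt_of_cone_ne_zero {R τ : ℝ} {z x : Space} (hτ : τ ≤ R) (h : cone R z (τ, x) ≠ 0) :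
    ‖x - z‖ < R - τ := by
  simpa [abs_of_nonneg (sub_nonneg.2 hτ)] using norm_lt_abs_of_cone_ne_zero h

lemma cone_center_pos {R τ : ℝ} (z : Space) (hτ : τ < R) : 0 < cone R z (τ, z) := by
  apply Real.smoothTransition.pos_of_pos
  have : 0 < R - τ := sub_pos.2 hτ
  change 0 < (R - τ) ^ 2 - ‖z - z‖ ^ 2
  rw [sub_self, norm_zero, zero_pow two_ne_zero, sub_zero]
  exact pow_pos this 2

lemma cone_eq_one {R τ : ℝ} {z x : Space} (h : ‖x - z‖ + 1 ≤ R - τ) : cone R z (τ, x) = 1 := by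
  apply Real.smoothTransition.one_of_one_le
  dsimp only
  nlinarith [norm_nonneg (x - z)]

lemma isConeFunction_cone {R T : ℝ} (hT : T ≤ R) (z : Space) : IsConeFunction T (cone R z) := by
  have hu : ContDiff ℝ 1 fun p : ℝ × Space => (R - p.1) ^ 2 - ‖p.2 - z‖ ^ 2 :=
    ((contDiff_const.sub contDiff_fst).pow 2).sub ((contDiff_snd.sub contDiff_const).norm_sq ℝ)
  have hχ : ContDiff ℝ 1 Real.smoothTransition := Real.smoothTransition.contDiff
  refine ⟨hχ.comp hu, cone_nonneg R z, fun τ hτ x c hc => ?_⟩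
  have hu' : HasFDerivAt (fun p : ℝ × Space => (R - p.1) ^ 2 - ‖p.2 - z‖ ^ 2)
      (fderiv ℝ (fun p : ℝ × Space => (R - p.1) ^ 2 - ‖p.2 - z‖ ^ 2) (τ, x)) (τ, x) :=
    (hu.differentiable one_ne_zero _).hasFDerivAt
  have hdir : fderiv ℝ (fun p : ℝ × Space => (R - p.1) ^ 2 - ‖p.2 - z‖ ^ 2) (τ, x) (1, c) =
      -2 * (R - τ) - 2 * inner ℝ (x - z) c := by
    have hline : HasDerivAt (fun s : ℝ => ((τ + s, x + s • c) : ℝ × Space)) (1, c) 0 := by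
      refine HasDerivAt.prodMk ((hasDerivAt_id (0 : ℝ)).const_add τ) ?_
      simpa using ((hasDerivAt_id (0 : ℝ)).smul_const c).const_add x
    have h1 := HasFDerivAt.comp_hasDerivAt (0 : ℝ)
      (f := fun s : ℝ => ((τ + s, x + s • c) : ℝ × Space)) (by simpa using hu') hline
    have h2 : HasDerivAt (fun s : ℝ => (R - (τ + s)) ^ 2 - ‖x + s • c - z‖ ^ 2)
        (-2 * (R - τ) - 2 * inner ℝ (x - z) c) 0 := by
      have e1 : HasDerivAt (fun s : ℝ => (R - (τ + s)) ^ 2) (-2 * (R - τ)) 0 := by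
        have : HasDerivAt (fun s : ℝ => (R - (τ + s)) ^ 2) _ 0 :=
          (((hasDerivAt_id (0 : ℝ)).const_add τ).const_sub R).pow 2
        exact this.congr_deriv (by simp)
      have e2 : HasDerivAt (fun s : ℝ => x + s • c - z) c 0 := by
        simpa using (((hasDerivAt_id (0 : ℝ)).smul_const c).const_add x).sub_const z
      have e3 := e2.norm_sq
      simp only [zero_smul, add_zero] at e3
      exact e1.sub e3
    exact h1.unique h2
  have hcomp : HasFDerivAt (cone R z) _ (τ, x) :=
    ((hχ.differentiable one_ne_zero _).hasDerivAt).comp_hasFDerivAt (τ, x) hu'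
  rw [hcomp.fderiv, _root_.smul_apply, hdir, smul_eq_mul]
  rcases le_or_gt ((R - τ) ^ 2 - ‖x - z‖ ^ 2) 0 with hle | hpos
  · -- outside the cone the transition function is at its minimum
    have : deriv Real.smoothTransition ((R - τ) ^ 2 - ‖x - z‖ ^ 2) = 0 := by
      refine IsLocalMin.deriv_eq_zero (Eventually.of_forall fun y => ?_)
      rw [Real.smoothTransition.zero_of_nonpos hle]
      exact Real.smoothTransition.nonneg y
    rw [this, zero_mul]
  · refine mul_nonpos_of_nonneg_of_nonpos Real.smoothTransition.monotone.deriv_nonneg ?_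
    have h1 : ‖x - z‖ < R - τ := by
      have : 0 ≤ R - τ := by linarith [hτ.2]
      nlinarith [norm_nonneg (x - z)]
    have h2 : -(‖x - z‖ * ‖c‖) ≤ inner ℝ (x - z) c :=
      neg_le_of_abs_le (abs_real_inner_le_norm _ _)
    have h3 : ‖x - z‖ * ‖c‖ ≤ ‖x - z‖ := mul_le_of_le_one_right (norm_nonneg _) hc
    linarith

lemma isConeFunction_cone_x {R T : ℝ} (hT : T ≤ R) (z : Space) (k : Fin M) :
    IsConeFunction T fun p : ℝ × Config M N => cone R z (p.1, p.2.1 k) :=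
  (isConeFunction_cone hT z).comp_clm
    ((ContinuousLinearMap.proj k).comp (ContinuousLinearMap.fst ℝ (Fin M → Space) (Fin N → Space)))
    fun c => (norm_le_pi_norm c.1 k).trans (norm_fst_le c)

lemma isConeFunction_cone_y {R T : ℝ} (hT : T ≤ R) (z : Space) (l : Fin N) :
    IsConeFunction T fun p : ℝ × Config M N => cone R z (p.1, p.2.2 l) :=
  (isConeFunction_cone hT z).comp_clm
    ((ContinuousLinearMap.proj l).comp (ContinuousLinearMap.snd ℝ (Fin M → Space) (Fin N → Space)))
    fun c => (norm_le_pi_norm c.2 l).trans (norm_snd_le c)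

/-- A cut-off that confines all `x`-particles to a light cone with base radius `L` and all
`y`-particles to a larger one. The latter is so large that it equals one within the range `δ` of the
former, whence the cut-off is compatible with the interaction. -/
noncomputable def cutoff (δ L : ℝ) (N : ℕ) (p : ℝ × Config M N) : ℝ :=
  (∏ k, cone L 0 (p.1, p.2.1 k)) * ∏ l, cone (L + δ + 1) 0 (p.1, p.2.2 l)

lemma cutoff_nonneg (δ L : ℝ) (p : ℝ × Config M N) : 0 ≤ cutoff δ L N p :=
  mul_nonneg (Finset.prod_nonneg fun _ _ => cone_nonneg _ _ _)
    (Finset.prod_nonneg fun _ _ => cone_nonneg _ _ _)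

lemma cutoff_le_one (δ L : ℝ) (p : ℝ × Config M N) : cutoff δ L N p ≤ 1 :=
  mul_le_one₀ (Finset.prod_le_one (fun _ _ => cone_nonneg _ _ _) fun _ _ => cone_le_one _ _ _)
    (Finset.prod_nonneg fun _ _ => cone_nonneg _ _ _)
    (Finset.prod_le_one (fun _ _ => cone_nonneg _ _ _) fun _ _ => cone_le_one _ _ _)

lemma isConeFunction_cutoff {δ L T : ℝ} (hδ : 0 ≤ δ) (hT : T ≤ L) :
    IsConeFunction T (cutoff δ L N : ℝ × Config M N → ℝ) :=
  (IsConeFunction.prod _ fun k => isConeFunction_cone_x hT 0 k).mul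
    (IsConeFunction.prod _ fun l => isConeFunction_cone_y (by linarith) 0 l)

lemma exists_compact_cutoff {δ L T : ℝ} (hδ : 0 ≤ δ) (hT : T ≤ L) (h0 : 0 ≤ T) :
    ∃ K : Set (Config M N), IsCompact K ∧
      ∀ τ ∈ Ioo (-1) (T + 1), ∀ q ∉ K, cutoff δ L N (τ, q) = 0 := by
  refine ⟨Metric.closedBall 0 (L + δ + 2), isCompact_closedBall _ _, fun τ hτ q hq => ?_⟩
  by_contra hne
  rw [← ne_eq, cutoff, mul_ne_zero_iff, Finset.prod_ne_zero_iff, Finset.prod_ne_zero_iff] at hne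
  refine hq (mem_closedBall_zero_iff.2 (norm_prod_le_iff.2 ⟨?_, ?_⟩))
  · refine (pi_norm_le_iff_of_nonneg (by linarith)).2 fun k => ?_
    have h1 := norm_lt_abs_of_cone_ne_zero (hne.1 k (Finset.mem_univ k))
    rw [sub_zero] at h1
    refine h1.le.trans (abs_le.2 ⟨by linarith [hτ.2], by linarith [hτ.1]⟩)
  · refine (pi_norm_le_iff_of_nonneg (by linarith)).2 fun l => ?_
    have h1 := norm_lt_abs_of_cone_ne_zero (hne.2 l (Finset.mem_univ l))
    rw [sub_zero] at h1
    refine h1.le.trans (abs_le.2 ⟨by linarith [hτ.2], by linarith [hτ.1]⟩)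

lemma cutoff_eventually_eq_one (δ τ : ℝ) (q : Config M N) (hδ : 0 ≤ δ) :
    ∀ᶠ n : ℕ in atTop, cutoff δ n N (τ, q) = 1 := by
  obtain ⟨n₀, hn₀⟩ := exists_nat_ge (‖q‖ + 1 + τ)
  filter_upwards [eventually_ge_atTop n₀] with n hn
  have hn' : (n₀ : ℝ) ≤ n := by exact_mod_cast hn
  rw [cutoff, Finset.prod_eq_one, Finset.prod_eq_one, one_mul]
  · intro l _
    apply cone_eq_one
    rw [sub_zero]
    have : ‖q.2 l‖ ≤ ‖q‖ := (norm_le_pi_norm q.2 l).trans (norm_snd_le q)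
    dsimp only
    linarith
  · intro k _
    apply cone_eq_one
    rw [sub_zero]
    have : ‖q.1 k‖ ≤ ‖q‖ := (norm_le_pi_norm q.1 k).trans (norm_fst_le q)
    dsimp only
    linarith

lemma IsCompatible.mul_cutoff {δ L τ : ℝ} {φ : Space → ℝ} {Ψ : Wave M} {v : ∀ N, Config M N → ℝ}
    (hv : IsCompatible δ φ Ψ v) (hv0 : ∀ N q, 0 ≤ v N q) (hτ : τ ≤ L) :
    IsCompatible δ φ Ψ fun N q => v N q * cutoff δ L N (τ, q) := by
  constructor
  · intro N k q y hy
    by_cases h0 : cutoff δ L N (τ, q) = 0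
    · rw [h0, mul_zero]
      exact mul_nonneg (hv0 _ _) (cutoff_nonneg _ _ _)
    · have h1 : cone L 0 (τ, q.1 k) ≠ 0 := by
        rw [← ne_eq, cutoff, mul_ne_zero_iff, Finset.prod_ne_zero_iff] at h0
        exact h0.1 k (Finset.mem_univ k)
      have h2 := norm_lt_of_cone_ne_zero hτ h1
      have h3 : cone (L + δ + 1) 0 (τ, y) = 1 := by
        apply cone_eq_one
        have : ‖y‖ ≤ ‖y - q.1 k‖ + ‖q.1 k‖ := by simpa using norm_add_le (y - q.1 k) (q.1 k)
        rw [sub_zero] at h2 ⊢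
        linarith
      have h4 : cutoff δ L (N + 1) (τ, (q.1, Fin.snoc (α := fun _ => Space) q.2 y)) =
          cutoff δ L N (τ, q) := by
        simp [cutoff, Fin.prod_univ_castSucc, h3]
      rw [h4]
      exact mul_le_mul_of_nonneg_right (hv.absorb N k q y hy) (cutoff_nonneg _ _ _)
  · intro N k q l r s hφ hΨ
    have h1 := hv.emit N k q l r s hφ hΨ
    have h2 : cutoff δ L (N + 1) (τ, q) ≤ cutoff δ L N (τ, (q.1, l.removeNth q.2)) := by
      simp only [cutoff, Fin.prod_univ_succAbove _ l]
      refine mul_le_mul_of_nonneg_left ?_ (Finset.prod_nonneg fun _ _ => cone_nonneg _ _ _)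
      exact mul_le_of_le_one_left (Finset.prod_nonneg fun _ _ => cone_nonneg _ _ _)
        (cone_le_one _ _ _)
    exact mul_le_mul h1 h2 (cutoff_nonneg _ _ _) (hv0 _ _)

/-! ### The energy inequality for general weights -/

section Limit

variable {σ mx my δ T : ℝ} {φ : Space → ℝ} {g : Fin 4 → Fin 4 → Fin 4 → ℂ} {Φ : ℝ → Wave M}

lemma localEnergy_mono {v w : ∀ N, ℝ × Config M N → ℝ} (h : ∀ N p, v N p ≤ w N p) (N : ℕ) (τ : ℝ) :
    localEnergy v Φ N τ ≤ localEnergy w Φ N τ :=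
  Finset.sum_le_sum fun r _ => Finset.sum_le_sum fun s _ => lintegral_mono fun q => by
    gcongr; exact h N _

/-- The energy inequality for weights that need not have compact support: the cut-offs are removed
with the help of Fatou's lemma. -/
theorem localEnergy_le {A : ℝ≥0∞} (hA : A ≠ ⊤) (hAb : IsInteractionBound M δ φ g A)
    (hφ : Continuous φ) (hδ : 0 ≤ δ) {v : ∀ N, ℝ × Config M N → ℝ}
    (hflow : IsFlow σ mx my δ φ g Φ) (hσ : |σ| ≤ 1) (hv : ∀ N, IsConeFunction T (v N))
    (hcomp : ∀ τ ∈ Icc 0 T, IsCompatible δ φ (Φ τ) fun N q => v N (τ, q))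
    (N : ℕ) (s τ : ℝ) (hs : 0 ≤ s) (hsτ : s ≤ τ) (hτ : τ ≤ T) :
    localEnergy v Φ N τ ≤ localEnergy v Φ N s +
      ENNReal.ofReal ((A.toReal + 1) * √((N : ℝ) + 1)) *
        ∫⁻ r in Icc s τ, neighbours (localEnergy v Φ) N r := by
  have hT0 : 0 ≤ T := hs.trans (hsτ.trans hτ)
  let w : ℕ → ∀ N, ℝ × Config M N → ℝ := fun n N p => v N p * cutoff δ n N p
  have hwv : ∀ n N p, w n N p ≤ v N p := fun n N p =>
    mul_le_of_le_one_right ((hv N).nonneg p) (cutoff_le_one _ _ _)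
  have hle : ∀ᶠ n : ℕ in atTop, localEnergy (w n) Φ N τ ≤ localEnergy v Φ N s +
      ENNReal.ofReal ((A.toReal + 1) * √((N : ℝ) + 1)) *
        ∫⁻ r in Icc s τ, neighbours (localEnergy v Φ) N r := by
    obtain ⟨n₀, hn₀⟩ := exists_nat_ge T
    filter_upwards [eventually_ge_atTop n₀] with n hn
    have hnT : T ≤ n := hn₀.trans (by exact_mod_cast hn)
    have hmono := fun m r => localEnergy_mono (Φ := Φ) (hwv n) m r
    refine (localEnergy_le_of_compact hA hAb hφ hflow hσ
      (fun N => (hv N).mul (isConeFunction_cutoff hδ hnT)) (fun N => ?_) (fun t ht => ?_)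
      N hs hsτ hτ).trans ?_
    · obtain ⟨K, hK, h0⟩ := exists_compact_cutoff (M := M) (N := N) hδ hnT hT0
      exact ⟨K, hK, fun t ht q hq => by rw [h0 t ht q hq, mul_zero]⟩
    · exact (hcomp t ht).mul_cutoff (fun N q => (hv N).nonneg _) (ht.2.trans hnT)
    · unfold neighbours
      gcongr
      exacts [hmono N s, hmono _ _, hmono _ _, hmono _ _]
  have hmeas : ∀ (u : Config M N → ℝ), Continuous u → Measurable fun q =>
      ENNReal.ofReal (u q * density (Φ τ) N q) := fun u hu => by
    refine ENNReal.measurable_ofReal.comp (hu.measurable.mul ?_)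
    exact ((hflow.smooth.contDiff_density N).continuous.comp
      (Continuous.prodMk_right τ)).measurable
  have hvc : Continuous fun q => v N (τ, q) :=
    (hv N).contDiff.continuous.comp (Continuous.prodMk_right τ)
  have hcc : ∀ n : ℕ, Continuous fun q : Config M N => cutoff δ n N (τ, q) := fun n => by
    unfold cutoff cone
    have := Real.smoothTransition.continuous
    fun_prop
  have hΦm : ∀ r s, Measurable (Φ τ N r s) := fun r s =>
    (hflow.smooth.continuous_slice τ N r s).measurable
  have hfatou : localEnergy v Φ N τ ≤ liminf (fun n => localEnergy (w n) Φ N τ) atTop := by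
    have h1 : ∀ n, localEnergy (w n) Φ N τ =
        ∫⁻ q, ENNReal.ofReal (w n N (τ, q) * density (Φ τ) N q) := fun n =>
      weightedNormSq_eq_lintegral (hvc.mul (hcc n)).measurable
        (fun q => mul_nonneg ((hv N).nonneg _) (cutoff_nonneg _ _ _)) hΦm
    rw [localEnergy, weightedNormSq_eq_lintegral hvc.measurable (fun q => (hv N).nonneg _) hΦm]
    simp only [h1]
    refine le_trans (lintegral_mono fun q => ?_)
      (lintegral_liminf_le fun n => hmeas _ (hvc.mul (hcc n)))
    refine le_of_eq (Tendsto.liminf_eq ?_).symm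
    refine tendsto_const_nhds.congr' ?_
    filter_upwards [cutoff_eventually_eq_one δ τ q hδ] with n hn
    simp only [w, hn, mul_one]
  exact hfatou.trans (liminf_le_of_frequently_le' hle.frequently)

end Limit

/-! ### Solutions that vanish under a cone weight -/

section Solutions

variable {mx my δ : ℝ} {φ : Space → ℝ} {g : Fin 4 → Fin 4 → Fin 4 → ℂ} {Ψ : ℝ → Wave M}

lemma IsStrongSolution.isFlow (h : IsStrongSolution mx my δ φ g Ψ) (σ t₀ : ℝ) :
    IsFlow σ mx my δ φ g fun τ => Ψ (t₀ + σ * τ) := by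
  constructor
  · intro N r s
    exact (h.smooth N r s).comp
      ((contDiff_const.add (contDiff_const.mul contDiff_fst)).prodMk contDiff_snd)
  · intro t N r s q
    have h1 : HasDerivAt (fun τ : ℝ => t₀ + σ * τ) σ t := by
      simpa using ((hasDerivAt_id t).const_mul σ).const_add t₀
    have h2 := (h.smooth.hasDerivAt (t₀ + σ * t) N r s q).scomp t h1
    have h3 : deriv (fun τ => Ψ (t₀ + σ * τ) N r s q) t =
        σ • deriv (fun τ => Ψ τ N r s q) (t₀ + σ * t) := h2.deriv
    rw [h3, ← h.equation, Complex.real_smul]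
    ring

lemma sectorNormSq_eq_weightedNormSq (Ψ : Wave M) (N : ℕ) :
    sectorNormSq Ψ N = weightedNormSq (fun _ : Config M N => 1) Ψ := by
  simp [sectorNormSq, weightedNormSq]

lemma lowerSemicontinuous_sectorNormSq (hΨ : SmoothTimeWave Ψ) (N : ℕ) :
    LowerSemicontinuous fun t => sectorNormSq (Ψ t) N := by
  have h1 : ∀ t, sectorNormSq (Ψ t) N = ∫⁻ q, ENNReal.ofReal (density (Ψ t) N q) := fun t => by
    rw [sectorNormSq_eq_weightedNormSq, weightedNormSq_eq_lintegral measurable_const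
      (fun _ => zero_le_one) fun r s => (hΨ.continuous_slice t N r s).measurable]
    simp
  have hc := (hΨ.contDiff_density N).continuous
  rw [lowerSemicontinuous_iff_isClosed_preimage]
  refine fun c => IsSeqClosed.isClosed fun u t hu hut => ?_
  simp only [mem_preimage, mem_Iic, h1] at hu ⊢
  calc ∫⁻ q, ENNReal.ofReal (density (Ψ t) N q)
      = ∫⁻ q, liminf (fun n => ENNReal.ofReal (density (Ψ (u n)) N q)) atTop := by
        refine lintegral_congr fun q => (Tendsto.liminf_eq ?_).symm
        refine ENNReal.tendsto_ofReal ?_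
        exact (hc.comp (Continuous.prodMk_left q)).continuousAt.tendsto.comp hut
    _ ≤ liminf (fun n => ∫⁻ q, ENNReal.ofReal (density (Ψ (u n)) N q)) atTop :=
        lintegral_liminf_le fun n => ENNReal.measurable_ofReal.comp
          (hc.comp (Continuous.prodMk_right (u n))).measurable
    _ ≤ c := liminf_le_of_frequently_le' (Frequently.of_forall hu)

/-- The norms of the sectors of a solution are bounded by a multiple of `exp √(N + 1)`, uniformly on
bounded time intervals. -/
lemma IsStrongSolution.exists_sector_bound (h : IsStrongSolution mx my δ φ g Ψ) (hδ : 0 ≤ δ)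
    (hφ : Continuous φ) {A : ℝ≥0∞} (hA : A ≠ ⊤) (hAb : IsInteractionBound M δ φ g A) (T : ℝ) :
    ∃ K : ℝ, 0 ≤ K ∧ ∀ t ∈ Icc (-T) T, ∀ N : ℕ,
      sectorNormSq (Ψ t) N ≤ ENNReal.ofReal (K * Real.exp √((N : ℝ) + 1)) := by
  refine exists_uniform_ladder_bound (E := fun N t => sectorNormSq (Ψ t) N) (C := A.toReal + 1)
    (by positivity) (lowerSemicontinuous_sectorNormSq h.smooth) (fun t => ?_) ?_ T
  · refine ⟨(normSq (Ψ t)).toReal, ENNReal.toReal_nonneg, fun N => ?_⟩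
    rw [ENNReal.ofReal_toReal (h.norm_finite t).ne]
    exact ENNReal.le_tsum N
  · intro σ hσ N s τ hτ
    have hσ' : |σ| ≤ 1 := by rcases hσ with rfl | rfl <;> simp
    have := localEnergy_le (T := τ) (v := fun N _ => 1) hA hAb hφ hδ (h.isFlow σ s) hσ'
      (fun N => IsConeFunction.const zero_le_one)
      (fun t _ => ⟨fun _ _ _ _ _ => le_rfl, fun _ _ _ _ _ _ _ _ => le_rfl⟩) N 0 τ le_rfl hτ le_rfl
    simpa [localEnergy, neighbours, ← sectorNormSq_eq_weightedNormSq] using this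

lemma eq_zero_of_weightedNormSq_eq_zero {Ψ : Wave M} {w : Config M N → ℝ} (hw : Continuous w)
    (hw0 : ∀ q, 0 ≤ w q) (hΨ : ∀ r s, Continuous (Ψ N r s)) (h : weightedNormSq w Ψ = 0)
    {q : Config M N} (hq : 0 < w q) (r : Fin M → Fin 4) (s : Fin N → Fin 4) : Ψ N r s q = 0 := by
  have hc : Continuous fun q => w q * density Ψ N q := by
    unfold density
    fun_prop
  have hm : Measurable fun q => ENNReal.ofReal (w q * density Ψ N q) :=
    ENNReal.measurable_ofReal.comp hc.measurable
  rw [weightedNormSq_eq_lintegral hw.measurable hw0 fun r s => (hΨ r s).measurable,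
    lintegral_eq_zero_iff hm] at h
  have h1 : (fun q => w q * density Ψ N q) =ᵐ[volume] fun _ => 0 := by
    filter_upwards [h] with q hq
    exact le_antisymm (ENNReal.ofReal_eq_zero.1 hq) (mul_nonneg (hw0 q) (density_nonneg _ _))
  have h2 := congrFun ((hc.ae_eq_iff_eq volume continuous_const).1 h1) q
  have h3 : density Ψ N q = 0 := (mul_eq_zero.1 h2).resolve_left hq.ne'
  unfold density at h3
  rw [Finset.sum_eq_zero_iff_of_nonneg fun _ _ => by positivity] at h3
  have h4 := h3 r (Finset.mem_univ r)
  rw [Finset.sum_eq_zero_iff_of_nonneg fun _ _ => by positivity] at h4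
  simpa using h4 s (Finset.mem_univ s)

/-- A solution that initially vanishes on the support of a compatible cone weight vanishes on it at
later times. -/
lemma IsStrongSolution.eq_zero_of_weight (h : IsStrongSolution mx my δ φ g Ψ) (hδ : 0 ≤ δ)
    (hφ : Continuous φ) {A : ℝ≥0∞} (hA : A ≠ ⊤) (hAb : IsInteractionBound M δ φ g A) {σ T : ℝ}
    (hσ : σ = 1 ∨ σ = -1) (hT : 0 ≤ T) {v : ∀ N, ℝ × Config M N → ℝ}
    (hv : ∀ N, IsConeFunction T (v N)) (hvN : ∀ N p, v N p ≤ N + 1)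
    (hcomp : ∀ τ ∈ Icc 0 T, IsCompatible δ φ (Ψ (σ * τ)) fun N q => v N (τ, q))
    (hzero : ∀ N r s q, v N (0, q) ≠ 0 → Ψ 0 N r s q = 0)
    {q : Config M N} (hq : 0 < v N (T, q)) (r : Fin M → Fin 4) (s : Fin N → Fin 4) :
    Ψ (σ * T) N r s q = 0 := by
  have hflow := h.isFlow σ 0
  simp only [zero_add] at hflow
  have hσ' : |σ| ≤ 1 := by rcases hσ with rfl | rfl <;> simp
  obtain ⟨K, hK, hKb⟩ := h.exists_sector_bound hδ hφ hA hAb T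
  have hall := ladder_eq_zero (a := localEnergy v fun τ => Ψ (σ * τ)) (C := A.toReal + 1) (c := 3)
    (T := T) (K := K) (by positivity) (by norm_num) hK ?_
    (localEnergy_le hA hAb hφ hδ hflow hσ' hv hcomp) ?_ N T ⟨hT, le_rfl⟩
  · refine eq_zero_of_weightedNormSq_eq_zero (w := fun q => v N (T, q))
      ((hv N).contDiff.continuous.comp (Continuous.prodMk_right T)) (fun q => (hv N).nonneg _)
      (fun r s => hflow.smooth.continuous_slice T N r s) hall hq r s
  · intro N
    refine Finset.sum_eq_zero fun r _ => Finset.sum_eq_zero fun s _ => ?_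
    rw [lintegral_eq_zero_of_ae_eq_zero]
    refine ae_of_all _ fun q => ?_
    by_cases h0 : v N (0, q) = 0
    · simp [h0]
    · simp [hzero N r s q h0]
  · -- the a priori bound: the factor `N + 1`, by which the weight may exceed one, is absorbed into
    -- the exponential
    intro N τ hτ
    set x := √((N : ℝ) + 1) with hx
    have hx2 : (N : ℝ) + 1 = x * x := (Real.mul_self_sqrt (by positivity)).symm
    have hx0 : 0 ≤ x := Real.sqrt_nonneg _
    have hmem : σ * τ ∈ Icc (-T) T := by
      rcases hσ with rfl | rfl
      · constructor <;> linarith [hτ.1, hτ.2]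
      · constructor <;> linarith [hτ.1, hτ.2]
    calc localEnergy v (fun τ => Ψ (σ * τ)) N τ
        ≤ ENNReal.ofReal (N + 1) * sectorNormSq (Ψ (σ * τ)) N := by
          rw [localEnergy, weightedNormSq, sectorNormSq, Finset.mul_sum]
          refine Finset.sum_le_sum fun r _ => ?_
          rw [Finset.mul_sum]
          refine Finset.sum_le_sum fun s _ => ?_
          rw [← lintegral_const_mul' _ _ ENNReal.ofReal_ne_top]
          refine lintegral_mono fun q => ?_
          gcongr
          exact hvN _ _
      _ ≤ ENNReal.ofReal (N + 1) * ENNReal.ofReal (K * Real.exp x) := by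
          gcongr
          exact hKb _ hmem N
      _ = ENNReal.ofReal (x * x * (K * Real.exp x)) := by
          rw [← ENNReal.ofReal_mul (by positivity), hx2]
      _ ≤ ENNReal.ofReal (K * Real.exp (3 * x)) := by
          apply ENNReal.ofReal_le_ofReal
          have h1 : x ≤ Real.exp x := by linarith [Real.add_one_le_exp x]
          have h2 : Real.exp (3 * x) = Real.exp x * Real.exp x * Real.exp x := by
            rw [← Real.exp_add, ← Real.exp_add]; ring_nf
          rw [h2]
          calc x * x * (K * Real.exp x) ≤ Real.exp x * Real.exp x * (K * Real.exp x) := by gcongr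
            _ = _ := by ring

end Solutions

/-! ### Supports -/

section Supports

lemma mem_essSupport_of_ne_zero {Ψ : Wave M} (hΨ : ∀ N r s, Continuous (Ψ N r s))
    {r : Fin M → Fin 4} {s : Fin N → Fin 4} {q : Config M N} (h : Ψ N r s q ≠ 0) :
    (⟨N, q⟩ : ConfigSpace M) ∈ essSupport Ψ := by
  rintro G ⟨hG, hae⟩
  by_contra hq
  have hopen : IsOpen ({q : Config M N | (⟨N, q⟩ : ConfigSpace M) ∉ G} ∩ {q | Ψ N r s q ≠ 0}) :=
    (hG.isOpen_compl.preimage continuous_sigmaMk).inter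
      (isOpen_ne_fun (hΨ N r s) continuous_const)
  have hpos := hopen.measure_pos volume ⟨q, hq, h⟩
  refine hpos.ne' (measure_mono_null ?_ (hae N))
  rintro q' ⟨h1, h2⟩ h3
  exact h2 (h3 h1 r s)

lemma supp3x_subset {Ψ : Wave M} {F : Set Space} (hF : IsClosed F)
    (h : ∀ N r s (q : Config M N) k, Ψ N r s q ≠ 0 → q.1 k ∈ F) : supp3x Ψ ⊆ F := by
  refine closure_minimal ?_ hF
  rintro x ⟨q, hq, k, rfl⟩
  have hS : IsClosed {p : ConfigSpace M | ∀ k, p.2.1 k ∈ F} := by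
    rw [isClosed_sigma_iff]
    intro N
    have : (Sigma.mk N ⁻¹' {p : ConfigSpace M | ∀ k, p.2.1 k ∈ F}) =
        {p : Config M N | ∀ k, p.1 k ∈ F} := rfl
    rw [this, ofPred_forall]
    exact isClosed_iInter fun k => hF.preimage ((continuous_apply k).comp continuous_fst)
  refine hq _ ⟨hS, fun N => ae_of_all _ fun p hp r s => ?_⟩ k
  by_contra hne
  exact hp fun k => h N r s p k hne

lemma supp3y_subset {Ψ : Wave M} {F : Set Space} (hF : IsClosed F)
    (h : ∀ N r s (q : Config M N) l, Ψ N r s q ≠ 0 → q.2 l ∈ F) : supp3y Ψ ⊆ F := by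
  refine closure_minimal ?_ hF
  rintro x ⟨q, hq, l, rfl⟩
  have hS : IsClosed {p : ConfigSpace M | ∀ l : Fin p.1, p.2.2 l ∈ F} := by
    rw [isClosed_sigma_iff]
    intro N
    have : (Sigma.mk N ⁻¹' {p : ConfigSpace M | ∀ l : Fin p.1, p.2.2 l ∈ F}) =
        {p : Config M N | ∀ l, p.2 l ∈ F} := rfl
    rw [this, ofPred_forall]
    exact isClosed_iInter fun l => hF.preimage ((continuous_apply l).comp continuous_snd)
  refine hq _ ⟨hS, fun N => ae_of_all _ fun p hp r s => ?_⟩ l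
  by_contra hne
  exact hp fun l => h N r s p l hne

lemma grown_eq_cthickening {G : Set Space} (hG : IsClosed G) {τ : ℝ} (hτ : 0 ≤ τ) :
    grown G τ = Metric.cthickening τ G := by
  rw [hG.cthickening_eq_biUnion_closedBall hτ]
  ext z
  simp [grown, dist_eq_norm, norm_sub_rev]

lemma isClosed_grown {G : Set Space} (hG : IsClosed G) {τ : ℝ} (hτ : 0 ≤ τ) :
    IsClosed (grown G τ) := by
  rw [grown_eq_cthickening hG hτ]
  exact Metric.isClosed_cthickening

lemma exists_lt_le_norm_of_notMem_grown {G : Set Space} (hG : IsClosed G) {τ : ℝ} (hτ : 0 ≤ τ)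
    {z : Space} (hz : z ∉ grown G τ) : ∃ R, τ < R ∧ ∀ x ∈ G, R ≤ ‖x - z‖ := by
  rw [grown_eq_cthickening hG hτ, Metric.mem_cthickening_iff, not_le] at hz
  obtain ⟨R, hR0, hτR, hRz⟩ := ENNReal.lt_iff_exists_real_btwn.1 hz
  refine ⟨R, ?_, fun x hx => ?_⟩
  · by_contra! hle
    exact absurd hτR (not_lt.2 (ENNReal.ofReal_le_ofReal hle))
  · have h1 := hRz.le.trans (Metric.infEDist_le_edist_of_mem hx)
    rw [edist_dist, ENNReal.ofReal_le_ofReal_iff dist_nonneg, dist_comm, dist_eq_norm] at h1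
    exact h1

end Supports

/-! ### Finite propagation speed -/

section Propagation

variable {mx my δ : ℝ} {φ : Space → ℝ} {g : Fin 4 → Fin 4 → Fin 4 → ℂ} {Ψ : ℝ → Wave M}

lemma exists_sign_mul_abs (t : ℝ) : ∃ σ : ℝ, (σ = 1 ∨ σ = -1) ∧ t = σ * |t| := by
  rcases abs_choice t with h | h
  · exact ⟨1, Or.inl rfl, by rw [one_mul, h]⟩
  · exact ⟨-1, Or.inr rfl, by rw [h]; ring⟩

/-- No `x`-particle leaves the light cone of the initial support of the `x`-particles. The weight is
the backward cone in one position `x_k`; it does not depend on the `y`-particles and is thus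
compatible with the interaction. -/
theorem IsStrongSolution.x_mem_grown (h : IsStrongSolution mx my δ φ g Ψ) (hδ : 0 ≤ δ)
    (hφ : Continuous φ) (hφc : HasCompactSupport φ) {t : ℝ} {r : Fin M → Fin 4} {s : Fin N → Fin 4}
    {q : Config M N} (hne : Ψ t N r s q ≠ 0) (k : Fin M) :
    q.1 k ∈ grown (supp3x (Ψ 0)) |t| := by
  obtain ⟨A, hA, hAb⟩ := exists_interaction_bound M δ hφ hφc g
  obtain ⟨σ, hσ, ht⟩ := exists_sign_mul_abs t
  by_contra hz
  obtain ⟨R, hR, hdist⟩ := exists_lt_le_norm_of_notMem_grown isClosed_closure (abs_nonneg t) hz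
  rw [ht] at hne
  refine hne (h.eq_zero_of_weight hδ hφ hA hAb hσ (abs_nonneg t)
    (v := fun N p => cone R (q.1 k) (p.1, p.2.1 k))
    (fun N => isConeFunction_cone_x hR.le _ k) (fun N p => ?_) (fun τ _ => ?_)
    (fun N r s p hp => ?_) (cone_center_pos _ hR) r s)
  · exact (cone_le_one _ _ _).trans (by linarith [(Nat.cast_nonneg N : (0 : ℝ) ≤ N)])
  · exact ⟨fun _ _ _ _ _ => le_rfl, fun _ _ _ _ _ _ _ _ => le_rfl⟩
  · by_contra h0
    have h1 := norm_lt_of_cone_ne_zero ((abs_nonneg t).trans hR.le) hp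
    have h2 : p.1 k ∈ supp3x (Ψ 0) := subset_closure
      ⟨⟨N, p⟩, mem_essSupport_of_ne_zero (h.smooth.continuous_slice 0) h0, k, rfl⟩
    linarith [hdist _ h2]

/-- The `y`-particles stay in the light cones of the initial `y`-particles and of the places where
they can be created. The weight counts the `y`-particles inside a backward cone; the emission cannot
increase it, since the `x`-particles are too far away by `IsStrongSolution.x_mem_grown`. -/
theorem IsStrongSolution.y_mem_grown (h : IsStrongSolution mx my δ φ g Ψ) (hδ : 0 ≤ δ)
    (hφ : Continuous φ) (hφc : HasCompactSupport φ) (hφδ : tsupport φ ⊆ Metric.ball 0 δ) {t : ℝ}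
    {r : Fin M → Fin 4} {s : Fin N → Fin 4} {q : Config M N} (hne : Ψ t N r s q ≠ 0) (l : Fin N) :
    q.2 l ∈ grown (supp3y (Ψ 0)) |t| ∪ grown (supp3x (Ψ 0)) (|t| + δ) := by
  obtain ⟨A, hA, hAb⟩ := exists_interaction_bound M δ hφ hφc g
  obtain ⟨σ, hσ, ht⟩ := exists_sign_mul_abs t
  have hσ' : |σ| = 1 := by rcases hσ with rfl | rfl <;> simp
  by_contra hz
  rw [mem_union, not_or] at hz
  obtain ⟨R₁, hR₁, hdist₁⟩ :=
    exists_lt_le_norm_of_notMem_grown isClosed_closure (abs_nonneg t) hz.1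
  obtain ⟨R₂, hR₂, hdist₂⟩ :=
    exists_lt_le_norm_of_notMem_grown isClosed_closure (by positivity) hz.2
  -- a cone of this radius contains no initial `y`-particle and keeps the distance `δ` from all
  -- places that the `x`-particles can reach
  set R := min R₁ (R₂ - δ) with hRdef
  have hR : |t| < R := lt_min hR₁ (by linarith)
  rw [ht] at hne
  refine hne (h.eq_zero_of_weight hδ hφ hA hAb hσ (abs_nonneg t)
    (v := fun N p => ∑ j, cone R (q.2 l) (p.1, p.2.2 j))
    (fun N => IsConeFunction.sum _ fun j => isConeFunction_cone_y hR.le _ j)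
    (fun N p => ?_) (fun τ hτ => ⟨?_, ?_⟩) (fun N r s p hp => ?_) ?_ r s)
  · calc ∑ j, cone R (q.2 l) (p.1, p.2.2 j) ≤ ∑ _j : Fin N, (1 : ℝ) :=
          Finset.sum_le_sum fun j _ => cone_le_one _ _ _
      _ ≤ N + 1 := by simp
  · intro N k p y _
    simp only [Fin.sum_univ_castSucc, Fin.snoc_castSucc, Fin.snoc_last]
    exact le_add_of_nonneg_right (cone_nonneg _ _ _)
  · intro N k p j r' s' hφne hΨne
    simp only [Fin.sum_univ_succAbove _ j]
    have h0 : cone R (q.2 l) (τ, p.2 j) = 0 := by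
      by_contra hc
      have h1 := norm_lt_of_cone_ne_zero (hτ.2.trans hR.le) hc
      obtain ⟨x, hx, hxk⟩ := h.x_mem_grown hδ hφ hφc hΨne k
      have h2 : ‖p.2 j - p.1 k‖ < δ := by
        simpa using hφδ (subset_tsupport φ hφne)
      rw [abs_mul, hσ', one_mul, abs_of_nonneg hτ.1] at hxk
      have h3 := hdist₂ x hx
      have h4 : ‖x - q.2 l‖ ≤ ‖x - p.1 k‖ + ‖p.2 j - p.1 k‖ + ‖p.2 j - q.2 l‖ := by
        have e : x - q.2 l = (x - p.1 k) - (p.2 j - p.1 k) + (p.2 j - q.2 l) := by abel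
        rw [e]
        exact (norm_add_le _ _).trans (by gcongr; exact norm_sub_le _ _)
      dsimp only at hxk
      linarith [min_le_right R₁ (R₂ - δ)]
    rw [h0, zero_add]
    rfl
  · obtain ⟨j, -, hj⟩ := Finset.exists_ne_zero_of_sum_ne_zero hp
    by_contra h0
    have h1 := norm_lt_of_cone_ne_zero ((abs_nonneg t).trans hR.le) hj
    have h2 : p.2 j ∈ supp3y (Ψ 0) := subset_closure
      ⟨⟨N, p⟩, mem_essSupport_of_ne_zero (h.smooth.continuous_slice 0) h0, j, rfl⟩
    linarith [hdist₁ _ h2, min_le_left R₁ (R₂ - δ)]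
  · exact (cone_center_pos _ hR).trans_le
      (Finset.single_le_sum (f := fun j => cone R (q.2 l) (|t|, q.2 j))
        (fun j _ => cone_nonneg _ _ _) (Finset.mem_univ l))

end Propagation

/-! ### Uniqueness -/

section Linearity

variable {mx my δ : ℝ} {φ : Space → ℝ} {g : Fin 4 → Fin 4 → Fin 4 → ℂ}

lemma SmoothWave.fderiv_sub_apply {Ψ Ψ' : Wave M} (h : SmoothWave Ψ) (h' : SmoothWave Ψ')
    {r : Fin M → Fin 4} {s : Fin N → Fin 4} (q v : Config M N) :
    fderiv ℝ ((Ψ - Ψ') N r s) q v = fderiv ℝ (Ψ N r s) q v - fderiv ℝ (Ψ' N r s) q v := by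
  rw [Pi.sub_apply, Pi.sub_apply, Pi.sub_apply, fderiv_sub
    ((h N r s).differentiable (by simp) q) ((h' N r s).differentiable (by simp) q)]
  rfl

lemma freeX_sub (m : ℝ) (k : Fin M) {Ψ Ψ' : Wave M} (h : SmoothWave Ψ) (h' : SmoothWave Ψ') :
    freeX m k (Ψ - Ψ') = freeX m k Ψ - freeX m k Ψ' := by
  funext N r s q
  have hd := fun r s v => SmoothWave.fderiv_sub_apply h h' (N := N) (r := r) (s := s) q v
  simp only [freeX, Pi.sub_apply] at hd ⊢
  simp only [hd, mul_sub, Finset.sum_sub_distrib]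
  ring

lemma freeY_sub (m : ℝ) {Ψ Ψ' : Wave M} (h : SmoothWave Ψ) (h' : SmoothWave Ψ') :
    freeY m (Ψ - Ψ') = freeY m Ψ - freeY m Ψ' := by
  funext N r s q
  have hd := fun r s v => SmoothWave.fderiv_sub_apply h h' (N := N) (r := r) (s := s) q v
  simp only [freeY, Pi.sub_apply] at hd ⊢
  rw [← Finset.sum_sub_distrib]
  refine Finset.sum_congr rfl fun l _ => ?_
  simp only [hd, mul_sub, Finset.sum_sub_distrib]
  ring

lemma absorb_sub (hφ : Continuous φ) (k : Fin M) {Ψ Ψ' : Wave M} (h : SmoothWave Ψ)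
    (h' : SmoothWave Ψ') : absorb δ φ g k (Ψ - Ψ') = absorb δ φ g k Ψ - absorb δ φ g k Ψ' := by
  funext N r s q
  have hint : ∀ {f : Config M (N + 1) → ℂ}, Continuous f → IntegrableOn
      (fun y => (φ (y - q.1 k) : ℂ) * f (q.1, Fin.snoc (α := fun _ => Space) q.2 y))
      (Metric.ball (q.1 k) δ) := by
    intro f hf
    have hc : Continuous fun y : Space =>
        (φ (y - q.1 k) : ℂ) * f (q.1, Fin.snoc (α := fun _ => Space) q.2 y) := by
      have : Continuous fun y : Space => (Fin.snoc (α := fun _ => Space) q.2 y) :=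
        continuous_const.finSnoc continuous_id
      fun_prop
    exact (hc.continuousOn.integrableOn_compact (isCompact_closedBall _ _)).mono_set
      Metric.ball_subset_closedBall
  simp only [absorb, Pi.sub_apply, mul_sub]
  rw [← mul_sub, ← Finset.sum_sub_distrib]
  congr 1
  refine Finset.sum_congr rfl fun r' _ => ?_
  rw [← Finset.sum_sub_distrib]
  refine Finset.sum_congr rfl fun s' _ => ?_
  rw [integral_sub (hint (h _ _ _).continuous) (hint (h' _ _ _).continuous), mul_sub]

lemma emit_sub (k : Fin M) (Ψ Ψ' : Wave M) :
    emit φ g k (Ψ - Ψ') = emit φ g k Ψ - emit φ g k Ψ' := by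
  funext N r s q
  cases N with
  | zero => simp [emit]
  | succ N => simp only [emit, Pi.sub_apply, mul_sub, Finset.sum_sub_distrib]

lemma hamiltonian_sub (hφ : Continuous φ) {Ψ Ψ' : Wave M} (h : SmoothWave Ψ)
    (h' : SmoothWave Ψ') : hamiltonian mx my δ φ g (Ψ - Ψ') =
      hamiltonian mx my δ φ g Ψ - hamiltonian mx my δ φ g Ψ' := by
  funext N r s q
  simp only [hamiltonian, freeX_sub _ _ h h', freeY_sub _ h h', absorb_sub hφ _ h h', emit_sub,
    Pi.sub_apply, Finset.sum_sub_distrib]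
  ring

lemma sectorNormSq_sub_le {Ψ Ψ' : Wave M} (h : SmoothWave Ψ) (N : ℕ) :
    sectorNormSq (Ψ - Ψ') N ≤ 2 * (sectorNormSq Ψ N + sectorNormSq Ψ' N) := by
  unfold sectorNormSq
  simp only [← Finset.sum_add_distrib, Finset.mul_sum]
  refine Finset.sum_le_sum fun r _ => Finset.sum_le_sum fun s _ => ?_
  have hm : Measurable fun q => ‖Ψ N r s q‖ₑ ^ 2 :=
    (h N r s).continuous.measurable.enorm.pow_const 2
  rw [← lintegral_add_left hm, ← lintegral_const_mul' _ _ (by simp)]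
  refine lintegral_mono fun q => ?_
  calc ‖Ψ N r s q - Ψ' N r s q‖ₑ ^ 2 ≤ (‖Ψ N r s q‖ₑ + ‖Ψ' N r s q‖ₑ) ^ 2 := by
        gcongr
        exact enorm_sub_le
    _ ≤ 2 * (‖Ψ N r s q‖ₑ ^ 2 + ‖Ψ' N r s q‖ₑ ^ 2) := by
        simp only [enorm_eq_nnnorm]
        exact_mod_cast add_sq_le (a := ‖Ψ N r s q‖₊) (b := ‖Ψ' N r s q‖₊)

lemma SmoothTimeWave.smoothWave {Ψ : ℝ → Wave M} (h : SmoothTimeWave Ψ) (t : ℝ) :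
    SmoothWave (Ψ t) := fun N r s => h.contDiff_slice t N r s

lemma IsStrongSolution.sub (hφ : Continuous φ) {Ψ Ψ' : ℝ → Wave M}
    (h : IsStrongSolution mx my δ φ g Ψ) (h' : IsStrongSolution mx my δ φ g Ψ') :
    IsStrongSolution mx my δ φ g (Ψ - Ψ') where
  smooth N r s := (h.smooth N r s).sub (h'.smooth N r s)
  equation t N r s q := by
    have hd : deriv (fun τ => (Ψ - Ψ') τ N r s q) t =
        deriv (fun τ => Ψ τ N r s q) t - deriv (fun τ => Ψ' τ N r s q) t :=
      ((h.smooth.hasDerivAt t N r s q).sub (h'.smooth.hasDerivAt t N r s q)).deriv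
    rw [hd, mul_sub, h.equation, h'.equation, Pi.sub_apply,
      hamiltonian_sub hφ (h.smooth.smoothWave t) (h'.smooth.smoothWave t)]
    rfl
  norm_finite t := by
    refine (ENNReal.tsum_le_tsum fun N =>
      sectorNormSq_sub_le (Ψ' := Ψ' t) (h.smooth.smoothWave t) N).trans_lt ?_
    rw [ENNReal.tsum_mul_left, ENNReal.tsum_add]
    exact ENNReal.mul_lt_top (by simp) (ENNReal.add_lt_top.2 ⟨h.norm_finite t, h'.norm_finite t⟩)
  number_norm_finite t := by
    have hle : ∀ N : ℕ, (N : ℝ≥0∞) * sectorNormSq ((Ψ - Ψ') t) N ≤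
        2 * (N * sectorNormSq (Ψ t) N + N * sectorNormSq (Ψ' t) N) := fun N => by
      rw [← mul_add, mul_left_comm]
      gcongr
      exact sectorNormSq_sub_le (h.smooth.smoothWave t) N
    refine (ENNReal.tsum_le_tsum hle).trans_lt ?_
    rw [ENNReal.tsum_mul_left, ENNReal.tsum_add]
    exact ENNReal.mul_lt_top (by simp)
      (ENNReal.add_lt_top.2 ⟨h.number_norm_finite t, h'.number_norm_finite t⟩)

/-- Solutions are determined by their initial data: the difference of two solutions with the same
data has empty initial support, so that no `x`-particle can be anywhere. The existence of at least
one `x`-particle matters. -/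
theorem IsStrongSolution.eq_of_initial_eq (hM : 0 < M) (hδ : 0 ≤ δ) (hφ : Continuous φ)
    (hφc : HasCompactSupport φ) {Ψ Ψ' : ℝ → Wave M} (h : IsStrongSolution mx my δ φ g Ψ)
    (h' : IsStrongSolution mx my δ φ g Ψ') (h0 : Ψ 0 = Ψ' 0) : Ψ = Ψ' := by
  have hempty : supp3x ((Ψ - Ψ') 0) ⊆ ∅ := supp3x_subset isClosed_empty fun N r s q k hne =>
    hne (by simp [h0])
  funext t N r s q
  by_contra hne
  obtain ⟨x, hx, -⟩ := (h.sub hφ h').x_mem_grown hδ hφ hφc (t := t) (r := r) (s := s) (q := q)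
    (sub_ne_zero.2 hne) ⟨0, hM⟩
  exact hempty hx

end Linearity

end DiracFock

theorem mainTheorem6 (M : ℕ) (hM : 0 < M) (mx my δ : ℝ) (hmx : 0 < mx) (hmy : 0 < my)
    (hδ : 0 < δ) (φ : DiracFock.Space → ℝ) (hφ : ContDiff ℝ ∞ φ) (hφc : HasCompactSupport φ)
    (hφδ : tsupport φ ⊆ Metric.ball 0 δ) (g : Fin 4 → Fin 4 → Fin 4 → ℂ) :
    (∀ Ψ : ℝ → DiracFock.Wave M, DiracFock.IsStrongSolution mx my δ φ g Ψ → ∀ t : ℝ,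
      DiracFock.supp3x (Ψ t) ⊆ DiracFock.grown (DiracFock.supp3x (Ψ 0)) |t| ∧
      DiracFock.supp3y (Ψ t) ⊆ DiracFock.grown (DiracFock.supp3y (Ψ 0)) |t| ∪
        DiracFock.grown (DiracFock.supp3x (Ψ 0)) (|t| + δ) ∧
      DiracFock.supp3 (Ψ t) ⊆ DiracFock.grown (DiracFock.supp3y (Ψ 0)) |t| ∪
        DiracFock.grown (DiracFock.supp3x (Ψ 0)) (|t| + δ)) ∧
    (∀ Ψ₀ : DiracFock.Wave M, DiracFock.SmoothWave Ψ₀ →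
      ∀ Ψ Ψ' : ℝ → DiracFock.Wave M,
        DiracFock.IsStrongSolution mx my δ φ g Ψ → Ψ 0 = Ψ₀ →
        DiracFock.IsStrongSolution mx my δ φ g Ψ' → Ψ' 0 = Ψ₀ → Ψ = Ψ') := by
  refine ⟨fun Ψ h t => ?_, fun Ψ₀ _ Ψ Ψ' h h0 h' h0' =>
    h.eq_of_initial_eq hM hδ.le hφ.continuous hφc h' (h0.trans h0'.symm)⟩
  have hx : DiracFock.supp3x (Ψ t) ⊆ DiracFock.grown (DiracFock.supp3x (Ψ 0)) |t| :=
    DiracFock.supp3x_subset (DiracFock.isClosed_grown isClosed_closure (abs_nonneg t))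
      fun N r s q k hne => h.x_mem_grown hδ.le hφ.continuous hφc hne k
  have hy : DiracFock.supp3y (Ψ t) ⊆ DiracFock.grown (DiracFock.supp3y (Ψ 0)) |t| ∪
      DiracFock.grown (DiracFock.supp3x (Ψ 0)) (|t| + δ) :=
    DiracFock.supp3y_subset
      ((DiracFock.isClosed_grown isClosed_closure (abs_nonneg t)).union
        (DiracFock.isClosed_grown isClosed_closure (by positivity)))
      fun N r s q l hne => h.y_mem_grown hδ.le hφ.continuous hφc hφδ hne l
  refine ⟨hx, hy, Set.union_subset (fun z hz => Or.inr ?_) hy⟩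
  obtain ⟨x, hxs, hxz⟩ := hx hz
  exact ⟨x, hxs, hxz.trans (by linarith)⟩
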